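/- Let $a<b$, $m,d\ge 0$, $1\le p<2$, $\beta>1$, $\gamma>p$, and let $A\in C^\beta(\mathbb R^m,\mathbb R^m)$, $B\in C^\gamma(\mathbb R^m,\mathbb R^{m\times d})$, where $f\in C^\gamma$ means that, with $k$ the largest integer $<\gamma$, $f$ is $k$ times continuously differentiable, its derivatives of orders $0,\dots,k$ are bounded, and the one of order $k$ is $(\gamma-k)$-Hölder continuous. **Decorated paths.** $D[a,b]$ denotes càdlàg functions. Consider functions $\phi:[a,b]\to D([0,1],\mathbb R^n)$ such that $t\mapsto\phi(t)(1)$ is in $D[a,b]$ and there is an at most countable $\Pi\subset[a,b]$ such that $\phi(t)$ is constant for $t\notin\Pi$ and, for each $\varepsilon>0$, only finitely many $t\in\Pi$ have $\sup_s|\phi(t)(s)-\phi(t)(0)|>\varepsilon$; we always take $b\in\Pi$. Enumerate $\Pi=\{t_j:1\le j<\kappa+1\}$ without repetition, put $r=\sum_{j}2^{-j}$ and, for $\delta>0$, $\tau_\delta(t)=t+\sum_j\frac{\delta 2^{-j}}{r}\mathbf 1_{t_j\le t}$, with $\tau_\delta(a^-)=a$. The $\delta$-extension $\phi^\delta:[a,b+\delta]\to\mathbb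 R^n$ is given by $\phi^\delta(\tau_\delta(t))=\phi(t)(1)$ and by $\phi(t_j)$, linearly rescaled, on $[\tau_\delta(t_j^-),\tau_\delta(t_j)]$. Write $|h|_{p\text{-var}}$ for the $p$-variation seminorm. Two functions $\phi_1,\phi_2$ as above are equivalent if for every $t\in[a,b]$ the paths $h_i(s)=\phi_i(t^-)(1)\mathbf 1_{s=0}+\phi_i(t)(s)\mathbf 1_{s>0}$ satisfy $\inf_\rho|h_1\circ\rho-h_2|_\infty=0$, over increasing bijections $\rho$ of $[0,1]$ (with $\phi(a^-)(1):=\phi(a)(0)$). $\mathscr D^{p\text{-var}}([a,b],\mathbb R^n)$ is the set of equivalence classes of those $\phi$ with $|\phi^\delta|_{p\text{-var}}<\infty$, with the distance $$\alpha_{p\text{-var}}(\phi_1,\phi_2)=\lim_{\delta\to0}\ \inf_{\rho}\ \max\bigl\{|\rho-\mathrm{Id}|_\infty,\ |(\phi_1^\delta\circ\rho-\phi_2^\delta)(a)|+|\phi_1^\delta\circ\rho-\phi_2^\delta|_{p\text{-var}}\bigr\},$$ the infimum being over increasing bijections $\rho$ of $[a,b+\delta]$; it does not depend on the representatives, the sets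 $\Pi$ or their enumerations. **Statement.** Let $\mathrm{Id}$ be the identity of $[a,b]$, regarded as the decorated path $t\mapsto(s\mapsto t)$. 1. For every $\xi\in\mathbb R^m$, every representative $\phi$ of an element of $\mathscr D^{p\text{-var}}([a,b],\mathbb R^d)$, every enumerated $\Pi$ and every $\delta>0$, the Young equation $dX^\delta=(A,B)(X^\delta)\,d\omega^\delta$, $X^\delta(a)=\xi$ (left-point integral), with $\omega^\delta$ the $\delta$-extension of $(\mathrm{Id},\phi)$, has a unique solution $X^\delta$ on $[a,b+\delta]$ among càdlàg paths of finite $p$-variation. 2. There is exactly one map $\mathcal S:\mathbb R^m\times\mathscr D^{p\text{-var}}([a,b],\mathbb R^d)\to\mathscr D^{p\text{-var}}([a,b],\mathbb R^m)$ such that, for all these choices, the function $X$ for which $X(t)$ is the linear reparametrisation to $[0,1]$ of $X^\delta|_{[\tau_\delta(t^-),\tau_\delta(t)]}$ represents an element of $\mathscr D^{p\text{-var}}([a,b],\mathbb R^m)$, admits the same $\Pi$, has $X^\delta$ as its $\delta$-extension, and has class $\mathcal S(\xi,[\phi])$. In other words, the solution map $(\xi,\phi)\mapsto X$ of $dX=A(X)\,dt+B(X)\,d\phi$,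 $X(a)=\xi$, is well defined. 3. If $p>1$, then $\mathcal S$ is locally Hölder continuous for $\alpha_{p\text{-var}}$ on both sides: there is $\eta\in(0,1]$ such that every $(\xi_0,\phi_0)$ has $r>0$ and $C<\infty$ with $$\alpha_{p\text{-var}}(\mathcal S(\xi_1,\phi_1),\mathcal S(\xi_2,\phi_2))\le C\bigl(|\xi_1-\xi_2|+\alpha_{p\text{-var}}(\phi_1,\phi_2)\bigr)^\eta$$ whenever $|\xi_i-\xi_0|<r$ and $\alpha_{p\text{-var}}(\phi_i,\phi_0)<r$ for $i=1,2$. -/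

import Mathlib

open Set Filter Topology
open scoped ENNReal NNReal

noncomputable section

/-- `ℝⁿ` with the Euclidean norm. -/
abbrev RSp (n : ℕ) : Type := EuclideanSpace ℝ (Fin n)

/-- Càdlàg on `[a, b]`: right-continuous on `[a, b)`, with left limits on `(a, b]`.
Only the values of `h` on `[a, b]` matter. -/
def IsCadlag {E : Type*} [TopologicalSpace E] (a b : ℝ) (h : ℝ → E) : Prop :=
  (∀ t ∈ Ico a b, Tendsto h (𝓝[>] t) (𝓝 (h t))) ∧
    ∀ t ∈ Ioc a b, ∃ l : E, Tendsto h (𝓝[<] t) (𝓝 l)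

/-- The `p`-variation seminorm of a function on a linearly ordered set, with values in `[0, ∞]`
(weakly increasing finite sequences give the same supremum as partitions). -/
def pVar {T E : Type*} [LinearOrder T] [PseudoEMetricSpace E] (p : ℝ) (f : T → E) : ℝ≥0∞ :=
  ⨆ q : ℕ × {u : ℕ → T // Monotone u},
    (∑ i ∈ Finset.range q.1, edist (f (q.2.1 (i + 1))) (f (q.2.1 i)) ^ p) ^ (1 / p)

/-- The Skorokhod version of the `p`-variation distance on `[a, b]` (here `a ≤ b`): the infimum
over increasing bijections `ρ` of `[a, b]` (automatically continuous) of the maximum of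
`|ρ - Id|_∞` and `|(h₁ ∘ ρ - h₂)(a)| + |h₁ ∘ ρ - h₂|_{p-var}`. Note `ρ a = a`. -/
def sigmaPVar {E : Type*} [NormedAddCommGroup E] (p a b : ℝ) (h₁ h₂ : ℝ → E) : ℝ≥0∞ :=
  ⨅ ρ : Icc a b ≃o Icc a b,
    max (⨆ t : Icc a b, edist (ρ t : ℝ) (t : ℝ))
      (edist (h₁ a) (h₂ a) + pVar p (fun t : Icc a b => h₁ (ρ t) - h₂ t))

/-! ### Decorated paths -/

/-- `P` is an admissible set of marked times for `φ : [a, b] → D[0, 1]`: an at most countable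
subset of `[a, b]` containing all non-stationary times, and such that for each `ε > 0` only
finitely many excursions `φ t`, `t ∈ P`, leave the `ε`-ball about their starting point. -/
structure IsMarkSet {E : Type*} [NormedAddCommGroup E] (a b : ℝ) (φ : ℝ → ℝ → E)
    (P : Set ℝ) : Prop where
  subset : P ⊆ Icc a b
  countable : P.Countable
  stationary : ∀ t ∈ Icc a b, t ∉ P → ∀ s ∈ Icc (0 : ℝ) 1, φ t s = φ t 0
  finite_osc : ∀ ε : ℝ, 0 < ε →
    {t ∈ P | ∃ s ∈ Icc (0 : ℝ) 1, ε < ‖φ t s - φ t 0‖}.Finite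

/-- The functions `φ : [a, b] → D([0, 1], ℝⁿ)` such that `t ↦ φ t 1` is càdlàg and `φ` has an
admissible set of marked times. Only the values on `[a, b] × [0, 1]` matter. -/
structure PreDecPath (a b : ℝ) (n : ℕ) where
  val : ℝ → ℝ → RSp n
  fibre_cadlag : ∀ t ∈ Icc a b, IsCadlag 0 1 (val t)
  end_cadlag : IsCadlag a b (fun t => val t 1)
  exists_markSet : ∃ P : Set ℝ, IsMarkSet a b val P

/-- An enumeration `t₁, t₂, …` without repetition (finite of length `κ`, or infinite, `κ = ⊤`)
of a set of marked times in `[a, b]`; `pts j` is `t_{j+1}` for `j < κ`, and the other values are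
irrelevant. The right end point `b` is always marked (it may carry a constant excursion):
this is no restriction on paths, as `b` can be added to any set of marked times. -/
structure Marks (a b : ℝ) where
  card : ℕ∞
  pts : ℕ → ℝ
  injOn : InjOn pts {j : ℕ | (j : ℕ∞) < card}
  mem_Icc : ∀ j : ℕ, (j : ℕ∞) < card → pts j ∈ Icc a b
  right_mem : b ∈ pts '' {j : ℕ | (j : ℕ∞) < card}

namespace Marks

variable {a b : ℝ}

/-- The set `P` of marked times. -/
def support (e : Marks a b) : Set ℝ := e.pts '' {j : ℕ | (j : ℕ∞) < e.card}

open Classical in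
/-- `2^{-j}` for the `j`-th marked time (counted from `1`), and `0` beyond the last one. -/
def rawWeight (e : Marks a b) (j : ℕ) : ℝ :=
  if (j : ℕ∞) < e.card then (1 / 2 : ℝ) ^ (j + 1) else 0

/-- The normalised weights `2^{-j} / r`, `r = ∑ 2^{-j}`. -/
def weight (e : Marks a b) (j : ℕ) : ℝ := e.rawWeight j / ∑' i, e.rawWeight i

open Classical in
/-- The time change `τ_δ(t) = t + ∑_j (δ 2^{-j} / r) 1_{t_j ≤ t}`. -/
def tau (e : Marks a b) (δ t : ℝ) : ℝ :=
  t + ∑' j, if e.pts j ≤ t then δ * e.weight j else 0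

open Classical in
/-- The left limit `τ_δ(t^-)`, with `τ_δ(a^-) = a`. -/
def tauLeft (e : Marks a b) (δ t : ℝ) : ℝ :=
  t + ∑' j, if e.pts j < t then δ * e.weight j else 0

/-- The left inverse `τ_δ⁻¹(u) = inf {s ∈ [a, b] : τ_δ(s) ≥ u}`, a nondecreasing surjection
`[a, b + δ] → [a, b]`. It is also the `δ`-extension of the trivial lift of the identity. -/
def tauInv (e : Marks a b) (δ u : ℝ) : ℝ := sInf {s ∈ Icc a b | u ≤ e.tau δ s}

open Classical in
/-- The `δ`-extension `φ^δ` on `[a, b + δ]`: the excursion `φ t` is run at linear speed over the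
inserted interval `[τ_δ(t^-), τ_δ(t)]` if `t` is marked, and `φ^δ(τ_δ(t)) = φ t 1`. -/
def ext {E : Type*} (e : Marks a b) (δ : ℝ) (φ : ℝ → ℝ → E) (u : ℝ) : E :=
  φ (e.tauInv δ u)
    (if e.tauLeft δ (e.tauInv δ u) < e.tau δ (e.tauInv δ u) then
      (u - e.tauLeft δ (e.tauInv δ u)) /
        (e.tau δ (e.tauInv δ u) - e.tauLeft δ (e.tauInv δ u))
    else 1)

/-- Collapsing the inserted intervals: `t ↦` the linear reparametrisation to `[0, 1]` of the
restriction of `Y` to `[τ_δ(t^-), τ_δ(t)]`. -/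
def collapse {E : Type*} (e : Marks a b) (δ : ℝ) (Y : ℝ → E) (t s : ℝ) : E :=
  Y (e.tauLeft δ t + s * (e.tau δ t - e.tauLeft δ t))

end Marks

/-- `h₁, h₂ : [0, 1] → E` are reparametrisations of each other:
`inf_ρ |h₁ ∘ ρ - h₂|_∞ = 0` over the increasing bijections `ρ` of `[0, 1]`. -/
def IsReparam {E : Type*} [NormedAddCommGroup E] (h₁ h₂ : ℝ → E) : Prop :=
  ∀ ε : ℝ, 0 < ε → ∃ ρ : Icc (0 : ℝ) 1 ≃o Icc (0 : ℝ) 1,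
    ∀ s : Icc (0 : ℝ) 1, ‖h₁ (ρ s) - h₂ s‖ ≤ ε

theorem IsReparam.refl {E : Type*} [NormedAddCommGroup E] (h : ℝ → E) : IsReparam h h :=
  fun ε hε => ⟨OrderIso.refl _, fun s => by simpa using hε.le⟩

theorem IsReparam.symm {E : Type*} [NormedAddCommGroup E] {h₁ h₂ : ℝ → E}
    (h : IsReparam h₁ h₂) : IsReparam h₂ h₁ := by
  intro ε hε
  obtain ⟨ρ, hρ⟩ := h ε hε
  refine ⟨ρ.symm, fun s => ?_⟩
  have := hρ (ρ.symm s)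
  rwa [OrderIso.apply_symm_apply, norm_sub_rev] at this

theorem IsReparam.trans {E : Type*} [NormedAddCommGroup E] {h₁ h₂ h₃ : ℝ → E}
    (h : IsReparam h₁ h₂) (h' : IsReparam h₂ h₃) : IsReparam h₁ h₃ := by
  intro ε hε
  obtain ⟨ρ, hρ⟩ := h (ε / 2) (by positivity)
  obtain ⟨ρ', hρ'⟩ := h' (ε / 2) (by positivity)
  refine ⟨ρ'.trans ρ, fun s => ?_⟩
  have h1 := hρ (ρ' s)
  have h2 := hρ' s
  have h3 := norm_sub_le_norm_sub_add_norm_sub (h₁ (ρ (ρ' s))) (h₂ (ρ' s)) (h₃ s)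
  simp only [OrderIso.trans_apply]
  linarith

namespace PreDecPath

variable {a b : ℝ} {n : ℕ}

open Classical in
/-- `φ(t^-)(1)`, the left limit at `t` of `u ↦ φ u 1`; at the left end point, `φ a 0`. -/
def leftValue (φ : PreDecPath a b n) (t : ℝ) : RSp n :=
  if t = a then φ.val a 0 else Function.leftLim (fun u => φ.val u 1) t

open Classical in
/-- The path `s ↦ φ(t^-)(1) 1_{s = 0} + φ(t)(s) 1_{s > 0}`. -/
def startedFibre (φ : PreDecPath a b n) (t s : ℝ) : RSp n :=
  if s = 0 then φ.leftValue t else φ.val t s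

/-- `|φ|_{p-var} < ∞`, that is, the `δ`-extensions have finite `p`-variation. -/
def FinitePVar (p : ℝ) (φ : PreDecPath a b n) : Prop :=
  ∀ e : Marks a b, IsMarkSet a b φ.val e.support → ∀ δ : ℝ, 0 < δ →
    pVar p (fun u : Icc a (b + δ) => e.ext δ φ.val u) < ⊤

end PreDecPath

/-- Representatives of decorated paths of finite `p`-variation. -/
def PrePVarPath (p a b : ℝ) (n : ℕ) : Type := {φ : PreDecPath a b n // φ.FinitePVar p}

/-- Two representatives are equivalent if at every time `t ∈ [a, b]` their excursions, started
from the left limits, are reparametrisations of each other. -/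
instance decSetoid (p a b : ℝ) (n : ℕ) : Setoid (PrePVarPath p a b n) where
  r φ₁ φ₂ := ∀ t ∈ Icc a b, IsReparam (φ₁.1.startedFibre t) (φ₂.1.startedFibre t)
  iseqv :=
    { refl := fun _ _ _ => IsReparam.refl _
      symm := fun h t ht => (h t ht).symm
      trans := fun h h' t ht => (h t ht).trans (h' t ht) }

/-- The space of decorated paths `[a, b] → ℝⁿ` of finite `p`-variation. -/
def DecPath (p a b : ℝ) (n : ℕ) : Type := Quotient (decSetoid p a b n)

/-- The class of a representative. -/
def DecPath.mk {p a b : ℝ} {n : ℕ} (φ : PrePVarPath p a b n) : DecPath p a b n :=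
  Quotient.mk _ φ

/-- `lim_{δ → 0} σ_{p-var}(φ₁^δ, φ₂^δ)` for given representatives and given enumerations of marked
times. (The limit exists, so that it is the upper limit.) -/
def alphaRep {a b : ℝ} {n : ℕ} (p : ℝ) (e₁ e₂ : Marks a b) (φ₁ φ₂ : ℝ → ℝ → RSp n) : ℝ≥0∞ :=
  limsup (fun δ : ℝ => sigmaPVar p a (b + δ) (e₁.ext δ φ₁) (e₂.ext δ φ₂)) (𝓝[>] (0 : ℝ))

/-- The metric `α_{p-var}` on decorated paths of finite `p`-variation. The limit
`lim_{δ → 0} σ_{p-var}(φ₁^δ, φ₂^δ)` is the same for all representatives and all enumerated sets of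
marked times; the infimum over all of them picks this common value without making a choice. -/
def alphaPVar {p a b : ℝ} {n : ℕ} (c₁ c₂ : DecPath p a b n) : ℝ≥0∞ :=
  ⨅ (φ₁ : PrePVarPath p a b n) (φ₂ : PrePVarPath p a b n)
    (_ : DecPath.mk φ₁ = c₁) (_ : DecPath.mk φ₂ = c₂)
    (e₁ : Marks a b) (e₂ : Marks a b)
    (_ : IsMarkSet a b φ₁.1.val e₁.support) (_ : IsMarkSet a b φ₂.1.val e₂.support),
    alphaRep p e₁ e₂ φ₁.1.val φ₂.1.val

/-! ### Coefficients and Young differential equations -/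

/-- The class `C^γ`, `γ > 0`: with `k` the largest integer strictly below `γ`, the function is
`k` times continuously differentiable with bounded derivatives of orders `0, …, k`, and the
derivative of order `k` is `(γ - k)`-Hölder continuous. -/
def IsCGamma {E F : Type*} [NormedAddCommGroup E] [NormedSpace ℝ E] [NormedAddCommGroup F]
    [NormedSpace ℝ F] (γ : ℝ) (f : E → F) : Prop :=
  ContDiff ℝ ((⌈γ⌉₊ - 1 : ℕ) : WithTop ℕ∞) f ∧
    ∃ M : ℝ, (∀ i ≤ ⌈γ⌉₊ - 1, ∀ x, ‖iteratedFDeriv ℝ i f x‖ ≤ M) ∧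
      ∀ x y, ‖iteratedFDeriv ℝ (⌈γ⌉₊ - 1) f x - iteratedFDeriv ℝ (⌈γ⌉₊ - 1) f y‖ ≤
        M * ‖x - y‖ ^ (γ - ((⌈γ⌉₊ - 1 : ℕ) : ℝ))

/-- `s = v 0 ≤ v 1 ≤ … ≤ v n = t`. -/
def IsPartition (s t : ℝ) (n : ℕ) (v : ℕ → ℝ) : Prop := Monotone v ∧ v 0 = s ∧ v n = t

/-- The Young integral `∫_s^t Y(r^-) dω(r)` exists and equals `I`: it is the limit, along
refinements of partitions, of the left-point sums `∑ Y(v_i) (ω(v_{i+1}) - ω(v_i))`. -/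
def HasYoungIntegral {E F : Type*} [NormedAddCommGroup E] [NormedSpace ℝ E]
    [NormedAddCommGroup F] [NormedSpace ℝ F] (Y : ℝ → E →L[ℝ] F) (ω : ℝ → E) (s t : ℝ) (I : F) :
    Prop :=
  ∀ ε : ℝ, 0 < ε → ∃ (n : ℕ) (v : ℕ → ℝ), IsPartition s t n v ∧
    ∀ (k : ℕ) (w : ℕ → ℝ), IsPartition s t k w → (∀ i ≤ n, ∃ j ≤ k, w j = v i) →
      ‖(∑ i ∈ Finset.range k, Y (w i) (ω (w (i + 1)) - ω (w i))) - I‖ < ε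

/-- The vector field `(A, B)`: `(A, B)(x)(λ, y) = λ A(x) + B(x) y`. -/
def jointField {m d : ℕ} (A : RSp m → RSp m) (B : RSp m → RSp d →L[ℝ] RSp m) (x : RSp m) :
    ℝ × RSp d →L[ℝ] RSp m :=
  (ContinuousLinearMap.fst ℝ ℝ (RSp d)).smulRight (A x) +
    (B x).comp (ContinuousLinearMap.snd ℝ ℝ (RSp d))

/-- `Y ∈ D^{p-var}([a, b], ℝᵐ)` solves the Young equation `dY = (A, B)(Y) dω`, `Y(a) = ξ`, on
`[a, b]`. -/
def IsYoungSolution {m d : ℕ} (p a b : ℝ) (A : RSp m → RSp m) (B : RSp m → RSp d →L[ℝ] RSp m)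
    (ξ : RSp m) (ω : ℝ → ℝ × RSp d) (Y : ℝ → RSp m) : Prop :=
  IsCadlag a b Y ∧ pVar p (fun u : Icc a b => Y u) < ⊤ ∧
    ∀ t ∈ Icc a b, HasYoungIntegral (fun r => jointField A B (Y r)) ω a t (Y t - ξ)

/-- `Y = X^δ`: it solves `dX^δ = (A, B)(X^δ) dω^δ`, `X^δ(a) = ξ`, on `[a, b + δ]`, where `ω^δ` is
the `δ`-extension of `(ι Id, φ)`. -/
def IsExtSolution {m d : ℕ} {a b : ℝ} (p : ℝ) (A : RSp m → RSp m)
    (B : RSp m → RSp d →L[ℝ] RSp m) (ξ : RSp m) (φ : ℝ → ℝ → RSp d) (e : Marks a b) (δ : ℝ)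
    (Y : ℝ → RSp m) : Prop :=
  IsYoungSolution p a (b + δ) A B ξ (e.ext δ (fun t s => (t, φ t s))) Y

/-- `S` is the solution map `(ξ, φ) ↦ X` of `dX = A(X) dt + B(X) dφ`, `X(a) = ξ`: whichever
representative of the driver, enumerated set of marked times `P`, length `δ > 0`, and solution
`X^δ` of the extended equation are taken, collapsing the inserted intervals gives a decorated path
`X` of finite `p`-variation, with `P` as a set of marked times and `X^δ` as its `δ`-extension, whose
class is `S ξ [φ]`. -/
def IsSolutionMap {m d : ℕ} {p a b : ℝ} (A : RSp m → RSp m) (B : RSp m → RSp d →L[ℝ] RSp m)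
    (S : RSp m → DecPath p a b d → DecPath p a b m) : Prop :=
  ∀ (ξ : RSp m) (φ : PrePVarPath p a b d) (e : Marks a b), IsMarkSet a b φ.1.val e.support →
    ∀ δ : ℝ, 0 < δ → ∀ Y : ℝ → RSp m, IsExtSolution p A B ξ φ.1.val e δ Y →
      ∃ X : PrePVarPath p a b m,
        (∀ t ∈ Icc a b, ∀ s ∈ Icc (0 : ℝ) 1, X.1.val t s = e.collapse δ Y t s) ∧
        IsMarkSet a b X.1.val e.support ∧
        EqOn (e.ext δ X.1.val) Y (Icc a (b + δ)) ∧
        DecPath.mk X = S ξ (DecPath.mk φ)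

end

/-!
# Canonical differential equations driven by decorated paths of finite `p`-variation

For a driver `φ` and marked times `e` the extended equation is a Young equation
`dY = f(Y) dω`, `ω = (Id, φ)^δ`, on `[a, b + δ]`, whose driver is càdlàg of finite `p`-variation
and has a monotone first component `π ∘ ω`. The vector field is `f(y) u = π(u) A(y) + B(y) u`, with
`A` Lipschitz and `B` satisfying a four-point estimate of exponent `α = min (γ - 1) 1 > p - 1`
(`exists_isYoungField`).

*Young equations.* Everything rests on one estimate for perturbed Euler schemes on finite
sequences (`euler_stability`): the variation of the difference of two schemes is at most a constant,
depending only on the field and on bounds for the drivers, times the difference of the initial values plus the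
variations of the differences of the drivers and of the perturbations. On a window where the driver
is small this is the discrete Young–Loève inequality (`young_loeve`, from `discrete_sewing`) with
the four-point estimate; the term with `A`, which has no four-point estimate, is handled by the
monotonicity of `π ∘ ω`; large jumps are isolated in single steps, so that the
number of windows is bounded. A solution sampled along a fine partition is an Euler scheme with
small perturbation, since the Young integral is a limit along refinements of partitions; this gives
`young_stability` in `p`-variation, hence uniqueness. For existence, approximate the driver
uniformly by step functions, for which the equation is an Euler recursion: the approximations are
Cauchy in `q`-variation for some `q > p` and the limit solves the equation
(`exists_solvesYoung`).

*The solution map is well defined.* A monotone surjection of time intervals maps solutions to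
solutions (`IsTimeChange.solvesYoung_comp`). Two extensions of one path for different
marked times or different `δ` differ by time changes from a common refinement, so by uniqueness the
collapsed solutions coincide (`IsYoungCoeff.collapse_eq`). If two drivers are equivalent, then up to
time changes their extensions are uniformly as close as desired while their `p`-variation is
bounded, so they are close in `q`-variation, `q > p`, and stability in `q`-variation makes the
collapsed solutions reparametrisations of each other (`IsYoungCoeff.isReparam`).

*Hölder continuity.* If `α_{p-var}(φ₁, φ₂) < s`, then for small `δ` there is a bijection `ρ` with
`|ρ - Id| ≤ s` under which the extended `φ`'s are `s`-close in `p`-variation, while the time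
components are uniformly `2s`-close and of `1`-variation at most `b - a`. By interpolation the
latter are of order `s ^ (1 - 1 / p)` apart in `p`-variation, and stability passes this on to
the solutions (`IsYoungCoeff.exists_sigmaPVar_le`).
-/

noncomputable section

/-! ### Variation of functions and of two-parameter functions -/

/-- The `p`-th powers of `ν` add up to at most `C ^ p` along every weakly increasing finite
sequence in `s`. For `ν x y = ‖f y - f x‖` this says that `f` has `p`-variation at most `C`. -/
def SumLE {α : Type*} [LinearOrder α] (p : ℝ) (ν : α → α → ℝ) (s : Set α) (C : ℝ) : Prop :=
  ∀ (n : ℕ) (u : ℕ → α), Monotone u → (∀ i, u i ∈ s) →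
    ∑ i ∈ Finset.range n, ν (u i) (u (i + 1)) ^ p ≤ C ^ p

/-- The `p`-variation of `f` on `s` as a real number; it is meaningful under `HasFinVar`. -/
def varNorm {α E : Type*} [LinearOrder α] [NormedAddCommGroup E] (p : ℝ) (f : α → E)
    (s : Set α) : ℝ := (pVar p (fun u : s => f u)).toReal

/-- `f` has finite `p`-variation on `s`. -/
def HasFinVar {α E : Type*} [LinearOrder α] [NormedAddCommGroup E] (p : ℝ) (f : α → E)
    (s : Set α) : Prop := pVar p (fun u : s => f u) < ⊤

section Variation

variable {α β E F : Type*} [LinearOrder α] [LinearOrder β] [NormedAddCommGroup E]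
  [NormedAddCommGroup F] {p q C D : ℝ} {f g : α → E} {s t : Set α}

theorem SumLE.mono_left {ν μ : α → α → ℝ} (hp : 0 ≤ p) (h0 : ∀ x ∈ s, ∀ y ∈ s, x ≤ y → 0 ≤ ν x y)
    (h : ∀ x ∈ s, ∀ y ∈ s, x ≤ y → ν x y ≤ μ x y) (hμ : SumLE p μ s C) : SumLE p ν s C :=
  fun n u hu hs => (Finset.sum_le_sum fun i _ => Real.rpow_le_rpow
    (h0 _ (hs _) _ (hs _) (hu (Nat.le_succ i))) (h _ (hs _) _ (hs _) (hu (Nat.le_succ i))) hp).trans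
    (hμ n u hu hs)

theorem SumLE.mono_right {ν : α → α → ℝ} (hp : 0 ≤ p) (hC : 0 ≤ C) (hCD : C ≤ D)
    (h : SumLE p ν s C) : SumLE p ν s D :=
  fun n u hu hs => (h n u hu hs).trans (Real.rpow_le_rpow hC hCD hp)

theorem SumLE.const_mul {ν : α → α → ℝ} (hC : 0 ≤ C) (hD : 0 ≤ D)
    (h0 : ∀ x ∈ s, ∀ y ∈ s, x ≤ y → 0 ≤ ν x y) (h : SumLE p ν s C) :
    SumLE p (fun x y => D * ν x y) s (D * C) := fun n u hu hs => by
  rw [Real.mul_rpow hD hC]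
  calc ∑ i ∈ Finset.range n, (D * ν (u i) (u (i + 1))) ^ p
      = D ^ p * ∑ i ∈ Finset.range n, ν (u i) (u (i + 1)) ^ p := by
        rw [Finset.mul_sum]
        exact Finset.sum_congr rfl fun i _ =>
          Real.mul_rpow hD (h0 _ (hs _) _ (hs _) (hu (Nat.le_succ i)))
    _ ≤ _ := mul_le_mul_of_nonneg_left (h n u hu hs) (Real.rpow_nonneg hD _)

/-- Minkowski's inequality. -/
theorem SumLE.add {ν μ : α → α → ℝ} (hp : 1 ≤ p) (hC : 0 ≤ C) (hD : 0 ≤ D)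
    (h0 : ∀ x ∈ s, ∀ y ∈ s, x ≤ y → 0 ≤ ν x y) (h0' : ∀ x ∈ s, ∀ y ∈ s, x ≤ y → 0 ≤ μ x y)
    (h : SumLE p ν s C) (h' : SumLE p μ s D) :
    SumLE p (fun x y => ν x y + μ x y) s (C + D) := fun n u hu hs => by
  have hp0 : 0 < p := by linarith
  have a0 : ∀ i ∈ Finset.range n, 0 ≤ ν (u i) (u (i + 1)) := fun i _ =>
    h0 _ (hs _) _ (hs _) (hu (Nat.le_succ i))
  have b0 : ∀ i ∈ Finset.range n, 0 ≤ μ (u i) (u (i + 1)) := fun i _ =>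
    h0' _ (hs _) _ (hs _) (hu (Nat.le_succ i))
  have key := Real.Lp_add_le_of_nonneg (Finset.range n) hp a0 b0
  have e1 : (∑ i ∈ Finset.range n, ν (u i) (u (i + 1)) ^ p) ^ (1 / p) ≤ C := by
    rw [one_div, Real.rpow_inv_le_iff_of_pos (Finset.sum_nonneg fun i hi =>
      Real.rpow_nonneg (a0 i hi) _) hC hp0]
    exact h n u hu hs
  have e2 : (∑ i ∈ Finset.range n, μ (u i) (u (i + 1)) ^ p) ^ (1 / p) ≤ D := by
    rw [one_div, Real.rpow_inv_le_iff_of_pos (Finset.sum_nonneg fun i hi =>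
      Real.rpow_nonneg (b0 i hi) _) hD hp0]
    exact h' n u hu hs
  have e3 := key.trans (add_le_add e1 e2)
  rwa [one_div, Real.rpow_inv_le_iff_of_pos (Finset.sum_nonneg fun i hi =>
      Real.rpow_nonneg (add_nonneg (a0 i hi) (b0 i hi)) _) (add_nonneg hC hD) hp0] at e3

theorem sum_rpow_le_rpow_sum {ι : Type*} (S : Finset ι) (a : ι → ℝ) (ha : ∀ i ∈ S, 0 ≤ a i)
    (hp : 1 ≤ p) : ∑ i ∈ S, a i ^ p ≤ (∑ i ∈ S, a i) ^ p := by
  classical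
  induction S using Finset.induction_on with
  | empty => simp [Real.zero_rpow (by linarith : p ≠ 0)]
  | insert i S hi ih =>
    rw [Finset.sum_insert hi, Finset.sum_insert hi]
    have h1 := ih fun j hj => ha j (Finset.mem_insert_of_mem hj)
    have h2 := Real.add_rpow_le_rpow_add (ha i (Finset.mem_insert_self _ _))
      (Finset.sum_nonneg fun j hj => ha j (Finset.mem_insert_of_mem hj)) hp
    linarith

theorem sumLE_of_monotone {G : α → ℝ} (hp : 1 ≤ p)
    (hG : ∀ x ∈ s, ∀ y ∈ s, x ≤ y → G x ≤ G y) (hD : ∀ x ∈ s, ∀ y ∈ s, G y - G x ≤ D) :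
    SumLE p (fun x y => G y - G x) s D := fun n u hu hs => by
  have h0 : ∀ i ∈ Finset.range n, 0 ≤ G (u (i + 1)) - G (u i) := fun i _ =>
    sub_nonneg.2 (hG _ (hs _) _ (hs _) (hu (Nat.le_succ i)))
  refine (sum_rpow_le_rpow_sum _ _ h0 hp).trans ?_
  have := Finset.sum_nonneg h0
  rw [Finset.sum_range_sub (fun i => G (u i))] at this ⊢
  exact Real.rpow_le_rpow this (hD _ (hs _) _ (hs _)) (by linarith)

theorem pVar_le_ofReal_iff (hp : 0 < p) (hC : 0 ≤ C) :
    pVar p (fun u : s => f u) ≤ ENNReal.ofReal C ↔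
      SumLE p (fun x y => ‖f y - f x‖) s C := by
  have key : ∀ (n : ℕ) (u : ℕ → α),
      (∑ i ∈ Finset.range n, edist (f (u (i + 1))) (f (u i)) ^ p) ^ (1 / p) ≤ ENNReal.ofReal C ↔
      ∑ i ∈ Finset.range n, ‖f (u (i + 1)) - f (u i)‖ ^ p ≤ C ^ p := by
    intro n u
    rw [one_div, ENNReal.rpow_inv_le_iff hp, ENNReal.ofReal_rpow_of_nonneg hC hp.le,
      ← ENNReal.ofReal_le_ofReal_iff (Real.rpow_nonneg hC _),
      ENNReal.ofReal_sum_of_nonneg (fun i _ => Real.rpow_nonneg (norm_nonneg _) _)]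
    refine Iff.of_eq (congrArg (· ≤ _) (Finset.sum_congr rfl fun i _ => ?_))
    rw [edist_dist, dist_eq_norm, ENNReal.ofReal_rpow_of_nonneg (norm_nonneg _) hp.le]
  unfold pVar
  rw [iSup_le_iff]
  constructor
  · intro h n u hu hs
    exact (key n u).1 (h (n, ⟨fun i => ⟨u i, hs i⟩, fun i j hij => hu hij⟩))
  · rintro h ⟨n, u, hu⟩
    exact (key n fun i => u i).2 (h n (fun i => u i) (fun i j hij => hu hij) fun i => (u i).2)

theorem varNorm_nonneg : 0 ≤ varNorm p f s := ENNReal.toReal_nonneg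

theorem SumLE.hasFinVar (hp : 0 < p) (hC : 0 ≤ C) (h : SumLE p (fun x y => ‖f y - f x‖) s C) :
    HasFinVar p f s :=
  ((pVar_le_ofReal_iff hp hC).2 h).trans_lt ENNReal.ofReal_lt_top

theorem SumLE.varNorm_le (hp : 0 < p) (hC : 0 ≤ C) (h : SumLE p (fun x y => ‖f y - f x‖) s C) :
    varNorm p f s ≤ C :=
  ENNReal.toReal_le_of_le_ofReal hC ((pVar_le_ofReal_iff hp hC).2 h)

theorem HasFinVar.sumLE (hp : 0 < p) (h : HasFinVar p f s) :
    SumLE p (fun x y => ‖f y - f x‖) s (varNorm p f s) :=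
  (pVar_le_ofReal_iff hp varNorm_nonneg).1 (ENNReal.le_ofReal_iff_toReal_le h.ne
    varNorm_nonneg |>.2 le_rfl)

/-- `varNorm ^ p` is the least upper bound of the variation sums. -/
theorem varNorm_rpow_le (hp : 0 < p) (hC : 0 ≤ C)
    (h : ∀ (n : ℕ) (u : ℕ → α), Monotone u → (∀ i, u i ∈ s) →
      ∑ i ∈ Finset.range n, ‖f (u (i + 1)) - f (u i)‖ ^ p ≤ C) : varNorm p f s ^ p ≤ C := by
  have h1 : SumLE p (fun x y => ‖f y - f x‖) s (C ^ p⁻¹) := fun n u hu hs => by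
    rw [Real.rpow_inv_rpow hC hp.ne']
    exact h n u hu hs
  have := Real.rpow_le_rpow varNorm_nonneg (h1.varNorm_le hp (Real.rpow_nonneg hC _)) hp.le
  rwa [Real.rpow_inv_rpow hC hp.ne'] at this

theorem HasFinVar.norm_sub_le (hp : 0 < p) (h : HasFinVar p f s) {x y : α} (hx : x ∈ s)
    (hy : y ∈ s) : ‖f y - f x‖ ≤ varNorm p f s := by
  wlog hxy : x ≤ y generalizing x y
  · rw [norm_sub_rev]
    exact this hy hx (le_of_not_ge hxy)
  have := h.sumLE hp 1 (fun i => if i = 0 then x else y)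
    (by
      intro i j hij
      by_cases hi : i = 0
      · by_cases hj : j = 0 <;> simp [hi, hj, hxy]
      · have hj : j ≠ 0 := by omega
        simp [hi, hj])
    (by intro i; by_cases hi : i = 0 <;> simp [hi, hx, hy])
  simp only [Finset.sum_range_one, if_true, zero_add, one_ne_zero, if_false] at this
  exact (Real.rpow_le_rpow_iff (norm_nonneg _) varNorm_nonneg hp).1 this

theorem HasFinVar.mono (hp : 0 < p) (h : HasFinVar p f t) (hst : s ⊆ t) : HasFinVar p f s :=
  SumLE.hasFinVar (C := varNorm p f t) hp varNorm_nonneg fun n u hu hs =>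
    h.sumLE hp n u hu fun i => hst (hs i)

theorem HasFinVar.varNorm_mono (hp : 0 < p) (h : HasFinVar p f t) (hst : s ⊆ t) :
    varNorm p f s ≤ varNorm p f t :=
  SumLE.varNorm_le hp varNorm_nonneg fun n u hu hs => h.sumLE hp n u hu fun i => hst (hs i)

/-- Superadditivity of the `p`-th power of the `p`-variation. -/
theorem varNorm_superadd (hp : 0 < p) {w : Set α} (hs : s ⊆ w) (ht : t ⊆ w)
    (hst : ∀ x ∈ s, ∀ y ∈ t, x ≤ y) (hw : HasFinVar p f w) :
    varNorm p f s ^ p + varNorm p f t ^ p ≤ varNorm p f w ^ p := by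
  have hws := hw.mono hp hs
  have hwt := hw.mono hp ht
  have le_s := Real.rpow_le_rpow varNorm_nonneg (hw.varNorm_mono hp hs) hp.le
  have le_t := Real.rpow_le_rpow varNorm_nonneg (hw.varNorm_mono hp ht) hp.le
  suffices H : varNorm p f s ^ p ≤ varNorm p f w ^ p - varNorm p f t ^ p by linarith
  refine varNorm_rpow_le hp (by linarith) fun n u hu hus => ?_
  suffices H : varNorm p f t ^ p ≤ varNorm p f w ^ p -
      ∑ i ∈ Finset.range n, ‖f (u (i + 1)) - f (u i)‖ ^ p by linarith
  refine varNorm_rpow_le hp (by linarith [hws.sumLE hp n u hu hus]) fun m v hv hvt => ?_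
  have hcat : Monotone (fun i => if i ≤ n then u i else v (i - (n + 1))) := by
    intro i j hij
    by_cases hi : i ≤ n
    · by_cases hj : j ≤ n
      · simpa [hi, hj] using hu hij
      · simpa [hi, hj] using hst _ (hus i) _ (hvt _)
    · have hj : ¬ j ≤ n := by omega
      simpa [hi, hj] using hv (by omega)
  have := hw.sumLE hp (n + 1 + m) _ hcat (by
    intro i
    by_cases hi : i ≤ n
    · simpa [hi] using hs (hus i)
    · simpa [hi] using ht (hvt _))
  rw [Finset.sum_range_add, Finset.sum_range_succ] at this
  have e1 : ∑ i ∈ Finset.range n, ‖f (if i + 1 ≤ n then u (i + 1) else v (i + 1 - (n + 1))) -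
      f (if i ≤ n then u i else v (i - (n + 1)))‖ ^ p =
      ∑ i ∈ Finset.range n, ‖f (u (i + 1)) - f (u i)‖ ^ p := by
    refine Finset.sum_congr rfl fun i hi => ?_
    have := Finset.mem_range.1 hi
    rw [if_pos (by omega), if_pos (by omega)]
  have e2 : ∑ i ∈ Finset.range m,
      ‖f (if n + 1 + i + 1 ≤ n then u (n + 1 + i + 1) else v (n + 1 + i + 1 - (n + 1))) -
      f (if n + 1 + i ≤ n then u (n + 1 + i) else v (n + 1 + i - (n + 1)))‖ ^ p =
      ∑ i ∈ Finset.range m, ‖f (v (i + 1)) - f (v i)‖ ^ p := by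
    refine Finset.sum_congr rfl fun i hi => ?_
    rw [if_neg (by omega), if_neg (by omega)]
    congr 5 <;> omega
  rw [e1, e2] at this
  have : 0 ≤ ‖f (if n + 1 ≤ n then u (n + 1) else v (n + 1 - (n + 1))) -
      f (if n ≤ n then u n else v (n - (n + 1)))‖ ^ p := Real.rpow_nonneg (norm_nonneg _) _
  linarith

/-- Summing a superadditive function along an increasing sequence. -/
theorem sum_superadditive_le {κ : α → α → ℝ} (h0 : ∀ x ∈ s, 0 ≤ κ x x)
    (h : ∀ x ∈ s, ∀ y ∈ s, ∀ z ∈ s, x ≤ y → y ≤ z → κ x y + κ y z ≤ κ x z) (u : ℕ → α)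
    (hu : Monotone u) (hs : ∀ i, u i ∈ s) (n : ℕ) :
    ∑ i ∈ Finset.range n, κ (u i) (u (i + 1)) ≤ κ (u 0) (u n) := by
  induction n with
  | zero => simpa using h0 _ (hs 0)
  | succ n ih =>
    rw [Finset.sum_range_succ]
    have := h _ (hs 0) _ (hs n) _ (hs (n + 1)) (hu (Nat.zero_le n)) (hu (Nat.le_succ n))
    linarith

/-- The `p`-variation over the intervals `[x, y]`, which add up. -/
theorem HasFinVar.sumLE_varNorm (hp : 0 < p) (h : HasFinVar p f s) [OrdConnected s] :
    SumLE p (fun x y => varNorm p f (Icc x y)) s (varNorm p f s) := fun n u hu hs => by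
  have key := sum_superadditive_le (s := s) (κ := fun x y => varNorm p f (Icc x y) ^ p)
    (fun x _ => Real.rpow_nonneg varNorm_nonneg _)
    (fun x hx y _ z hz hxy hyz => varNorm_superadd hp (Icc_subset_Icc_right hyz)
      (Icc_subset_Icc_left hxy) (fun a ha b hb => ha.2.trans hb.1)
      (h.mono hp (OrdConnected.out ‹s.OrdConnected› hx hz))) u hu hs n
  exact key.trans (Real.rpow_le_rpow varNorm_nonneg
    (h.varNorm_mono hp (OrdConnected.out ‹s.OrdConnected› (hs 0) (hs n))) hp.le)

/-- A function dominated by the variation of another one on each interval. -/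
theorem HasFinVar.sumLE_of_le (hp : 0 < p) [OrdConnected s] {g : α → F}
    (h : HasFinVar p f s) (hC : 0 ≤ C)
    (hg : ∀ x ∈ s, ∀ y ∈ s, x ≤ y → ‖g y - g x‖ ≤ C * varNorm p f (Icc x y)) :
    SumLE p (fun x y => ‖g y - g x‖) s (C * varNorm p f s) :=
  SumLE.mono_left hp.le (fun _ _ _ _ _ => norm_nonneg _) hg
    (SumLE.const_mul varNorm_nonneg hC (fun _ _ _ _ _ => varNorm_nonneg) (h.sumLE_varNorm hp))

theorem SumLE.norm_add (hp : 1 ≤ p) (hC : 0 ≤ C) (hD : 0 ≤ D)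
    (hf : SumLE p (fun x y => ‖f y - f x‖) s C) (hg : SumLE p (fun x y => ‖g y - g x‖) s D) :
    SumLE p (fun x y => ‖(f y + g y) - (f x + g x)‖) s (C + D) :=
  SumLE.mono_left (by linarith) (fun _ _ _ _ _ => norm_nonneg _)
    (fun x _ y _ _ => by
      rw [add_sub_add_comm]
      exact norm_add_le _ _)
    (SumLE.add hp hC hD (fun _ _ _ _ _ => norm_nonneg _) (fun _ _ _ _ _ => norm_nonneg _) hf hg)

theorem SumLE.norm_neg (hf : SumLE p (fun x y => ‖f y - f x‖) s C) :
    SumLE p (fun x y => ‖(- f y) - (- f x)‖) s C := by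
  have : (fun x y => ‖(- f y) - (- f x)‖) = fun x y => ‖f y - f x‖ := by
    funext x y
    rw [neg_sub_neg, norm_sub_rev]
  rwa [this]

theorem SumLE.norm_sub (hp : 1 ≤ p) (hC : 0 ≤ C) (hD : 0 ≤ D)
    (hf : SumLE p (fun x y => ‖f y - f x‖) s C) (hg : SumLE p (fun x y => ‖g y - g x‖) s D) :
    SumLE p (fun x y => ‖(f y - g y) - (f x - g x)‖) s (C + D) := by
  simpa only [sub_eq_add_neg] using hf.norm_add hp hC hD hg.norm_neg

theorem HasFinVar.sub (hp : 1 ≤ p) (hf : HasFinVar p f s) (hg : HasFinVar p g s) :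
    HasFinVar p (fun x => f x - g x) s :=
  ((hf.sumLE (by linarith)).norm_sub hp varNorm_nonneg varNorm_nonneg
    (hg.sumLE (by linarith))).hasFinVar (by linarith) (add_nonneg varNorm_nonneg varNorm_nonneg)

theorem HasFinVar.varNorm_sub_le (hp : 1 ≤ p) (hf : HasFinVar p f s) (hg : HasFinVar p g s) :
    varNorm p (fun x => f x - g x) s ≤ varNorm p f s + varNorm p g s :=
  ((hf.sumLE (by linarith)).norm_sub hp varNorm_nonneg varNorm_nonneg
    (hg.sumLE (by linarith))).varNorm_le (by linarith) (add_nonneg varNorm_nonneg varNorm_nonneg)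

theorem SumLE.congr (h : SumLE p (fun x y => ‖f y - f x‖) s C) (hfg : EqOn g f s) :
    SumLE p (fun x y => ‖g y - g x‖) s C := fun n u hu hs => by
  simpa only [hfg (hs _)] using h n u hu hs

theorem HasFinVar.congr (hp : 0 < p) (h : HasFinVar p f s) (hfg : EqOn g f s) :
    HasFinVar p g s := ((h.sumLE hp).congr hfg).hasFinVar hp varNorm_nonneg

theorem varNorm_congr (hfg : EqOn g f s) : varNorm p g s = varNorm p f s := by
  unfold varNorm
  congr 2
  funext u
  exact hfg u.2

theorem SumLE.lipschitz_comp (hp : 0 < p) (hC : 0 ≤ C) (hD : 0 ≤ D) {Φ : E → F}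
    (hΦ : ∀ x ∈ s, ∀ y ∈ s, ‖Φ (f y) - Φ (f x)‖ ≤ D * ‖f y - f x‖)
    (h : SumLE p (fun x y => ‖f y - f x‖) s C) :
    SumLE p (fun x y => ‖Φ (f y) - Φ (f x)‖) s (D * C) :=
  SumLE.mono_left hp.le (fun _ _ _ _ _ => norm_nonneg _) (fun x hx y hy _ => hΦ x hx y hy)
    (SumLE.const_mul hC hD (fun _ _ _ _ _ => norm_nonneg _) h)

theorem SumLE.comp {w : β → α} {r : Set β} (hw : MonotoneOn w r) (hm : MapsTo w r s)
    (h : SumLE p (fun x y => ‖f y - f x‖) s C) :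
    SumLE p (fun x y => ‖f (w y) - f (w x)‖) r C := fun n u hu hs =>
  h n (fun i => w (u i)) (fun _ _ hij => hw (hs _) (hs _) (hu hij)) fun i => hm (hs i)

theorem HasFinVar.comp (hp : 0 < p) {w : β → α} {r : Set β} (hw : MonotoneOn w r)
    (hm : MapsTo w r s) (h : HasFinVar p f s) : HasFinVar p (fun x => f (w x)) r :=
  ((h.sumLE hp).comp hw hm).hasFinVar hp varNorm_nonneg

theorem HasFinVar.varNorm_comp_le (hp : 0 < p) {w : β → α} {r : Set β} (hw : MonotoneOn w r)
    (hm : MapsTo w r s) (h : HasFinVar p f s) :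
    varNorm p (fun x => f (w x)) r ≤ varNorm p f s :=
  ((h.sumLE hp).comp hw hm).varNorm_le hp varNorm_nonneg

/-- A monotone surjection does not change the variation. -/
theorem SumLE.of_comp {w : β → α} {r : Set β} (hw : MonotoneOn w r) (hm : SurjOn w r s)
    (h : SumLE p (fun x y => ‖f (w y) - f (w x)‖) r C) :
    SumLE p (fun x y => ‖f y - f x‖) s C := fun n u hu hs => by
  have : Nonempty β := let ⟨y, _⟩ := hm (hs 0); ⟨y⟩
  have hm' : ∀ x, x ∈ s → ∃ y, y ∈ r ∧ w y = x := fun x hx => hm hx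
  choose! g hg hwg using hm'
  have hgm : Monotone fun i => g (u i) := by
    intro i j hij
    rcases (hu hij).eq_or_lt with h1 | h1
    · simp only [h1]; exact le_rfl
    · by_contra hc
      have := hw (hg _ (hs j)) (hg _ (hs i)) (not_le.1 hc).le
      rw [hwg _ (hs j), hwg _ (hs i)] at this
      exact absurd h1 (not_lt.2 this)
  have := h n (fun i => g (u i)) hgm fun i => hg _ (hs i)
  simpa only [hwg _ (hs _)] using this

theorem HasFinVar.of_comp (hp : 0 < p) {w : β → α} {r : Set β} (hw : MonotoneOn w r)
    (hm : SurjOn w r s) (h : HasFinVar p (fun x => f (w x)) r) : HasFinVar p f s :=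
  ((h.sumLE hp).of_comp hw hm).hasFinVar hp varNorm_nonneg

theorem varNorm_comp_eq (hp : 0 < p) {w : β → α} {r : Set β} (hw : MonotoneOn w r)
    (hm : SurjOn w r s) (hm' : MapsTo w r s) (h : HasFinVar p f s) :
    varNorm p (fun x => f (w x)) r = varNorm p f s :=
  le_antisymm (h.varNorm_comp_le hp hw hm')
    ((((h.comp hp hw hm').sumLE hp).of_comp hw hm).varNorm_le hp varNorm_nonneg)

/-- Interpolation between the uniform norm and the `p`-variation. -/
theorem SumLE.interpolate {ν : α → α → ℝ} (hp : 0 < p) (hpq : p ≤ q) (hC : 0 ≤ C) (hD : 0 ≤ D)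
    (h0 : ∀ x ∈ s, ∀ y ∈ s, x ≤ y → 0 ≤ ν x y) (hν : ∀ x ∈ s, ∀ y ∈ s, x ≤ y → ν x y ≤ D)
    (h : SumLE p ν s C) : SumLE q ν s (D ^ (1 - p / q) * C ^ (p / q)) := fun n u hu hs => by
  have hq : 0 < q := hp.trans_le hpq
  have e : (D ^ (1 - p / q) * C ^ (p / q)) ^ q = D ^ (q - p) * C ^ p := by
    rw [Real.mul_rpow (Real.rpow_nonneg hD _) (Real.rpow_nonneg hC _), ← Real.rpow_mul hD,
      ← Real.rpow_mul hC]
    congr 2 <;> field_simp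
  rw [e]
  calc ∑ i ∈ Finset.range n, ν (u i) (u (i + 1)) ^ q
      ≤ ∑ i ∈ Finset.range n, D ^ (q - p) * ν (u i) (u (i + 1)) ^ p := by
        refine Finset.sum_le_sum fun i _ => ?_
        have hi := h0 _ (hs _) _ (hs _) (hu (Nat.le_succ i))
        have hi' := hν _ (hs _) _ (hs _) (hu (Nat.le_succ i))
        have : ν (u i) (u (i + 1)) ^ q =
            ν (u i) (u (i + 1)) ^ (q - p) * ν (u i) (u (i + 1)) ^ p := by
          rw [← Real.rpow_add_of_nonneg hi (by linarith) hp.le]; congr 1; ring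
        rw [this]
        exact mul_le_mul_of_nonneg_right (Real.rpow_le_rpow hi hi' (by linarith))
          (Real.rpow_nonneg hi _)
    _ ≤ _ := by
        rw [← Finset.mul_sum]
        exact mul_le_mul_of_nonneg_left (h n u hu hs) (Real.rpow_nonneg hD _)

theorem HasFinVar.sumLE_exponent (hp : 0 < p) (hpq : p ≤ q) (h : HasFinVar p f s) :
    SumLE q (fun x y => ‖f y - f x‖) s (varNorm p f s) := by
  have hq : 0 < q := hp.trans_le hpq
  have := SumLE.interpolate (D := varNorm p f s) hp hpq varNorm_nonneg varNorm_nonneg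
    (fun _ _ _ _ _ => norm_nonneg _) (fun x hx y hy _ => h.norm_sub_le hp hx hy) (h.sumLE hp)
  rwa [← Real.rpow_add_of_nonneg varNorm_nonneg (by
    rw [sub_nonneg, div_le_one hq]; exact hpq) (by positivity), sub_add_cancel,
    Real.rpow_one] at this

theorem HasFinVar.exponent_mono (hp : 0 < p) (hpq : p ≤ q) (h : HasFinVar p f s) :
    HasFinVar q f s := (h.sumLE_exponent hp hpq).hasFinVar (hp.trans_le hpq) varNorm_nonneg

theorem HasFinVar.varNorm_exponent_mono (hp : 0 < p) (hpq : p ≤ q) (h : HasFinVar p f s) :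
    varNorm q f s ≤ varNorm p f s :=
  (h.sumLE_exponent hp hpq).varNorm_le (hp.trans_le hpq) varNorm_nonneg

/-- Lower semicontinuity of the `p`-variation under pointwise convergence. -/
theorem sumLE_of_tendsto {ι : Type*} {l : Filter ι} [l.NeBot] {φ : ι → α → E} (hp : 0 < p)
    (hφ : ∀ x ∈ s, Tendsto (fun i => φ i x) l (𝓝 (f x)))
    (h : ∀ᶠ i in l, SumLE p (fun x y => ‖φ i y - φ i x‖) s C) :
    SumLE p (fun x y => ‖f y - f x‖) s C := fun n u hu hs => by
  have ht : Tendsto (fun i => ∑ j ∈ Finset.range n, ‖φ i (u (j + 1)) - φ i (u j)‖ ^ p) l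
      (𝓝 (∑ j ∈ Finset.range n, ‖f (u (j + 1)) - f (u j)‖ ^ p)) :=
    tendsto_finsetSum _ fun j _ =>
      (((hφ _ (hs _)).sub (hφ _ (hs _))).norm).rpow_const (Or.inr hp.le)
  exact le_of_tendsto ht (h.mono fun i hi => hi n u hu hs)

theorem SumLE.concat (hp : 1 ≤ p) (hC : 0 ≤ C) (hD : 0 ≤ D) {a b c : α} (hab : a ≤ b)
    (hbc : b ≤ c) (h : SumLE p (fun x y => ‖f y - f x‖) (Icc a b) C)
    (h' : SumLE p (fun x y => ‖f y - f x‖) (Icc b c) D) :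
    SumLE p (fun x y => ‖f y - f x‖) (Icc a c) (C + D) := by
  have m1 : MapsTo (fun x => min x b) (Icc a c) (Icc a b) := fun x hx =>
    ⟨le_min hx.1 hab, min_le_right _ _⟩
  have m2 : MapsTo (fun x => max x b) (Icc a c) (Icc b c) := fun x hx =>
    ⟨le_max_right _ _, max_le hx.2 hbc⟩
  have h1 : SumLE p (fun x y => ‖f (min y b) - f (min x b)‖) (Icc a c) C :=
    h.comp (w := fun x => min x b) (fun x _ y _ hxy => min_le_min_right b hxy) m1
  have h2 : SumLE p (fun x y => ‖f (max y b) - f (max x b)‖) (Icc a c) D :=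
    h'.comp (w := fun x => max x b) (fun x _ y _ hxy => max_le_max_right b hxy) m2
  have h3 := h1.norm_add hp hC hD h2
  have e : ∀ x, f x = f (min x b) + f (max x b) - f b := by
    intro x
    rcases le_total x b with hx | hx <;> simp [hx]
  intro n u hu hs
  refine le_trans (le_of_eq (Finset.sum_congr rfl fun i _ => ?_)) (h3 n u hu hs)
  simp only
  rw [e (u (i + 1)), e (u i), sub_sub_sub_cancel_right]

/-- On a bounded set of integers every sequence has finite variation. -/
theorem hasFinVar_nat (hp : 1 ≤ p) (f : ℕ → E) (i k : ℕ) : HasFinVar p f (Icc i k) := by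
  have h0 : ∀ l, 0 ≤ ‖f (l + 1) - f l‖ := fun l => norm_nonneg _
  set G : ℕ → ℝ := fun n => ∑ l ∈ Finset.range n, ‖f (l + 1) - f l‖ with hG
  have hGm : Monotone G := monotone_nat_of_le_succ fun n => by
    simp only [hG, Finset.sum_range_succ]; linarith [h0 n]
  have hfG : ∀ x y, x ≤ y → ‖f y - f x‖ ≤ G y - G x := by
    intro x y hxy
    induction y, hxy using Nat.le_induction with
    | base => simp
    | succ y _ ih =>
      have : G (y + 1) = G y + ‖f (y + 1) - f y‖ := by simp only [hG, Finset.sum_range_succ]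
      have h1 := norm_sub_le_norm_sub_add_norm_sub (f (y + 1)) (f y) (f x)
      linarith
  have hnn : 0 ≤ G k := Finset.sum_nonneg fun l _ => h0 l
  refine SumLE.hasFinVar (C := G k) (by linarith) hnn (SumLE.mono_left (by linarith)
    (fun _ _ _ _ _ => norm_nonneg _) (fun x _ y _ hxy => hfG x y hxy)
    (sumLE_of_monotone (G := G) hp (fun x _ y _ hxy => hGm hxy) fun x hx y hy => ?_))
  have := hGm hy.2
  have : 0 ≤ G x := Finset.sum_nonneg fun l _ => h0 l
  linarith

end Variation

/-! ### Discrete sewing and the Young–Loève estimate -/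

/-- Geometric means of superadditive functions are superadditive (Hölder's inequality for two
summands). -/
theorem rpow_mul_rpow_add_le {a b c d l : ℝ} (ha : 0 ≤ a) (hb : 0 ≤ b) (hc : 0 ≤ c) (hd : 0 ≤ d)
    (hl : 0 < l) (hl1 : l < 1) :
    a ^ l * b ^ (1 - l) + c ^ l * d ^ (1 - l) ≤ (a + c) ^ l * (b + d) ^ (1 - l) := by
  have hl' : 0 < 1 - l := by linarith
  rcases (add_nonneg ha hc).eq_or_lt with h | h
  · have h1 : a = 0 := by linarith
    have h2 : c = 0 := by linarith
    simp [h1, h2, Real.zero_rpow hl.ne']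
  rcases (add_nonneg hb hd).eq_or_lt with h' | h'
  · have h1 : b = 0 := by linarith
    have h2 : d = 0 := by linarith
    simp [h1, h2, Real.zero_rpow hl'.ne']
  have k1 := Real.geom_mean_le_arith_mean2_weighted hl.le hl'.le (div_nonneg ha h.le)
    (div_nonneg hb h'.le) (by ring)
  have k2 := Real.geom_mean_le_arith_mean2_weighted hl.le hl'.le (div_nonneg hc h.le)
    (div_nonneg hd h'.le) (by ring)
  rw [Real.div_rpow ha h.le, Real.div_rpow hb h'.le] at k1
  rw [Real.div_rpow hc h.le, Real.div_rpow hd h'.le] at k2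
  have e1 : a / (a + c) + c / (a + c) = 1 := by field_simp
  have e2 : b / (b + d) + d / (b + d) = 1 := by field_simp
  have p1 : 0 < (a + c) ^ l := Real.rpow_pos_of_pos h _
  have p2 : 0 < (b + d) ^ (1 - l) := Real.rpow_pos_of_pos h' _
  have k3 : a ^ l / (a + c) ^ l * (b ^ (1 - l) / (b + d) ^ (1 - l)) +
      c ^ l / (a + c) ^ l * (d ^ (1 - l) / (b + d) ^ (1 - l)) ≤ 1 := by
    have : l * (a / (a + c)) + (1 - l) * (b / (b + d)) +
        (l * (c / (a + c)) + (1 - l) * (d / (b + d))) = 1 := by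
      linear_combination l * e1 + (1 - l) * e2
    linarith
  rw [div_mul_div_comm, div_mul_div_comm, ← add_div, div_le_one (mul_pos p1 p2)] at k3
  exact k3

/-- **Discrete sewing lemma.** The window `[i, k]` is split next to the largest `j` for which
`κ i j` is at most half of `κ i k`. -/
theorem discrete_sewing {E : Type*} [NormedAddCommGroup E] {κ : ℕ → ℕ → ℝ} {J : ℕ → ℕ → E}
    {θ K : ℝ} (hθ : 1 < θ) (hK : 0 ≤ K) (hκ0 : ∀ i j, i ≤ j → 0 ≤ κ i j)
    (hκ : ∀ i j k, i ≤ j → j ≤ k → κ i j + κ j k ≤ κ i k)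
    (hJ0 : ∀ i, J i i = 0) (hJ1 : ∀ i, J i (i + 1) = 0)
    (hJ : ∀ i j k, i ≤ j → j ≤ k → ‖J i k - J i j - J j k‖ ≤ K * κ i k ^ θ) :
    ∀ i k, i ≤ k → ‖J i k‖ ≤ 2 * K / (1 - 2 ^ (1 - θ)) * κ i k ^ θ := by
  have h2 : (2 : ℝ) ^ (1 - θ) < 1 := Real.rpow_lt_one_of_one_lt_of_neg (by norm_num) (by linarith)
  have hpos : 0 < 1 - (2 : ℝ) ^ (1 - θ) := by linarith
  set C := 2 * K / (1 - (2 : ℝ) ^ (1 - θ)) with hC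
  have hC0 : 0 ≤ C := by positivity
  have hCeq : C * 2 ^ (1 - θ) + 2 * K = C := by
    rw [hC]; field_simp; ring
  have hκii : ∀ i, κ i i = 0 := fun i => by
    have := hκ i i i le_rfl le_rfl; have := hκ0 i i le_rfl; linarith
  suffices H : ∀ n i k, i ≤ k → k - i ≤ n → ‖J i k‖ ≤ C * κ i k ^ θ from
    fun i k hik => H _ i k hik le_rfl
  intro n
  induction n with
  | zero =>
    intro i k hik hn
    obtain rfl : i = k := by omega
    rw [hJ0, norm_zero]
    exact mul_nonneg hC0 (Real.rpow_nonneg (hκ0 _ _ le_rfl) _)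
  | succ n ih =>
    intro i k hik hn
    rcases Nat.lt_or_ge k (i + 2) with hk | hk
    · have : J i k = 0 := by
        rcases (show k = i ∨ k = i + 1 by omega) with rfl | rfl
        · exact hJ0 _
        · exact hJ1 _
      rw [this, norm_zero]
      exact mul_nonneg hC0 (Real.rpow_nonneg (hκ0 _ _ hik) _)
    have hnn : 0 ≤ κ i k := hκ0 i k hik
    obtain ⟨j, hij, hjk, hPj, hPj'⟩ : ∃ j, i ≤ j ∧ j + 1 ≤ k ∧ κ i j ≤ κ i k / 2 ∧
        κ (j + 1) k ≤ κ i k / 2 := by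
      have hi : i ≤ Nat.findGreatest (fun j => i ≤ j ∧ κ i j ≤ κ i k / 2) (k - 1) :=
        Nat.le_findGreatest (by omega) ⟨le_rfl, by rw [hκii]; linarith⟩
      have hsp : i ≤ _ ∧ _ := Nat.findGreatest_spec (P := fun j => i ≤ j ∧ κ i j ≤ κ i k / 2)
        (n := k - 1) (m := i) (by omega) ⟨le_rfl, by rw [hκii]; linarith⟩
      have hle := Nat.findGreatest_le (P := fun j => i ≤ j ∧ κ i j ≤ κ i k / 2) (k - 1)
      refine ⟨_, hi, by omega, hsp.2, ?_⟩
      set j := Nat.findGreatest (fun j => i ≤ j ∧ κ i j ≤ κ i k / 2) (k - 1) with hj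
      rcases Nat.lt_or_ge (j + 1) k with hlt | hge
      · have hnot := Nat.findGreatest_is_greatest (P := fun j => i ≤ j ∧ κ i j ≤ κ i k / 2)
          (n := k - 1) (k := j + 1) (by omega) (by omega)
        have h1 : κ i k / 2 < κ i (j + 1) := by
          by_contra hc
          exact hnot ⟨by omega, not_lt.1 hc⟩
        have := hκ i (j + 1) k (by omega) (by omega)
        linarith
      · have : j + 1 = k := by omega
        rw [this, hκii]; linarith
    have b1 := ih i j hij (by omega)
    have b2 := ih (j + 1) k hjk (by omega)
    have d1 := hJ i j k hij (by omega)
    have d2 := hJ j (j + 1) k (by omega) hjk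
    rw [hJ1, sub_zero] at d2
    have hjk' : κ j k ≤ κ i k := by
      have := hκ i j k hij (by omega); have := hκ0 i j hij; linarith
    have hm : κ j k ^ θ ≤ κ i k ^ θ :=
      Real.rpow_le_rpow (hκ0 _ _ (by omega)) hjk' (by linarith)
    have half : ∀ y, 0 ≤ y → y ≤ κ i k / 2 → C * y ^ θ ≤ C * 2 ^ (1 - θ) / 2 * κ i k ^ θ := by
      intro y hy hyk
      have : (κ i k / 2) ^ θ = 2 ^ (1 - θ) / 2 * κ i k ^ θ := by
        rw [Real.div_rpow hnn (by norm_num), Real.rpow_sub (by norm_num), Real.rpow_one]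
        field_simp
      calc C * y ^ θ ≤ C * (κ i k / 2) ^ θ :=
            mul_le_mul_of_nonneg_left (Real.rpow_le_rpow hy hyk (by linarith)) hC0
        _ = _ := by rw [this]; ring
    have c1 := half _ (hκ0 i j hij) hPj
    have c2 := half _ (hκ0 (j + 1) k hjk) hPj'
    have e : J i k = (J i k - J i j - J j k) + (J j k - J (j + 1) k) + J i j + J (j + 1) k := by
      abel
    have t1 := norm_add_le (J i k - J i j - J j k + (J j k - J (j + 1) k) + J i j) (J (j + 1) k)
    have t2 := norm_add_le (J i k - J i j - J j k + (J j k - J (j + 1) k)) (J i j)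
    have t3 := norm_add_le (J i k - J i j - J j k) (J j k - J (j + 1) k)
    rw [← e] at t1
    have m2 : K * κ j k ^ θ ≤ K * κ i k ^ θ := mul_le_mul_of_nonneg_left hm hK
    calc ‖J i k‖ ≤ 2 * (K * κ i k ^ θ) + 2 * (C * 2 ^ (1 - θ) / 2 * κ i k ^ θ) := by linarith
      _ = (C * 2 ^ (1 - θ) + 2 * K) * κ i k ^ θ := by ring
      _ = _ := by rw [hCeq]

/-- The constant in the Young–Loève estimate for exponents `p` and `q`. -/
def youngConst (p q : ℝ) : ℝ := 2 / (1 - 2 ^ (1 - (1 / p + 1 / q)))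

theorem youngConst_nonneg {p q : ℝ} (h : 1 < 1 / p + 1 / q) : 0 ≤ youngConst p q := by
  have : (2 : ℝ) ^ (1 - (1 / p + 1 / q)) < 1 :=
    Real.rpow_lt_one_of_one_lt_of_neg (by norm_num) (by linarith)
  exact div_nonneg (by norm_num) (by linarith)

section Young

variable {V E : Type*} [NormedAddCommGroup V] [NormedSpace ℝ V] [NormedAddCommGroup E]
  [NormedSpace ℝ E] {p q : ℝ}

/-- The product of a `q`-variation and a `p`-variation is the power `1 / p + 1 / q` of a
superadditive function. -/
theorem rpow_geomMean_eq (hp : 0 < p) (hq : 0 < q) {a b : ℝ} (ha : 0 ≤ a) (hb : 0 ≤ b) :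
    ((a ^ q) ^ (1 / q / (1 / p + 1 / q)) * (b ^ p) ^ (1 - 1 / q / (1 / p + 1 / q))) ^
      (1 / p + 1 / q) = a * b := by
  have hθ : 0 < 1 / p + 1 / q := by positivity
  have e : 1 - 1 / q / (1 / p + 1 / q) = 1 / p / (1 / p + 1 / q) := by
    field_simp; ring
  rw [e, Real.mul_rpow (by positivity) (by positivity), ← Real.rpow_mul (by positivity),
    ← Real.rpow_mul ha, ← Real.rpow_mul (by positivity), ← Real.rpow_mul hb,
    div_mul_cancel₀ _ hθ.ne', div_mul_cancel₀ _ hθ.ne', mul_one_div_cancel hq.ne',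
    mul_one_div_cancel hp.ne', Real.rpow_one, Real.rpow_one]

/-- **Young–Loève estimate** for left-point sums. The last value of the integrand is irrelevant. -/
theorem young_loeve (hp : 1 ≤ p) (hq : 1 ≤ q) (hpq : 1 < 1 / p + 1 / q) (h : ℕ → V →L[ℝ] E)
    (x : ℕ → V) {i k : ℕ} (hik : i ≤ k) :
    ‖∑ l ∈ Finset.Ico i k, h l (x (l + 1) - x l) - h i (x k - x i)‖ ≤
      youngConst p q * (varNorm q h (Ico i k) * varNorm p x (Icc i k)) := by
  have hp0 : 0 < p := by linarith
  have hq0 : 0 < q := by linarith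
  have hfh : ∀ i k, HasFinVar q h (Ico i k) := fun i k =>
    (hasFinVar_nat hq h i k).mono hq0 Ico_subset_Icc_self
  have hfx : ∀ i k, HasFinVar p x (Icc i k) := fun i k => hasFinVar_nat hp x i k
  have hθ : 0 < 1 / p + 1 / q := by positivity
  have hl : 0 < 1 / q / (1 / p + 1 / q) := by positivity
  have hl1 : 1 / q / (1 / p + 1 / q) < 1 := by
    rw [div_lt_one hθ]; have : 0 < 1 / p := by positivity
    linarith
  set l := 1 / q / (1 / p + 1 / q) with hldef
  have key := discrete_sewing (θ := 1 / p + 1 / q) (K := 1)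
    (κ := fun i k => (varNorm q h (Ico i k) ^ q) ^ l * (varNorm p x (Icc i k) ^ p) ^ (1 - l))
    (J := fun i k => ∑ l ∈ Finset.Ico i k, h l (x (l + 1) - x l) - h i (x k - x i))
    hpq zero_le_one
    (fun i k _ => mul_nonneg (Real.rpow_nonneg (Real.rpow_nonneg varNorm_nonneg _) _)
      (Real.rpow_nonneg (Real.rpow_nonneg varNorm_nonneg _) _))
    (fun i j k hij hjk => by
      refine (rpow_mul_rpow_add_le (Real.rpow_nonneg varNorm_nonneg _)
        (Real.rpow_nonneg varNorm_nonneg _) (Real.rpow_nonneg varNorm_nonneg _)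
        (Real.rpow_nonneg varNorm_nonneg _) hl hl1).trans ?_
      have s1 := varNorm_superadd (f := h) hq0 (Ico_subset_Ico_right hjk : Ico i j ⊆ Ico i k)
        (Ico_subset_Ico_left hij) (fun a ha b hb => ha.2.le.trans hb.1) (hfh i k)
      have s2 := varNorm_superadd (f := x) hp0 (Icc_subset_Icc_right hjk : Icc i j ⊆ Icc i k)
        (Icc_subset_Icc_left hij) (fun a ha b hb => ha.2.trans hb.1) (hfx i k)
      have n1 := fun i k => Real.rpow_nonneg (varNorm_nonneg (p := q) (f := h) (s := Ico i k)) q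
      have n2 := fun i k => Real.rpow_nonneg (varNorm_nonneg (p := p) (f := x) (s := Icc i k)) p
      exact mul_le_mul
        (Real.rpow_le_rpow (add_nonneg (n1 _ _) (n1 _ _)) s1 hl.le)
        (Real.rpow_le_rpow (add_nonneg (n2 _ _) (n2 _ _)) s2 (by linarith))
        (Real.rpow_nonneg (add_nonneg (n2 _ _) (n2 _ _)) _) (Real.rpow_nonneg (n1 _ _) _))
    (fun i => by simp) (fun i => by simp)
    (fun i j k hij hjk => by
      rw [rpow_geomMean_eq hp0 hq0 varNorm_nonneg varNorm_nonneg, one_mul]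
      have e : ∑ l ∈ Finset.Ico i k, h l (x (l + 1) - x l) - h i (x k - x i) -
          (∑ l ∈ Finset.Ico i j, h l (x (l + 1) - x l) - h i (x j - x i)) -
          (∑ l ∈ Finset.Ico j k, h l (x (l + 1) - x l) - h j (x k - x j)) =
          (h j - h i) (x k - x j) := by
        rw [← Finset.sum_Ico_consecutive _ hij hjk]
        simp only [map_sub, sub_apply]
        abel
      rw [e]
      rcases hjk.eq_or_lt with rfl | hjk'
      · simp only [sub_self, map_zero, norm_zero]
        exact mul_nonneg varNorm_nonneg varNorm_nonneg
      · exact (ContinuousLinearMap.le_opNorm _ _).trans (mul_le_mul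
          ((hfh i k).norm_sub_le hq0 ⟨le_rfl, by omega⟩ ⟨hij, hjk'⟩)
          ((hfx i k).norm_sub_le hp0 ⟨hij, hjk⟩ ⟨by omega, le_rfl⟩) (norm_nonneg _)
          varNorm_nonneg)) i k hik
  rw [rpow_geomMean_eq hp0 hq0 varNorm_nonneg varNorm_nonneg] at key
  simpa [youngConst] using key

theorem young_norm_sub_le (hp : 1 ≤ p) (hq : 1 ≤ q) (hpq : 1 < 1 / p + 1 / q)
    {h : ℕ → V →L[ℝ] E} {x : ℕ → V} {z : ℕ → E} {i k : ℕ} (hik : i ≤ k)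
    (hz : ∀ l, i ≤ l → l < k → z (l + 1) - z l = h l (x (l + 1) - x l)) {S : ℝ}
    (hS : ‖h i‖ ≤ S) :
    ‖z k - z i‖ ≤ (S + youngConst p q * varNorm q h (Icc i k)) * varNorm p x (Icc i k) := by
  have e : ∑ l ∈ Finset.Ico i k, h l (x (l + 1) - x l) = z k - z i := by
    rw [← Finset.sum_Ico_sub z hik]
    exact Finset.sum_congr rfl fun l hl => by
      rw [Finset.mem_Ico] at hl
      exact (hz l hl.1 hl.2).symm
  have h1 := young_loeve hp hq hpq h x hik
  rw [e] at h1
  have h2 := ContinuousLinearMap.le_opNorm (h i) (x k - x i)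
  have h3 := (hasFinVar_nat hp x i k).norm_sub_le (by linarith)
    (⟨le_rfl, hik⟩ : i ∈ Icc i k) (⟨hik, le_rfl⟩ : k ∈ Icc i k)
  have h4 : ‖h i‖ * ‖x k - x i‖ ≤ S * varNorm p x (Icc i k) :=
    mul_le_mul hS h3 (norm_nonneg _) ((norm_nonneg _).trans hS)
  have h5 : varNorm q h (Ico i k) ≤ varNorm q h (Icc i k) :=
    (hasFinVar_nat hq h i k).varNorm_mono (by linarith) Ico_subset_Icc_self
  have h6 : youngConst p q * (varNorm q h (Ico i k) * varNorm p x (Icc i k)) ≤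
      youngConst p q * (varNorm q h (Icc i k) * varNorm p x (Icc i k)) :=
    mul_le_mul_of_nonneg_left (mul_le_mul_of_nonneg_right h5 varNorm_nonneg)
      (youngConst_nonneg hpq)
  have h7 := norm_le_norm_add_norm_sub' (z k - z i) (h i (x k - x i))
  calc _ ≤ S * varNorm p x (Icc i k) +
      youngConst p q * (varNorm q h (Icc i k) * varNorm p x (Icc i k)) := by linarith
    _ = _ := by ring

/-- The `p`-variation of a left-point sum. -/
theorem young_sumLE (hp : 1 ≤ p) (hq : 1 ≤ q) (hpq : 1 < 1 / p + 1 / q)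
    {h : ℕ → V →L[ℝ] E} {x : ℕ → V} {z : ℕ → E} {i k : ℕ}
    (hz : ∀ l, i ≤ l → l < k → z (l + 1) - z l = h l (x (l + 1) - x l)) {S : ℝ} (hS0 : 0 ≤ S)
    (hS : ∀ l, i ≤ l → l ≤ k → ‖h l‖ ≤ S) :
    SumLE p (fun a b => ‖z b - z a‖) (Icc i k)
      ((S + youngConst p q * varNorm q h (Icc i k)) * varNorm p x (Icc i k)) := by
  have hc := youngConst_nonneg hpq
  refine (hasFinVar_nat hp x i k).sumLE_of_le (by linarith)
    (add_nonneg hS0 (mul_nonneg hc varNorm_nonneg)) fun a ha b hb hab => ?_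
  refine (young_norm_sub_le hp hq hpq hab (fun l h1 h2 => hz l (ha.1.trans h1)
    (h2.trans_le hb.2)) (hS a ha.1 ha.2)).trans ?_
  refine mul_le_mul_of_nonneg_right ?_ varNorm_nonneg
  have := (hasFinVar_nat hq h i k).varNorm_mono (by linarith) (Icc_subset_Icc ha.1 hb.2)
  have := mul_le_mul_of_nonneg_left this hc
  linarith

end Young

/-! ### Stability of perturbed Euler schemes -/

section Euler

variable {U E : Type*} [NormedAddCommGroup U] [NormedSpace ℝ U] [NormedAddCommGroup E]
  [NormedSpace ℝ E]

/-- A vector field `f(y)u = π(u) A(y) + B(y)u`: the component `π(u)` of the driver will be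
monotone, which is why `A` need only be Lipschitz, whereas `B` has an `α`-Hölder derivative. The
derivative enters only through the four-point estimate `four_point`. -/
structure IsYoungField (f : E → U →L[ℝ] E) (π : U →L[ℝ] ℝ) (A : E → E) (B : E → U →L[ℝ] E)
    (α M : ℝ) : Prop where
  one_le : 1 ≤ M
  apply_eq : ∀ y u, f y u = π u • A y + B y u
  norm_le : ∀ y, ‖f y‖ ≤ M
  lipschitz : ∀ y z, ‖f y - f z‖ ≤ M * ‖y - z‖
  lipschitz_left : ∀ y z, ‖A y - A z‖ ≤ M * ‖y - z‖
  four_point : ∀ y₁ z₁ y₂ z₂, ‖B y₁ - B z₁ - (B y₂ - B z₂)‖ ≤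
    M * ‖y₁ - z₁ - (y₂ - z₂)‖ + M * (‖y₁ - y₂‖ + ‖z₁ - z₂‖) ^ α * ‖y₂ - z₂‖

/-- The Euler scheme `y (l + 1) = y l + f (y l) (x (l + 1) - x l)`, perturbed by the increments
of `r`. -/
def IsPerturbedEuler (f : E → U →L[ℝ] E) (x : ℕ → U) (r y : ℕ → E) : Prop :=
  ∀ l, y (l + 1) - y l = f (y l) (x (l + 1) - x l) + (r (l + 1) - r l)

variable {f : E → U →L[ℝ] E} {π : U →L[ℝ] ℝ} {A : E → E} {B : E → U →L[ℝ] E} {α M p : ℝ}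

theorem IsYoungField.pos (hf : IsYoungField f π A B α M) : 0 < M := by linarith [hf.one_le]

/-- A priori bound on a window where the driver is small. -/
theorem IsPerturbedEuler.varNorm_le (hf : IsYoungField f π A B α M) (hp : 1 ≤ p) {q : ℝ}
    (hpq' : p ≤ q) (hpq : 1 < 1 / p + 1 / q) {x : ℕ → U} {r y : ℕ → E}
    (h : IsPerturbedEuler f x r y) {i k : ℕ} {e : ℝ} (he1 : M * e ≤ 1)
    (he2 : youngConst p q * M * e ≤ 1 / 2) (hx : varNorm p x (Icc i k) ≤ e)
    (hr : varNorm p r (Icc i k) ≤ 1) : varNorm p y (Icc i k) ≤ 4 := by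
  have hp0 : 0 < p := by linarith
  have hC := youngConst_nonneg hpq
  have hM := hf.pos
  set N := varNorm p y (Icc i k) with hN
  have hN0 : 0 ≤ N := varNorm_nonneg
  have he0 : 0 ≤ e := varNorm_nonneg.trans hx
  have hNq : varNorm q (fun l => f (y l)) (Icc i k) ≤ M * N :=
    SumLE.varNorm_le (by linarith) (by positivity) (SumLE.lipschitz_comp (by linarith)
      varNorm_nonneg hM.le (fun a _ b _ => hf.lipschitz _ _)
      ((hasFinVar_nat hp y i k).sumLE_exponent hp0 hpq'))
  have hz := young_sumLE (z := fun l => y l - r l) (i := i) (k := k) hp (hp.trans hpq') hpq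
    (h := fun l => f (y l)) (x := x) (fun l _ _ => by
      have := h l
      rw [sub_sub_sub_comm, this]; abel) hM.le (fun l _ _ => hf.norm_le _)
  have h0 : 0 ≤ (M + youngConst p q * varNorm q (fun l => f (y l)) (Icc i k)) *
      varNorm p x (Icc i k) := mul_nonneg (add_nonneg hM.le (mul_nonneg hC varNorm_nonneg))
        varNorm_nonneg
  have hy := (hz.norm_add hp h0 varNorm_nonneg
    ((hasFinVar_nat hp r i k).sumLE hp0)).varNorm_le hp0 (add_nonneg h0 varNorm_nonneg)
  simp only [sub_add_cancel] at hy
  have b1 : (M + youngConst p q * varNorm q (fun l => f (y l)) (Icc i k)) *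
      varNorm p x (Icc i k) ≤ (M + youngConst p q * (M * N)) * e :=
    mul_le_mul (by linarith [mul_le_mul_of_nonneg_left hNq hC]) hx varNorm_nonneg (by positivity)
  have b2 : (M + youngConst p q * (M * N)) * e ≤ 1 + N / 2 := by
    have := mul_le_mul_of_nonneg_right he2 hN0
    calc _ = M * e + youngConst p q * M * e * N := by ring
      _ ≤ _ := by linarith
  change N ≤ _ at hy
  linarith

theorem local_stability_arith {M C e D W ε : ℝ} (hM : 0 ≤ M) (hC : 0 ≤ C) (he0 : 0 ≤ e)
    (hD : 0 ≤ D) (hε : 0 ≤ ε) (he : (2 * M + 9 * C * M) * e = 1 / 2)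
    (h : W ≤ M * (D + W) * e + (M * (D + W) + C * (M * W + M * (D + W) * 8)) * e +
      (M + C * (M * 4)) * ε + ε) :
    W ≤ 2 * (M + 4 * C * M + 1) * (D + ε) := by
  have h1 : (D + W) / 2 = (M * (D + W) * e + (M * (D + W) + C * (M * W + M * (D + W) * 8)) * e)
      + C * M * e * D := by linear_combination -(D + W) * he
  have h2 : 0 ≤ C * M * e * D := by positivity
  have h3 : 0 ≤ (2 * M + 8 * C * M + 1) * D := by positivity
  have h4 : 0 ≤ (M + 4 * C * M + 1) * ε := by positivity
  have h5 : (M + C * (M * 4)) * ε + ε = (M + 4 * C * M + 1) * ε := by ring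
  have h6 : W ≤ D + 2 * ((M + 4 * C * M + 1) * ε) := by linarith
  calc W ≤ D + 2 * ((M + 4 * C * M + 1) * ε) := h6
    _ ≤ D + 2 * ((M + 4 * C * M + 1) * ε) + (2 * M + 8 * C * M + 1) * D := by linarith
    _ = _ := by ring

/-- Stability of perturbed Euler schemes on a window where the drivers are small. -/
theorem IsPerturbedEuler.varNorm_sub_le_of_small (hf : IsYoungField f π A B α M) (hp : 1 ≤ p)
    (hα : 0 < α) (hα1 : α ≤ 1) (hpα : p < 1 + α) {x x' : ℕ → U} {r r' y y' : ℕ → E}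
    (h : IsPerturbedEuler f x r y) (h' : IsPerturbedEuler f x' r' y')
    (hmono : Monotone fun l => π (x l)) {i k : ℕ} (hik : i ≤ k) {e ε : ℝ}
    (he : (2 * M + 9 * youngConst p (p / α) * M) * e = 1 / 2)
    (hx : varNorm p x (Icc i k) ≤ e) (hx' : varNorm p x' (Icc i k) ≤ e)
    (hπ : π (x k) - π (x i) ≤ e)
    (hr : varNorm p r (Icc i k) ≤ 1) (hr' : varNorm p r' (Icc i k) ≤ 1)
    (hxx : varNorm p (fun l => x l - x' l) (Icc i k) ≤ ε)
    (hrr : varNorm p (fun l => r l - r' l) (Icc i k) ≤ ε) :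
    varNorm p (fun l => y l - y' l) (Icc i k) ≤
      2 * (M + 4 * youngConst p (p / α) * M + 1) * (‖y i - y' i‖ + ε) := by
  have hp0 : 0 < p := by linarith
  have hM := hf.pos
  have hM1 := hf.one_le
  have hpq' : p ≤ p / α := by rw [le_div_iff₀ hα]; nlinarith
  have hpq : 1 < 1 / p + 1 / (p / α) := by
    rw [one_div_div, ← add_div, lt_div_iff₀ hp0]; linarith
  set q := p / α with hq
  have hq0 : 0 < q := by linarith
  have hC := youngConst_nonneg hpq
  set C := youngConst p q with hCdef
  have he0 : 0 ≤ e := varNorm_nonneg.trans hx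
  have hε0 : 0 ≤ ε := varNorm_nonneg.trans hxx
  have hCM : 0 ≤ C * M * e := by positivity
  have hMe : 0 ≤ M * e := by positivity
  have he1 : M * e ≤ 1 := by nlinarith
  have he2 : C * M * e ≤ 1 / 2 := by nlinarith
  have hy := h.varNorm_le hf hp hpq' hpq he1 he2 hx hr
  have hy' := h'.varNorm_le hf hp hpq' hpq he1 he2 hx' hr'
  have fy := hasFinVar_nat hp y i k
  have fy' := hasFinVar_nat hp y' i k
  have fΔ := hasFinVar_nat hp (fun l => y l - y' l) i k
  set W := varNorm p (fun l => y l - y' l) (Icc i k) with hW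
  have hW0 : 0 ≤ W := varNorm_nonneg
  set D := ‖y i - y' i‖ with hD
  have hD0 : 0 ≤ D := norm_nonneg _
  have hsup : ∀ l, i ≤ l → l ≤ k → ‖y l - y' l‖ ≤ D + W := fun l h1 h2 => by
    have := fΔ.norm_sub_le hp0 (⟨le_rfl, hik⟩ : i ∈ Icc i k) (⟨h1, h2⟩ : l ∈ Icc i k)
    have := norm_le_norm_add_norm_sub' (y l - y' l) (y i - y' i)
    linarith
  -- the drift term has bounded variation
  set z₁ : ℕ → E := fun l => ∑ j ∈ Finset.range l, π (x (j + 1) - x j) • (A (y j) - A (y' j))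
  have hz₁ : SumLE p (fun a b => ‖z₁ b - z₁ a‖) (Icc i k) (M * (D + W) * e) := by
    refine SumLE.mono_left hp0.le (fun _ _ _ _ _ => norm_nonneg _)
      (μ := fun a b => M * (D + W) * (π (x b) - π (x a))) (fun a ha b hb hab => ?_)
      (SumLE.const_mul he0 (by positivity)
        (fun a _ b _ hab => sub_nonneg.2 (hmono hab))
        (sumLE_of_monotone (G := fun l => π (x l)) hp (fun a _ b _ hab => hmono hab)
          fun a ha b hb => ?_))
    · rw [← Finset.sum_Ico_eq_sub _ hab, ← Finset.sum_Ico_sub (fun l => π (x l)) hab,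
        Finset.mul_sum]
      refine norm_sum_le_of_le _ fun l hl => ?_
      rw [Finset.mem_Ico] at hl
      have hm := sub_nonneg.2 (hmono (Nat.le_succ l))
      rw [norm_smul, map_sub, Real.norm_of_nonneg hm, mul_comm]
      refine mul_le_mul_of_nonneg_right ((hf.lipschitz_left _ _).trans ?_) hm
      exact mul_le_mul_of_nonneg_left (hsup l (ha.1.trans hl.1) (hl.2.le.trans hb.2)) hM.le
    · have := hmono hb.2
      have := hmono ha.1
      simp only at *
      linarith
  -- the difference of the integrands, in the `p / α`-variation
  have hBq : varNorm q (fun l => B (y l) - B (y' l)) (Icc i k) ≤ M * W + M * (D + W) * 8 := by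
    refine SumLE.varNorm_le hq0 (by positivity) (SumLE.mono_left hq0.le
      (fun _ _ _ _ _ => norm_nonneg _) (μ := fun a b => M * ‖(y b - y' b) - (y a - y' a)‖ +
        M * (D + W) * (‖y b - y a‖ + ‖y' b - y' a‖) ^ α) (fun a ha b hb hab => ?_)
      (SumLE.add (by linarith) (by positivity) (by positivity)
        (fun _ _ _ _ _ => by positivity) (fun _ _ _ _ _ => by positivity)
        (SumLE.const_mul hW0 hM.le (fun _ _ _ _ _ => norm_nonneg _)
          (fΔ.sumLE_exponent hp0 hpq'))
        (SumLE.const_mul (by norm_num) (by positivity) (fun _ _ _ _ _ => by positivity) ?_)))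
    · refine (hf.four_point _ _ _ _).trans (add_le_add_right ?_ _)
      have := mul_le_mul_of_nonneg_left (hsup a ha.1 ha.2)
        (by positivity : 0 ≤ M * (‖y b - y a‖ + ‖y' b - y' a‖) ^ α)
      linarith
    · intro n u hu hs
      have h1 := (fy.sumLE hp0).add hp varNorm_nonneg varNorm_nonneg
        (fun _ _ _ _ _ => norm_nonneg _) (fun _ _ _ _ _ => norm_nonneg _) (fy'.sumLE hp0) n u hu hs
      have e1 : ∀ l, ((‖y (u (l + 1)) - y (u l)‖ + ‖y' (u (l + 1)) - y' (u l)‖) ^ α) ^ q =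
          (‖y (u (l + 1)) - y (u l)‖ + ‖y' (u (l + 1)) - y' (u l)‖) ^ p := fun l => by
        rw [← Real.rpow_mul (by positivity), hq, mul_div_cancel₀ _ hα.ne']
      simp only [e1]
      refine h1.trans ?_
      calc _ ≤ (8 : ℝ) ^ p := Real.rpow_le_rpow (add_nonneg varNorm_nonneg varNorm_nonneg)
            (by linarith) hp0.le
        _ ≤ 8 ^ q := Real.rpow_le_rpow_of_exponent_le (by norm_num) hpq'
  set z₂ : ℕ → E := fun l => ∑ j ∈ Finset.range l, (B (y j) - B (y' j)) (x (j + 1) - x j)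
  have hB0 : ∀ y z, ‖B y - B z‖ ≤ M * ‖y - z‖ := fun y z => by
    have := hf.four_point y z z z
    simpa using this
  have hz₂ := young_sumLE (z := z₂) (i := i) (k := k) hp (hp.trans hpq') hpq
    (h := fun l => B (y l) - B (y' l)) (x := x)
    (fun l _ _ => by simp only [z₂, Finset.sum_range_succ]; abel)
    (by positivity : 0 ≤ M * (D + W)) (fun l h1 h2 => (hB0 _ _).trans
      (mul_le_mul_of_nonneg_left (hsup l h1 h2) hM.le))
  set z₃ : ℕ → E := fun l => ∑ j ∈ Finset.range l, f (y' j) ((x (j + 1) - x' (j + 1)) -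
    (x j - x' j))
  have hfq : varNorm q (fun l => f (y' l)) (Icc i k) ≤ M * 4 :=
    SumLE.varNorm_le hq0 (by positivity) (SumLE.lipschitz_comp hq0 (by norm_num) hM.le
      (fun a _ b _ => hf.lipschitz _ _) ((fy'.sumLE_exponent hp0 hpq').mono_right hq0.le
        varNorm_nonneg hy'))
  have hz₃ := young_sumLE (z := z₃) (i := i) (k := k) hp (hp.trans hpq') hpq
    (h := fun l => f (y' l)) (x := fun l => x l - x' l)
    (fun l _ _ => by simp only [z₃, Finset.sum_range_succ]; abel) hM.le
    (fun l _ _ => hf.norm_le _)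
  have p2 : 0 ≤ (M * (D + W) + C * varNorm q (fun l => B (y l) - B (y' l)) (Icc i k)) *
      varNorm p x (Icc i k) := mul_nonneg (add_nonneg (by positivity)
        (mul_nonneg hC varNorm_nonneg)) varNorm_nonneg
  have p3 : 0 ≤ (M + C * varNorm q (fun l => f (y' l)) (Icc i k)) *
      varNorm p (fun l => x l - x' l) (Icc i k) := mul_nonneg (add_nonneg hM.le
        (mul_nonneg hC varNorm_nonneg)) varNorm_nonneg
  have p1 : 0 ≤ M * (D + W) * e := by positivity
  have p4 := varNorm_nonneg (p := p) (f := fun l => r l - r' l) (s := Icc i k)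
  have hsum := ((hz₁.norm_add hp p1 p2 hz₂).norm_add hp (add_nonneg p1 p2) p3 hz₃).norm_add hp
    (add_nonneg (add_nonneg p1 p2) p3) p4
    ((hasFinVar_nat hp (fun l => r l - r' l) i k).sumLE hp0)
  have hΔ : ∀ l, y l - y' l = z₁ l + z₂ l + z₃ l + (r l - r' l) +
      (y 0 - y' 0 - (r 0 - r' 0)) := by
    intro l
    induction l with
    | zero => simp [z₁, z₂, z₃]
    | succ l ih =>
      have a1 := h l
      have a2 := h' l
      have e1 : y (l + 1) - y' (l + 1) = (y l - y' l) + (f (y l) (x (l + 1) - x l) -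
          f (y' l) (x' (l + 1) - x' l)) + ((r (l + 1) - r' (l + 1)) - (r l - r' l)) := by
        rw [← sub_eq_zero] at a1 a2 ⊢
        rw [← sub_zero (0 : E)]
        nth_rw 1 [← a1]
        rw [← a2]
        abel
      have e2 : f (y l) (x (l + 1) - x l) - f (y' l) (x' (l + 1) - x' l) =
          π (x (l + 1) - x l) • (A (y l) - A (y' l)) + (B (y l) - B (y' l)) (x (l + 1) - x l) +
          f (y' l) ((x (l + 1) - x' (l + 1)) - (x l - x' l)) := by
        have : (x (l + 1) - x' (l + 1)) - (x l - x' l) = (x (l + 1) - x l) -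
          (x' (l + 1) - x' l) := by abel
        rw [this, map_sub (f (y' l)) (x (l + 1) - x l),
          hf.apply_eq (y l), hf.apply_eq (y' l) (x (l + 1) - x l),
          sub_apply, smul_sub]
        abel
      rw [e1, ih, e2]
      simp only [z₁, z₂, z₃, Finset.sum_range_succ]
      abel
  have hfin : W ≤ _ := SumLE.varNorm_le hp0 (add_nonneg (add_nonneg (add_nonneg p1 p2) p3) p4)
    (f := fun l => y l - y' l) (s := Icc i k) (fun n u hu hs => by
      refine le_trans (le_of_eq (Finset.sum_congr rfl fun j _ => ?_)) (hsum n u hu hs)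
      simp only
      rw [hΔ (u (j + 1)), hΔ (u j), add_sub_add_right_eq_sub])
  have t2 : (M * (D + W) + C * varNorm q (fun l => B (y l) - B (y' l)) (Icc i k)) *
      varNorm p x (Icc i k) ≤ (M * (D + W) + C * (M * W + M * (D + W) * 8)) * e :=
    mul_le_mul (by linarith [mul_le_mul_of_nonneg_left hBq hC]) hx varNorm_nonneg (by positivity)
  have t3 : (M + C * varNorm q (fun l => f (y' l)) (Icc i k)) *
      varNorm p (fun l => x l - x' l) (Icc i k) ≤ (M + C * (M * 4)) * ε :=
    mul_le_mul (by linarith [mul_le_mul_of_nonneg_left hfq hC]) hxx varNorm_nonneg (by positivity)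
  exact local_stability_arith hM.le hC he0 hD0 hε0 he (hfin.trans
    (add_le_add (add_le_add (add_le_add le_rfl t2) t3) hrr))

end Euler

section EulerGlobal

variable {U E : Type*} [NormedAddCommGroup U] [NormedSpace ℝ U] [NormedAddCommGroup E]
  [NormedSpace ℝ E]
variable {f : E → U →L[ℝ] E} {π : U →L[ℝ] ℝ} {A : E → E} {B : E → U →L[ℝ] E} {α M p : ℝ}

/-- The difference of two schemes over a single Euler step, however large the increments of the
drivers. -/
theorem IsPerturbedEuler.norm_step_le (hf : IsYoungField f π A B α M) {x x' : ℕ → U}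
    {r r' y y' : ℕ → E} (h : IsPerturbedEuler f x r y) (h' : IsPerturbedEuler f x' r' y') {l : ℕ}
    {R ε : ℝ} (hx : ‖x (l + 1) - x l‖ ≤ R)
    (hxx : ‖(x (l + 1) - x' (l + 1)) - (x l - x' l)‖ ≤ ε)
    (hrr : ‖(r (l + 1) - r' (l + 1)) - (r l - r' l)‖ ≤ ε) :
    ‖(y (l + 1) - y' (l + 1)) - (y l - y' l)‖ ≤ M * ‖y l - y' l‖ * R + M * ε + ε := by
  have e : (y (l + 1) - y' (l + 1)) - (y l - y' l) = (f (y l) - f (y' l)) (x (l + 1) - x l) +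
      f (y' l) ((x (l + 1) - x' (l + 1)) - (x l - x' l)) +
      ((r (l + 1) - r' (l + 1)) - (r l - r' l)) := by
    have : (x (l + 1) - x' (l + 1)) - (x l - x' l) = (x (l + 1) - x l) -
        (x' (l + 1) - x' l) := by abel
    rw [this, map_sub (f (y' l)) (x (l + 1) - x l), sub_apply, sub_sub_sub_comm, h l, h' l]
    abel
  rw [e]
  refine (norm_add₃_le).trans (add_le_add (add_le_add ?_ ?_) hrr)
  · exact (ContinuousLinearMap.le_opNorm _ _).trans (mul_le_mul (hf.lipschitz _ _) hx
      (norm_nonneg _) (mul_nonneg hf.pos.le (norm_nonneg _)))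
  · exact (ContinuousLinearMap.le_opNorm _ _).trans (mul_le_mul (hf.norm_le _) hxx
      (norm_nonneg _) hf.pos.le)

theorem sumLE_pair {E : Type*} [NormedAddCommGroup E] (hp : 1 ≤ p) (g : ℕ → E) (j : ℕ) {D : ℝ}
    (h : ‖g (j + 1) - g j‖ ≤ D) : SumLE p (fun a b => ‖g b - g a‖) (Icc j (j + 1)) D := by
  have hD : 0 ≤ D := (norm_nonneg _).trans h
  refine SumLE.mono_left (by linarith) (fun _ _ _ _ _ => norm_nonneg _)
    (μ := fun a b => D * (b : ℝ) - D * (a : ℝ)) (fun a ha b hb hab => ?_)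
    (sumLE_of_monotone (G := fun l : ℕ => D * (l : ℝ)) hp (fun a _ b _ hab => ?_)
      fun a ha b hb => ?_)
  · rcases hab.eq_or_lt with rfl | hlt
    · simp
    · obtain rfl : a = j := by have := ha.1; have := hb.2; omega
      obtain rfl : b = a + 1 := by have := hb.2; omega
      push_cast
      linarith
  · exact mul_le_mul_of_nonneg_left (Nat.cast_le.2 hab) hD
  · have h1 : (b : ℝ) ≤ j + 1 := by exact_mod_cast hb.2
    have h2 : (j : ℝ) ≤ a := by exact_mod_cast ha.1
    nlinarith

/-- Two perturbed Euler schemes on `{0, …, n}` with drivers of `p`-variation at most `R` whose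
drivers and perturbations are `ε`-close in `p`-variation. -/
structure EulerPair (f : E → U →L[ℝ] E) (π : U →L[ℝ] ℝ) (p R ε : ℝ) (n : ℕ) (x x' : ℕ → U)
    (r r' y y' : ℕ → E) : Prop where
  left : IsPerturbedEuler f x r y
  right : IsPerturbedEuler f x' r' y'
  mono : Monotone fun l => π (x l)
  left_le : varNorm p x (Icc 0 n) ≤ R
  right_le : varNorm p x' (Icc 0 n) ≤ R
  mono_le : π (x n) - π (x 0) ≤ R
  left_pert : varNorm p r (Icc 0 n) ≤ 1
  right_pert : varNorm p r' (Icc 0 n) ≤ 1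
  driver_sub : varNorm p (fun l => x l - x' l) (Icc 0 n) ≤ ε
  pert_sub : varNorm p (fun l => r l - r' l) (Icc 0 n) ≤ ε

/-- Stability on windows where the total size of the drivers is at most `N` times the threshold
of the local estimate; by induction on `N`, splitting next to the first time at which the threshold
is exceeded. The jumps of the drivers need not be small, since one Euler step is explicit. -/
theorem euler_stability_window (hf : IsYoungField f π A B α M) (hp : 1 ≤ p) (hα : 0 < α)
    (hα1 : α ≤ 1) (hpα : p < 1 + α) (R : ℝ) (N : ℕ) : ∃ K : ℝ, 0 ≤ K ∧
      ∀ (n : ℕ) (ε : ℝ) (x x' : ℕ → U) (r r' y y' : ℕ → E), EulerPair f π p R ε n x x' r r' y y' →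
      ∀ i k, i ≤ k → k ≤ n →
        varNorm p x (Icc i k) ^ p + varNorm p x' (Icc i k) ^ p + (π (x k) - π (x i)) ≤
          N * (1 / (2 * (2 * M + 9 * youngConst p (p / α) * M))) ^ p →
        varNorm p (fun l => y l - y' l) (Icc i k) ≤ K * (‖y i - y' i‖ + ε) := by
  have hp0 : 0 < p := by linarith
  have hM := hf.pos
  have hM1 := hf.one_le
  have hC : 0 ≤ youngConst p (p / α) := youngConst_nonneg (by
    rw [one_div_div, ← add_div, lt_div_iff₀ hp0]; linarith)
  set e := 1 / (2 * (2 * M + 9 * youngConst p (p / α) * M)) with he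
  have hden : 1 ≤ 2 * (2 * M + 9 * youngConst p (p / α) * M) := by
    have : 0 ≤ youngConst p (p / α) * M := by positivity
    linarith
  have he0 : 0 < e := by positivity
  have he1 : e ≤ 1 := by rw [he, div_le_one (by linarith)]; exact hden
  have hee : (2 * M + 9 * youngConst p (p / α) * M) * e = 1 / 2 := by
    rw [he]; field_simp
  have hep : e ^ p ≤ e := by
    calc e ^ p ≤ e ^ (1 : ℝ) := Real.rpow_le_rpow_of_exponent_ge he0 he1 hp
      _ = e := Real.rpow_one e
  set L := 2 * (M + 4 * youngConst p (p / α) * M + 1) with hL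
  have hL0 : 0 ≤ L := by positivity
  -- the local estimate
  have loc : ∀ (n : ℕ) (ε : ℝ) (x x' : ℕ → U) (r r' y y' : ℕ → E),
      EulerPair f π p R ε n x x' r r' y y' → ∀ i k, i ≤ k → k ≤ n →
        varNorm p x (Icc i k) ^ p + varNorm p x' (Icc i k) ^ p + (π (x k) - π (x i)) ≤ e ^ p →
        varNorm p (fun l => y l - y' l) (Icc i k) ≤ L * (‖y i - y' i‖ + ε) := by
    intro n ε x x' r r' y y' h i k hik hk hκ
    have a1 := Real.rpow_nonneg (varNorm_nonneg (p := p) (f := x) (s := Icc i k)) p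
    have a2 := Real.rpow_nonneg (varNorm_nonneg (p := p) (f := x') (s := Icc i k)) p
    have a3 : 0 ≤ π (x k) - π (x i) := sub_nonneg.2 (h.mono hik)
    have sub : Icc i k ⊆ Icc 0 n := Icc_subset_Icc (Nat.zero_le _) hk
    have mono : ∀ {F : Type _} [NormedAddCommGroup F] (g : ℕ → F),
        varNorm p g (Icc i k) ≤ varNorm p g (Icc 0 n) := fun g =>
      (hasFinVar_nat hp g 0 n).varNorm_mono hp0 sub
    refine IsPerturbedEuler.varNorm_sub_le_of_small hf hp hα hα1 hpα h.left h.right h.mono hik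
      hee ?_ ?_ (by linarith) ((mono r).trans h.left_pert) ((mono r').trans h.right_pert)
      (((hasFinVar_nat hp _ 0 n).varNorm_mono hp0 sub).trans h.driver_sub)
      ((mono _).trans h.pert_sub)
    · exact (Real.rpow_le_rpow_iff varNorm_nonneg he0.le hp0).1 (by linarith)
    · exact (Real.rpow_le_rpow_iff varNorm_nonneg he0.le hp0).1 (by linarith)
  induction N with
  | zero =>
    refine ⟨L, hL0, fun n ε x x' r r' y y' h i k hik hk hκ => loc n ε x x' r r' y y' h i k hik hk
      (hκ.trans ?_)⟩
    simp only [Nat.cast_zero, zero_mul]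
    positivity
  | succ N ih =>
    obtain ⟨K, hK0, hK⟩ := ih
    set R' := max R 0 with hR'
    have hR0 : 0 ≤ R' := le_max_right _ _
    set S := M * (1 + L) * R' + M + 1 with hS
    have hS0 : 0 ≤ S := by positivity
    refine ⟨L + S + K * (2 + L + S), by positivity,
      fun n ε x x' r r' y y' h i k hik hk hκ => ?_⟩
    have hε0 : 0 ≤ ε := varNorm_nonneg.trans h.driver_sub
    set D := ‖y i - y' i‖ with hD
    have hD0 : 0 ≤ D := norm_nonneg _
    have hT0 : 0 ≤ D + ε := add_nonneg hD0 hε0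
    set κ : ℕ → ℕ → ℝ := fun i k =>
      varNorm p x (Icc i k) ^ p + varNorm p x' (Icc i k) ^ p + (π (x k) - π (x i)) with hκdef
    have hsuper : ∀ i j k, i ≤ j → j ≤ k → κ i j + κ j k ≤ κ i k := fun i j k hij hjk => by
      have s1 := varNorm_superadd (f := x) hp0 (Icc_subset_Icc_right hjk : Icc i j ⊆ Icc i k)
        (Icc_subset_Icc_left hij) (fun a ha b hb => ha.2.trans hb.1) (hasFinVar_nat hp x i k)
      have s2 := varNorm_superadd (f := x') hp0 (Icc_subset_Icc_right hjk : Icc i j ⊆ Icc i k)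
        (Icc_subset_Icc_left hij) (fun a ha b hb => ha.2.trans hb.1) (hasFinVar_nat hp x' i k)
      simp only [hκdef]
      linarith
    have hκ0 : ∀ i k, i ≤ k → 0 ≤ κ i k := fun i k hik => add_nonneg (add_nonneg
      (Real.rpow_nonneg varNorm_nonneg _) (Real.rpow_nonneg varNorm_nonneg _))
      (sub_nonneg.2 (h.mono hik))
    by_cases hsmall : κ i k ≤ e ^ p
    · refine (loc n ε x x' r r' y y' h i k hik hk hsmall).trans
        (mul_le_mul_of_nonneg_right ?_ hT0)
      have : 0 ≤ K * (2 + L + S) := by positivity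
      linarith
    have hii : κ i i ≤ e ^ p := by
      have := hsuper i i i le_rfl le_rfl
      have : 0 < e ^ p := Real.rpow_pos_of_pos he0 p
      linarith
    have hsp := Nat.findGreatest_spec (P := fun j => κ i j ≤ e ^ p) (n := k) (m := i) hik hii
    have hij := Nat.le_findGreatest (P := fun j => κ i j ≤ e ^ p) (n := k) (m := i) hik hii
    have hjk := Nat.findGreatest_le (P := fun j => κ i j ≤ e ^ p) k
    have hgt := Nat.findGreatest_is_greatest (P := fun j => κ i j ≤ e ^ p) (n := k)
      (k := Nat.findGreatest (fun j => κ i j ≤ e ^ p) k + 1) (Nat.lt_succ_self _)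
    set j := Nat.findGreatest (fun j => κ i j ≤ e ^ p) k with hj
    have hjk' : j + 1 ≤ k := by
      rcases hjk.eq_or_lt with h1 | h1
      · rw [h1] at hsp; exact absurd hsp hsmall
      · exact h1
    have hgt' : e ^ p < κ i (j + 1) := not_le.1 (hgt hjk')
    have b1 := loc n ε x x' r r' y y' h i j hij (by omega) hsp
    have hrest : κ (j + 1) k ≤ N * e ^ p := by
      have := hsuper i (j + 1) k (by omega) hjk'
      change κ i k ≤ _ at hκ
      push_cast at hκ
      linarith
    have b2 := hK n ε x x' r r' y y' h (j + 1) k hjk' hk hrest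
    have hj0 : ‖y j - y' j‖ ≤ (1 + L) * (D + ε) := by
      have h1 := (hasFinVar_nat hp (fun l => y l - y' l) i j).norm_sub_le hp0
        (⟨le_rfl, hij⟩ : i ∈ Icc i j) (⟨hij, le_rfl⟩ : j ∈ Icc i j)
      have h2 := norm_le_norm_add_norm_sub' (y j - y' j) (y i - y' i)
      linarith
    have incr : ∀ {F : Type _} [NormedAddCommGroup F] (g : ℕ → F),
        ‖g (j + 1) - g j‖ ≤ varNorm p g (Icc 0 n) := fun g =>
      (hasFinVar_nat hp g 0 n).norm_sub_le hp0 ⟨by omega, by omega⟩ ⟨by omega, by omega⟩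
    have hstep := IsPerturbedEuler.norm_step_le hf h.left h.right (l := j) (R := R') (ε := ε)
      (((hasFinVar_nat hp x 0 n).norm_sub_le hp0 ⟨by omega, by omega⟩
        ⟨by omega, by omega⟩).trans (h.left_le.trans (le_max_left _ _)))
      (((hasFinVar_nat hp (fun l => x l - x' l) 0 n).norm_sub_le hp0 ⟨by omega, by omega⟩
        ⟨by omega, by omega⟩).trans h.driver_sub)
      ((incr fun l => r l - r' l).trans h.pert_sub)
    have hstep' : ‖(y (j + 1) - y' (j + 1)) - (y j - y' j)‖ ≤ S * (D + ε) := by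
      refine hstep.trans ?_
      have h1 : M * ‖y j - y' j‖ * R' ≤ M * ((1 + L) * (D + ε)) * R' := by gcongr
      have h2 : (M + 1) * ε ≤ (M + 1) * (D + ε) := by gcongr; linarith
      calc _ ≤ M * ((1 + L) * (D + ε)) * R' + (M + 1) * (D + ε) := by linarith
        _ = _ := by rw [hS]; ring
    have hj1 : ‖y (j + 1) - y' (j + 1)‖ ≤ (1 + L + S) * (D + ε) := by
      have := norm_le_norm_add_norm_sub' (y (j + 1) - y' (j + 1)) (y j - y' j)
      linarith
    have hS' : 0 ≤ S * (D + ε) := by positivity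
    have cat := (((hasFinVar_nat hp (fun l => y l - y' l) i j).sumLE hp0).concat hp varNorm_nonneg
      hS' hij (Nat.le_succ j) (sumLE_pair hp _ j hstep')).concat hp
      (add_nonneg varNorm_nonneg hS') varNorm_nonneg (hij.trans (Nat.le_succ j)) hjk'
      ((hasFinVar_nat hp (fun l => y l - y' l) (j + 1) k).sumLE hp0)
    have := cat.varNorm_le hp0 (add_nonneg (add_nonneg varNorm_nonneg hS') varNorm_nonneg)
    have b3 : K * (‖y (j + 1) - y' (j + 1)‖ + ε) ≤ K * ((2 + L + S) * (D + ε)) := by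
      refine mul_le_mul_of_nonneg_left ?_ hK0
      calc _ ≤ (1 + L + S) * (D + ε) + (D + ε) := by linarith
        _ = _ := by ring
    calc _ ≤ L * (D + ε) + S * (D + ε) + K * ((2 + L + S) * (D + ε)) := by linarith
      _ = _ := by ring

/-- **Stability of perturbed Euler schemes**, uniformly in the number of steps. -/
theorem euler_stability (hf : IsYoungField f π A B α M) (hp : 1 ≤ p) (hα : 0 < α)
    (hα1 : α ≤ 1) (hpα : p < 1 + α) (R : ℝ) : ∃ K : ℝ, 0 ≤ K ∧
      ∀ (n : ℕ) (ε : ℝ) (x x' : ℕ → U) (r r' y y' : ℕ → E), EulerPair f π p R ε n x x' r r' y y' →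
        varNorm p (fun l => y l - y' l) (Icc 0 n) ≤ K * (‖y 0 - y' 0‖ + ε) := by
  have hp0 : 0 < p := by linarith
  have hM := hf.pos
  have hC : 0 ≤ youngConst p (p / α) := youngConst_nonneg (by
    rw [one_div_div, ← add_div, lt_div_iff₀ hp0]; linarith)
  set e := 1 / (2 * (2 * M + 9 * youngConst p (p / α) * M)) with he
  have he0 : 0 < e := by positivity
  have hep : 0 < e ^ p := Real.rpow_pos_of_pos he0 p
  obtain ⟨N, hN⟩ := exists_nat_ge ((2 * R ^ p + R) / e ^ p)
  rw [div_le_iff₀ hep] at hN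
  obtain ⟨K, hK0, hK⟩ := euler_stability_window hf hp hα hα1 hpα R N
  refine ⟨K, hK0, fun n ε x x' r r' y y' h => hK n ε x x' r r' y y' h 0 n (Nat.zero_le _) le_rfl ?_⟩
  have h1 := Real.rpow_le_rpow varNorm_nonneg h.left_le hp0.le
  have h2 := Real.rpow_le_rpow varNorm_nonneg h.right_le hp0.le
  have h3 := h.mono_le
  linarith

end EulerGlobal

/-! ### Partitions and càdlàg functions -/

/-- Outside finitely many times, a càdlàg function oscillates little: the increments over intervals
`(s, t]` avoiding a suitable finite set are small. -/
theorem IsCadlag.exists_finset_gap {E : Type*} [NormedAddCommGroup E] {a c : ℝ} {g : ℝ → E}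
    (hg : IsCadlag a c g) {η : ℝ} (hη : 0 < η) : ∃ F : Finset ℝ, ∀ s ∈ Icc a c, ∀ t ∈ Icc a c,
      s ≤ t → (∀ x ∈ F, ¬ (s < x ∧ x ≤ t)) → ‖g t - g s‖ ≤ η := by
  have loc : ∀ x : ℝ, ∃ ε > 0, x ∈ Icc a c → ∀ s ∈ Icc a c, ∀ t ∈ Icc a c, s ≤ t →
      dist s x < ε → dist t x < ε → (t < x ∨ x ≤ s) → ‖g t - g s‖ ≤ η := by
    intro x
    by_cases hx : x ∈ Icc a c
    swap
    · exact ⟨1, one_pos, fun h => absurd h hx⟩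
    have hL : ∃ ε > 0, ∀ s ∈ Icc a c, ∀ t ∈ Icc a c, s < x → t < x → dist s x < ε →
        dist t x < ε → ‖g t - g s‖ ≤ η := by
      rcases hx.1.eq_or_lt with h | h
      · exact ⟨1, one_pos, fun s hs t _ hsx => absurd (hs.1.trans_lt hsx)
          (by rw [h]; exact lt_irrefl _)⟩
      obtain ⟨l, hl⟩ := hg.2 x ⟨h, hx.2⟩
      have := Metric.tendsto_nhdsWithin_nhds.1 hl (η / 2) (by positivity)
      obtain ⟨ε, hε, hε'⟩ := this
      refine ⟨ε, hε, fun s _ t _ hsx htx hs ht => ?_⟩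
      have h1 := hε' (show s ∈ Iio x from hsx) hs
      have h2 := hε' (show t ∈ Iio x from htx) ht
      rw [← dist_eq_norm]
      have := dist_triangle_right (g t) (g s) l
      linarith
    have hR : ∃ ε > 0, ∀ s ∈ Icc a c, ∀ t ∈ Icc a c, x ≤ s → x ≤ t → dist s x < ε →
        dist t x < ε → ‖g t - g s‖ ≤ η := by
      rcases hx.2.eq_or_lt with h | h
      · refine ⟨1, one_pos, fun s hs t ht hsx htx _ _ => ?_⟩
        have e1 : s = x := le_antisymm (h ▸ hs.2) hsx
        have e2 : t = x := le_antisymm (h ▸ ht.2) htx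
        rw [e1, e2, sub_self, norm_zero]
        exact hη.le
      have hl := hg.1 x ⟨hx.1, h⟩
      obtain ⟨ε, hε, hε'⟩ := Metric.tendsto_nhdsWithin_nhds.1 hl (η / 2) (by positivity)
      refine ⟨ε, hε, fun s _ t _ hsx htx hs ht => ?_⟩
      have h1 : dist (g s) (g x) ≤ η / 2 := by
        rcases hsx.eq_or_lt with h1 | h1
        · rw [← h1, dist_self]; positivity
        · exact (hε' (show s ∈ Ioi x from h1) hs).le
      have h2 : dist (g t) (g x) ≤ η / 2 := by
        rcases htx.eq_or_lt with h1 | h1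
        · rw [← h1, dist_self]; positivity
        · exact (hε' (show t ∈ Ioi x from h1) ht).le
      rw [← dist_eq_norm]
      have := dist_triangle_right (g t) (g s) (g x)
      linarith
    obtain ⟨ε₁, h1, h1'⟩ := hL
    obtain ⟨ε₂, h2, h2'⟩ := hR
    refine ⟨min ε₁ ε₂, lt_min h1 h2, fun _ s hs t ht hst hsx htx h => ?_⟩
    rcases h with h | h
    · exact h1' s hs t ht (hst.trans_lt h) h (hsx.trans_le (min_le_left _ _))
        (htx.trans_le (min_le_left _ _))
    · exact h2' s hs t ht h (h.trans hst) (hsx.trans_le (min_le_right _ _))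
        (htx.trans_le (min_le_right _ _))
  choose ε hε hloc using loc
  obtain ⟨T, hT, hcov⟩ := (isCompact_Icc (a := a) (b := c)).elim_nhds_subcover
    (fun x => Metric.ball x (ε x)) fun x _ => Metric.ball_mem_nhds x (hε x)
  obtain ⟨δ, hδ, hleb⟩ := lebesgue_number_lemma_of_metric (ι := T)
    (c := fun x => Metric.ball (x : ℝ) (ε x)) isCompact_Icc (fun _ => Metric.isOpen_ball)
    (hcov.trans (by
      intro y hy
      simp only [mem_iUnion] at hy ⊢
      obtain ⟨x, hx, hy⟩ := hy
      exact ⟨⟨x, hx⟩, hy⟩))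
  obtain ⟨n, hn⟩ := exists_nat_ge ((c - a) / (δ / 2))
  rw [div_le_iff₀ (by positivity)] at hn
  -- a grid of mesh `δ / 2` keeps `[s, t]` within the Lebesgue number
  refine ⟨T ∪ (Finset.range (n + 1)).image (fun i : ℕ => a + i * (δ / 2)),
    fun s hs t ht hst hF => ?_⟩
  have hlt : t < s + δ := by
    by_contra hc
    have hfl := Nat.lt_floor_add_one ((s - a) / (δ / 2))
    have hfl' := Nat.floor_le (div_nonneg (sub_nonneg.2 hs.1) (by positivity : 0 ≤ δ / 2))
    rw [div_lt_iff₀ (by positivity)] at hfl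
    rw [le_div_iff₀ (by positivity)] at hfl'
    set i := ⌊(s - a) / (δ / 2)⌋₊
    have hle : a + ((i + 1 : ℕ) : ℝ) * (δ / 2) ≤ t := by push_cast; linarith
    refine hF (a + ((i + 1 : ℕ) : ℝ) * (δ / 2)) (Finset.mem_union_right _
      (Finset.mem_image.2 ⟨i + 1, Finset.mem_range.2 ?_, rfl⟩)) ⟨by push_cast; linarith, hle⟩
    have h3 : ((i + 1 : ℕ) : ℝ) * (δ / 2) ≤ n * (δ / 2) := by linarith [ht.2]
    have := le_of_mul_le_mul_right h3 (by positivity)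
    have : i + 1 ≤ n := by exact_mod_cast this
    omega
  obtain ⟨⟨x, hx⟩, hball⟩ := hleb s hs
  have h1 : dist s x < ε x := hball (Metric.mem_ball_self hδ)
  have h2 : dist t x < ε x := hball (by
    rw [Metric.mem_ball, Real.dist_eq, abs_of_nonneg (by linarith)]; linarith)
  refine hloc x (hT x hx) s hs t ht hst h1 h2 ?_
  have := hF x (Finset.mem_union_left _ hx)
  by_contra hc
  push Not at hc
  exact this ⟨hc.2, hc.1⟩

theorem exists_partition {s t : ℝ} (hst : s ≤ t) (F : Finset ℝ) : ∃ (k : ℕ) (w : ℕ → ℝ),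
    IsPartition s t k w ∧ (∀ i, w i ∈ Icc s t) ∧ (∀ x ∈ F, x ∈ Icc s t → ∃ j ≤ k, w j = x) ∧
      ∀ j < k, w j < t := by
  classical
  set G : Finset ℝ := insert s (insert t (F.filter (· ∈ Icc s t))) with hG
  have hGI : ∀ x ∈ G, x ∈ Icc s t := by
    intro x hx
    simp only [hG, Finset.mem_insert, Finset.mem_filter] at hx
    rcases hx with rfl | rfl | hx
    · exact ⟨le_rfl, hst⟩
    · exact ⟨hst, le_rfl⟩
    · exact hx.2
  have hs : s ∈ G := Finset.mem_insert_self _ _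
  have ht : t ∈ G := Finset.mem_insert_of_mem (Finset.mem_insert_self _ _)
  have hpos : 0 < G.card := Finset.card_pos.2 ⟨s, hs⟩
  set e := G.orderEmbOfFin rfl with he
  set w : ℕ → ℝ := fun i => e ⟨min i (G.card - 1), by omega⟩ with hw
  have hmem : ∀ i, w i ∈ Icc s t := fun i => hGI _ (G.orderEmbOfFin_mem rfl _)
  have hmono : Monotone w := fun i j hij =>
    e.monotone (Fin.mk_le_mk.2 (min_le_min_right _ hij))
  have hsurj : ∀ x ∈ G, ∃ j ≤ G.card - 1, w j = x := by
    intro x hx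
    have : x ∈ Set.range e := by rw [he, Finset.range_orderEmbOfFin]; exact hx
    obtain ⟨⟨j, hj⟩, rfl⟩ := this
    exact ⟨j, by omega, by simp only [hw]; congr 2; omega⟩
  have hlast : w (G.card - 1) = t := by
    obtain ⟨j, hj, hjt⟩ := hsurj t ht
    exact le_antisymm (hmem _).2 (hjt ▸ hmono hj)
  refine ⟨G.card - 1, w, ⟨hmono, ?_, hlast⟩, hmem,
    fun x hx hxI => hsurj x ?_, fun j hj => ?_⟩
  · obtain ⟨j, hj, hjs⟩ := hsurj s hs
    exact le_antisymm (hjs ▸ hmono (Nat.zero_le j)) (hmem _).1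
  · simp [hG, hx, hxI.1, hxI.2]
  · rw [← hlast]
    exact e.strictMono (Fin.mk_lt_mk.2 (by omega))

section YoungIntegral

variable {U E : Type*} [NormedAddCommGroup U] [NormedSpace ℝ U] [NormedAddCommGroup E]
  [NormedSpace ℝ E]

/-- The Young integral as a limit along finite sets of partition points. -/
theorem HasYoungIntegral.exists_finset {h : ℝ → U →L[ℝ] E} {ω : ℝ → U} {s t : ℝ} {I : E}
    (hI : HasYoungIntegral h ω s t I) {ε : ℝ} (hε : 0 < ε) :
    ∃ F : Finset ℝ, ∀ (k : ℕ) (w : ℕ → ℝ), IsPartition s t k w →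
      (∀ x ∈ F, x ∈ Icc s t → ∃ j ≤ k, w j = x) →
      ‖(∑ i ∈ Finset.range k, h (w i) (ω (w (i + 1)) - ω (w i))) - I‖ < ε := by
  classical
  obtain ⟨n, v, hv, H⟩ := hI ε hε
  refine ⟨(Finset.range (n + 1)).image v, fun k w hw hr => H k w hw fun i hi => ?_⟩
  refine hr (v i) (Finset.mem_image_of_mem _ (Finset.mem_range.2 (by omega))) ⟨?_, ?_⟩
  · rw [← hv.2.1]; exact hv.1 (Nat.zero_le i)
  · rw [← hv.2.2]; exact hv.1 hi

theorem HasYoungIntegral.of_finset {h : ℝ → U →L[ℝ] E} {ω : ℝ → U} {s t : ℝ} {I : E}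
    (hst : s ≤ t) (H : ∀ ε : ℝ, 0 < ε → ∃ F : Finset ℝ, ∀ (k : ℕ) (w : ℕ → ℝ),
      IsPartition s t k w → (∀ x ∈ F, x ∈ Icc s t → ∃ j ≤ k, w j = x) →
      ‖(∑ i ∈ Finset.range k, h (w i) (ω (w (i + 1)) - ω (w i))) - I‖ < ε) :
    HasYoungIntegral h ω s t I := by
  intro ε hε
  obtain ⟨F, hF⟩ := H ε hε
  obtain ⟨n, v, hv, _, hr, _⟩ := exists_partition hst F
  refine ⟨n, v, hv, fun k w hw hvw => hF k w hw fun x hx hxI => ?_⟩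
  obtain ⟨i, hi, rfl⟩ := hr x hx hxI
  exact hvw i hi

/-- **Young–Loève estimate** for the Young integral; the integrand is only seen on `[s, t)`. -/
theorem young_local {p q : ℝ} (hp : 1 ≤ p) (hq : 1 ≤ q) (hpq : 1 < 1 / p + 1 / q)
    {h : ℝ → U →L[ℝ] E} {ω : ℝ → U} {a s t : ℝ} (has : a ≤ s) (hst : s ≤ t) {I J : E}
    (hI : HasYoungIntegral h ω a s I) (hJ : HasYoungIntegral h ω a t J)
    (hh : HasFinVar q h (Ico s t)) (hω : HasFinVar p ω (Icc s t)) :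
    ‖J - I - h s (ω t - ω s)‖ ≤
      youngConst p q * (varNorm q h (Ico s t) * varNorm p ω (Icc s t)) := by
  have hp0 : 0 < p := by linarith
  have hq0 : 0 < q := by linarith
  refine le_of_forall_pos_le_add fun ε hε => ?_
  obtain ⟨F₁, h₁⟩ := hI.exists_finset (half_pos hε)
  obtain ⟨F₂, h₂⟩ := hJ.exists_finset (half_pos hε)
  obtain ⟨m, v, hv, hvI, hvr, -⟩ := exists_partition has (F₁ ∪ F₂)
  obtain ⟨k, w, hw, hwI, hwr, hwt⟩ := exists_partition hst F₂
  -- concatenate the two partitions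
  set z : ℕ → ℝ := fun i => if i ≤ m then v i else w (i - m) with hz
  have hzv : ∀ i ≤ m, z i = v i := fun i hi => by simp [hz, hi]
  have hzw : ∀ i, z (m + i) = w i := fun i => by
    by_cases hi : i = 0
    · subst hi; simp [hz, hv.2.2, hw.2.1]
    · have : ¬ m + i ≤ m := by omega
      simp [hz, this]
  have hzmono : Monotone z := monotone_nat_of_le_succ fun i => by
    rcases Nat.lt_or_ge i m with hi | hi
    · rw [hzv i hi.le, hzv (i + 1) hi]; exact hv.1 (Nat.le_succ i)
    · obtain ⟨j, rfl⟩ := Nat.exists_eq_add_of_le hi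
      rw [hzw, add_assoc, hzw]; exact hw.1 (Nat.le_succ j)
  have hzp : IsPartition a t (m + k) z :=
    ⟨hzmono, by rw [hzv 0 (Nat.zero_le _)]; exact hv.2.1, by rw [hzw]; exact hw.2.2⟩
  have e₁ := h₁ m v hv fun x hx hxI => hvr x (Finset.mem_union_left _ hx) hxI
  have e₂ := h₂ (m + k) z hzp fun x hx hxI => by
    rcases le_total x s with hxs | hxs
    · obtain ⟨j, hj, rfl⟩ := hvr x (Finset.mem_union_right _ hx) ⟨hxI.1, hxs⟩
      exact ⟨j, by omega, hzv j hj⟩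
    · obtain ⟨j, hj, rfl⟩ := hwr x hx ⟨hxs, hxI.2⟩
      exact ⟨m + j, by omega, hzw j⟩
  have esum : ∑ i ∈ Finset.range (m + k), h (z i) (ω (z (i + 1)) - ω (z i)) =
      ∑ i ∈ Finset.range m, h (v i) (ω (v (i + 1)) - ω (v i)) +
      ∑ i ∈ Finset.range k, h (w i) (ω (w (i + 1)) - ω (w i)) := by
    rw [Finset.sum_range_add]
    congr 1
    · refine Finset.sum_congr rfl fun i hi => ?_
      have := Finset.mem_range.1 hi
      rw [hzv i (by omega), hzv (i + 1) (by omega)]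
    · refine Finset.sum_congr rfl fun i _ => ?_
      rw [hzw, add_assoc, hzw]
  have key := young_loeve hp hq hpq (fun l => h (w l)) (fun l => ω (w l)) (Nat.zero_le k)
  rw [← Finset.range_eq_Ico, hw.2.1, hw.2.2] at key
  have k1 : varNorm q (fun l => h (w l)) (Ico 0 k) ≤ varNorm q h (Ico s t) :=
    hh.varNorm_comp_le hq0 (hw.1.monotoneOn _) fun j hj => ⟨(hwI j).1, hwt j hj.2⟩
  have k2 : varNorm p (fun l => ω (w l)) (Icc 0 k) ≤ varNorm p ω (Icc s t) :=
    hω.varNorm_comp_le hp0 (hw.1.monotoneOn _) fun j _ => hwI j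
  have k3 : youngConst p q * (varNorm q (fun l => h (w l)) (Ico 0 k) *
      varNorm p (fun l => ω (w l)) (Icc 0 k)) ≤
      youngConst p q * (varNorm q h (Ico s t) * varNorm p ω (Icc s t)) :=
    mul_le_mul_of_nonneg_left (mul_le_mul k1 k2 varNorm_nonneg varNorm_nonneg)
      (youngConst_nonneg hpq)
  rw [esum] at e₂
  set S₁ := ∑ i ∈ Finset.range m, h (v i) (ω (v (i + 1)) - ω (v i))
  set S₂ := ∑ i ∈ Finset.range k, h (w i) (ω (w (i + 1)) - ω (w i))
  have e : J - I - h s (ω t - ω s) = (S₂ - h s (ω t - ω s)) + (S₁ - I) - (S₁ + S₂ - J) := by abel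
  have t1 := norm_sub_le ((S₂ - h s (ω t - ω s)) + (S₁ - I)) (S₁ + S₂ - J)
  have t2 := norm_add_le (S₂ - h s (ω t - ω s)) (S₁ - I)
  rw [e]
  linarith

end YoungIntegral

/-! ### Stability of Young differential equations -/

section YoungEquation

variable {U E : Type*} [NormedAddCommGroup U] [NormedSpace ℝ U] [NormedAddCommGroup E]
  [NormedSpace ℝ E]

/-- `Y` is a càdlàg solution of finite `p`-variation of `dY = f(Y) dω`, `Y(a) = ξ`, on `[a, c]`. -/
def SolvesYoung (p a c : ℝ) (f : E → U →L[ℝ] E) (ξ : E) (ω : ℝ → U) (Y : ℝ → E) : Prop :=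
  IsCadlag a c Y ∧ HasFinVar p Y (Icc a c) ∧
    ∀ t ∈ Icc a c, HasYoungIntegral (fun r => f (Y r)) ω a t (Y t - ξ)

variable {f : E → U →L[ℝ] E} {π : U →L[ℝ] ℝ} {A : E → E} {B : E → U →L[ℝ] E} {α M p : ℝ}

theorem SolvesYoung.initial {a c : ℝ} (hac : a ≤ c) {ξ : E} {ω : ℝ → U} {Y : ℝ → E}
    (h : SolvesYoung p a c f ξ ω Y) : Y a = ξ := by
  rw [← sub_eq_zero, ← norm_le_zero_iff]
  refine le_of_forall_pos_le_add fun ε hε => ?_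
  obtain ⟨F, hF⟩ := (h.2.2 a ⟨le_rfl, hac⟩).exists_finset hε
  obtain ⟨k, w, hw, hwI, hwr, -⟩ := exists_partition (le_refl a) F
  have hwa : ∀ i, w i = a := fun i => le_antisymm (hwI i).2 (hwI i).1
  have := hF k w hw hwr
  simp only [hwa, sub_self, map_zero, Finset.sum_const_zero, zero_sub, norm_neg] at this
  linarith

/-- Along fine partitions, a solution is an Euler scheme up to a perturbation that is small in
`p`-variation. The integrand is estimated in `q`-variation, `p < q < 2`, which is small on intervals
`[s, t)` on which `Y` oscillates little. -/
theorem SolvesYoung.exists_finset_euler (hf : IsYoungField f π A B α M) (hp : 1 ≤ p) (hp2 : p < 2)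
    {a c : ℝ} {ξ : E} {ω : ℝ → U} {Y : ℝ → E} (hω : HasFinVar p ω (Icc a c))
    (h : SolvesYoung p a c f ξ ω Y) {ε : ℝ} (hε : 0 < ε) :
    ∃ F : Finset ℝ, ∀ (k : ℕ) (w : ℕ → ℝ), IsPartition a c k w → (∀ i, w i ∈ Icc a c) →
      (∀ x ∈ F, x ∈ Icc a c → ∃ j ≤ k, w j = x) →
      ∃ r : ℕ → E, IsPerturbedEuler f (fun l => ω (w l)) r (fun l => Y (w l)) ∧
        varNorm p r (Icc 0 k) ≤ ε := by
  have hp0 : 0 < p := by linarith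
  set q := (p + 2) / 2 with hq
  have hpq' : p < q := by rw [hq]; linarith
  have hq2 : q < 2 := by rw [hq]; linarith
  have hq0 : 0 < q := by linarith
  have hq1 : 1 ≤ q := by linarith
  have hpq : 1 < 1 / p + 1 / q := by
    have h1 : 1 / 2 < 1 / p := one_div_lt_one_div_of_lt hp0 hp2
    have h2 : 1 / 2 < 1 / q := one_div_lt_one_div_of_lt hq0 hq2
    linarith
  have hθ : 0 < 1 / p + 1 / q := by positivity
  have hC := youngConst_nonneg hpq
  have hM := hf.pos
  set C := youngConst p q with hCdef
  set σ := 1 - p / q with hσ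
  have hσ0 : 0 < σ := by
    rw [hσ, sub_pos, div_lt_one hq0]; exact hpq'
  set V := varNorm p Y (Icc a c) with hV
  have hV0 : 0 ≤ V := varNorm_nonneg
  set Ω := varNorm p ω (Icc a c) with hΩ
  have hΩ0 : 0 ≤ Ω := varNorm_nonneg
  set T := C * M * V ^ (p / q) * Ω with hT
  have hT0 : 0 ≤ T := by positivity
  set δ := ε / (T + 1) with hδ
  have hδ0 : 0 < δ := by positivity
  set η := δ ^ σ⁻¹ with hη
  have hη0 : 0 < η := Real.rpow_pos_of_pos hδ0 _
  have hησ : η ^ σ = δ := Real.rpow_inv_rpow hδ0.le hσ0.ne'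
  obtain ⟨F, hF⟩ := h.1.exists_finset_gap hη0
  refine ⟨F, fun k w hw hwI hwF => ?_⟩
  set ρ : ℕ → E := fun j => Y (w (j + 1)) - Y (w j) - f (Y (w j)) (ω (w (j + 1)) - ω (w j)) with hρ
  refine ⟨fun l => ∑ j ∈ Finset.range l, ρ j, fun l => ?_, ?_⟩
  · simp only [Finset.sum_range_succ, hρ]
    abel
  -- the `p / q`-th power of the `p`-variation of `Y` on `[s, t]`
  set b : ℝ → ℝ → ℝ := fun s t => varNorm p Y (Icc s t) ^ (p / q) with hb
  have hb0 : ∀ s t, 0 ≤ b s t := fun s t => Real.rpow_nonneg varNorm_nonneg _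
  have hbq : ∀ s t, b s t ^ q = varNorm p Y (Icc s t) ^ p := fun s t => by
    simp only [hb]
    rw [← Real.rpow_mul varNorm_nonneg, div_mul_cancel₀ _ hq0.ne']
  have hstep : ∀ l < k, ‖ρ l‖ ≤ C * M * δ *
      (b (w l) (w (l + 1)) * varNorm p ω (Icc (w l) (w (l + 1)))) := by
    intro l hl
    have hll : w l ≤ w (l + 1) := hw.1 (Nat.le_succ l)
    have sub : Icc (w l) (w (l + 1)) ⊆ Icc a c := Icc_subset_Icc (hwI l).1 (hwI (l + 1)).2
    have hYI : HasFinVar p Y (Icc (w l) (w (l + 1))) := h.2.1.mono hp0 sub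
    have hYo : SumLE p (fun x y => ‖f (Y y) - f (Y x)‖) (Ico (w l) (w (l + 1)))
        (M * varNorm p Y (Icc (w l) (w (l + 1)))) :=
      SumLE.lipschitz_comp hp0 varNorm_nonneg hM.le (fun x _ y _ => hf.lipschitz _ _)
        (((hYI.mono hp0 Ico_subset_Icc_self).sumLE hp0).mono_right hp0.le varNorm_nonneg
          (hYI.varNorm_mono hp0 Ico_subset_Icc_self))
    have hgap : ∀ x ∈ Ico (w l) (w (l + 1)), ∀ y ∈ Ico (w l) (w (l + 1)), x ≤ y →
        ‖f (Y y) - f (Y x)‖ ≤ M * η := fun x hx y hy hxy => by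
      refine (hf.lipschitz _ _).trans (mul_le_mul_of_nonneg_left (hF x
        (sub ⟨hx.1, hx.2.le⟩) y (sub ⟨hy.1, hy.2.le⟩) hxy fun z hz hzz => ?_) hM.le)
      have hza : z ∈ Icc a c := sub ⟨hx.1.trans hzz.1.le, hzz.2.trans hy.2.le⟩
      obtain ⟨j, _, rfl⟩ := hwF z hz hza
      have j1 : l < j := by
        by_contra hc
        exact absurd (hw.1 (not_lt.1 hc)) (not_le.2 (hx.1.trans_lt hzz.1))
      exact absurd (hw.1 j1) (not_le.2 (hzz.2.trans_lt hy.2))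
    have hint := SumLE.interpolate hp0 hpq'.le (mul_nonneg hM.le varNorm_nonneg)
      (by positivity : 0 ≤ M * η)
      (fun _ _ _ _ _ => norm_nonneg _) hgap hYo
    have h0 : 0 ≤ (M * η) ^ (1 - p / q) * (M * varNorm p Y (Icc (w l) (w (l + 1)))) ^ (p / q) :=
      mul_nonneg (Real.rpow_nonneg (by positivity) _)
        (Real.rpow_nonneg (mul_nonneg hM.le varNorm_nonneg) _)
    have hvq := hint.varNorm_le (f := fun r => f (Y r)) hq0 h0
    have heq : (M * η) ^ (1 - p / q) * (M * varNorm p Y (Icc (w l) (w (l + 1)))) ^ (p / q) =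
        M * δ * b (w l) (w (l + 1)) := by
      rw [Real.mul_rpow hM.le hη0.le, Real.mul_rpow hM.le varNorm_nonneg, ← hσ, hησ]
      have : M = M ^ σ * M ^ (p / q) := by
        rw [← Real.rpow_add hM, hσ, sub_add_cancel, Real.rpow_one]
      simp only [hb]
      nth_rw 3 [this]
      ring
    have key := young_local hp hq1 hpq (hwI l).1 hll (h.2.2 _ (hwI l)) (h.2.2 _ (hwI (l + 1)))
      (hint.hasFinVar (f := fun r => f (Y r)) hq0 h0) (hω.mono hp0 sub)
    rw [sub_sub_sub_cancel_right] at key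
    refine key.trans ?_
    rw [heq] at hvq
    calc _ ≤ C * (M * δ * b (w l) (w (l + 1)) * varNorm p ω (Icc (w l) (w (l + 1)))) :=
          mul_le_mul_of_nonneg_left (mul_le_mul_of_nonneg_right hvq varNorm_nonneg) hC
      _ = _ := by ring
  set lam := 1 / q / (1 / p + 1 / q) with hlam
  have hl0 : 0 < lam := by positivity
  have hl1 : lam < 1 := by
    rw [hlam, div_lt_one hθ]; have : 0 < 1 / p := by positivity
    linarith
  set κ : ℝ → ℝ → ℝ := fun s t => (b s t ^ q) ^ lam * (varNorm p ω (Icc s t) ^ p) ^ (1 - lam)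
    with hκ
  have hκ0 : ∀ s t, 0 ≤ κ s t := fun s t => mul_nonneg
    (Real.rpow_nonneg (Real.rpow_nonneg (hb0 _ _) _) _)
    (Real.rpow_nonneg (Real.rpow_nonneg varNorm_nonneg _) _)
  have hκθ : ∀ s t, κ s t ^ (1 / p + 1 / q) = b s t * varNorm p ω (Icc s t) := fun s t =>
    rpow_geomMean_eq hp0 hq0 (hb0 _ _) varNorm_nonneg
  have hκs : ∀ x ∈ Icc a c, ∀ y ∈ Icc a c, ∀ z ∈ Icc a c, x ≤ y → y ≤ z →
      κ x y + κ y z ≤ κ x z := fun x hx y hy z hz hxy hyz => by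
    have nn : ∀ {F : Type _} [NormedAddCommGroup F] (g : ℝ → F) (s t : ℝ),
      0 ≤ varNorm p g (Icc s t) ^ p := fun g s t => Real.rpow_nonneg varNorm_nonneg _
    have nn' : ∀ s t : ℝ, 0 ≤ varNorm p ω (Icc s t) ^ p :=
      fun s t => Real.rpow_nonneg varNorm_nonneg _
    have sub : Icc x z ⊆ Icc a c := Icc_subset_Icc hx.1 hz.2
    have s1 := varNorm_superadd (f := Y) hp0 (Icc_subset_Icc_right hyz : Icc x y ⊆ Icc x z)
      (Icc_subset_Icc_left hxy) (fun u hu v hv => hu.2.trans hv.1) (h.2.1.mono hp0 sub)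
    have s2 := varNorm_superadd (f := ω) hp0 (Icc_subset_Icc_right hyz : Icc x y ⊆ Icc x z)
      (Icc_subset_Icc_left hxy) (fun u hu v hv => hu.2.trans hv.1) (hω.mono hp0 sub)
    simp only [hκ, hbq]
    refine (rpow_mul_rpow_add_le (nn _ _ _) (nn' _ _) (nn _ _ _) (nn' _ _) hl0 hl1).trans ?_
    exact mul_le_mul (Real.rpow_le_rpow (add_nonneg (nn _ _ _) (nn _ _ _)) s1 hl0.le)
      (Real.rpow_le_rpow (add_nonneg (nn' _ _) (nn' _ _)) s2 (by linarith))
      (Real.rpow_nonneg (add_nonneg (nn' _ _) (nn' _ _)) _) (Real.rpow_nonneg (nn _ _ _) _)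
  have hblock : ∀ i j, i ≤ j → j ≤ k → ‖∑ l ∈ Finset.Ico i j, ρ l‖ ≤
      C * M * δ * V ^ (p / q) * varNorm p ω (Icc (w i) (w j)) := by
    intro i j hij hjk
    obtain ⟨n, rfl⟩ := Nat.exists_eq_add_of_le hij
    rw [Finset.sum_Ico_eq_sum_range, Nat.add_sub_cancel_left]
    have h1 : ∑ l ∈ Finset.range n, κ (w (i + l)) (w (i + (l + 1))) ^ (1 / p + 1 / q) ≤
        κ (w i) (w (i + n)) ^ (1 / p + 1 / q) := by
      refine (sum_rpow_le_rpow_sum _ _ (fun l _ => hκ0 _ _) hpq.le).trans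
        (Real.rpow_le_rpow (Finset.sum_nonneg fun l _ => hκ0 _ _) ?_ hθ.le)
      exact sum_superadditive_le (s := Icc a c) (fun x _ => hκ0 x x) hκs (fun l => w (i + l))
        (fun l m hlm => hw.1 (by omega)) (fun l => hwI _) n
    simp only [hκθ] at h1
    have h2 : b (w i) (w (i + n)) ≤ V ^ (p / q) :=
      Real.rpow_le_rpow varNorm_nonneg (h.2.1.varNorm_mono hp0
        (Icc_subset_Icc (hwI _).1 (hwI _).2)) (by positivity)
    calc ‖∑ l ∈ Finset.range n, ρ (i + l)‖
        ≤ ∑ l ∈ Finset.range n, C * M * δ * (b (w (i + l)) (w (i + (l + 1))) *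
            varNorm p ω (Icc (w (i + l)) (w (i + (l + 1))))) :=
          norm_sum_le_of_le _ fun l hl => hstep (i + l) (by
            have := Finset.mem_range.1 hl; omega)
      _ = C * M * δ * ∑ l ∈ Finset.range n, b (w (i + l)) (w (i + (l + 1))) *
            varNorm p ω (Icc (w (i + l)) (w (i + (l + 1)))) := by rw [Finset.mul_sum]
      _ ≤ C * M * δ * (V ^ (p / q) * varNorm p ω (Icc (w i) (w (i + n)))) :=
          mul_le_mul_of_nonneg_left (h1.trans (mul_le_mul_of_nonneg_right h2 varNorm_nonneg))
            (by positivity)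
      _ = _ := by ring
  have hfin : SumLE p (fun x y => ‖∑ j ∈ Finset.range y, ρ j - ∑ j ∈ Finset.range x, ρ j‖)
      (Icc 0 k) (C * M * δ * V ^ (p / q) * Ω) := by
    intro n u hu hus
    have h1 := (SumLE.const_mul (D := C * M * δ * V ^ (p / q)) varNorm_nonneg (by positivity)
      (fun _ _ _ _ _ => varNorm_nonneg) (hω.sumLE_varNorm hp0)) n (fun l => w (u l))
      (fun l m hlm => hw.1 (hu hlm)) fun l => hwI _
    refine le_trans (Finset.sum_le_sum fun l _ => ?_) h1
    refine Real.rpow_le_rpow (norm_nonneg _) ?_ hp0.le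
    simp only
    rw [← Finset.sum_Ico_eq_sub _ (hu (Nat.le_succ l) : u l ≤ u (l + 1))]
    exact hblock _ _ (hu (Nat.le_succ l)) (hus _).2
  refine (hfin.varNorm_le hp0 (by positivity)).trans ?_
  calc C * M * δ * V ^ (p / q) * Ω = T * ε / (T + 1) := by rw [hT, hδ]; ring
    _ ≤ ε := by rw [div_le_iff₀ (by positivity)]; nlinarith

/-- **Stability of Young differential equations** in `p`-variation. -/
theorem young_stability (hf : IsYoungField f π A B α M) (hp : 1 ≤ p) (hp2 : p < 2) (hα : 0 < α)
    (hα1 : α ≤ 1) (hpα : p < 1 + α) (R : ℝ) : ∃ K : ℝ, 0 ≤ K ∧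
      ∀ (a c : ℝ) (ω ω' : ℝ → U) (ξ ξ' : E) (Y Y' : ℝ → E), a ≤ c →
        HasFinVar p ω (Icc a c) → HasFinVar p ω' (Icc a c) →
        varNorm p ω (Icc a c) ≤ R → varNorm p ω' (Icc a c) ≤ R →
        MonotoneOn (fun t => π (ω t)) (Icc a c) → π (ω c) - π (ω a) ≤ R →
        SolvesYoung p a c f ξ ω Y → SolvesYoung p a c f ξ' ω' Y' →
        SumLE p (fun s t => ‖(Y t - Y' t) - (Y s - Y' s)‖) (Icc a c)
          (K * (‖ξ - ξ'‖ + varNorm p (fun t => ω t - ω' t) (Icc a c))) := by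
  classical
  obtain ⟨K, hK0, hK⟩ := euler_stability hf hp hα hα1 hpα R
  have hp0 : 0 < p := by linarith
  refine ⟨K, hK0, fun a c ω ω' ξ ξ' Y Y' hac hω hω' hR hR' hmono hπ hY hY' n u hu hus => ?_⟩
  set d := varNorm p (fun t => ω t - ω' t) (Icc a c) with hd
  have hd0 : 0 ≤ d := varNorm_nonneg
  have hfin := hω.sub hp hω'
  have main : ∀ ε : ℝ, 0 < ε → ε ≤ 1 →
      ∑ i ∈ Finset.range n, ‖(Y (u (i + 1)) - Y' (u (i + 1))) - (Y (u i) - Y' (u i))‖ ^ p ≤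
        (K * (‖ξ - ξ'‖ + (d + 2 * ε))) ^ p := by
    intro ε hε hε1
    obtain ⟨F₁, h₁⟩ := hY.exists_finset_euler hf hp hp2 hω hε
    obtain ⟨F₂, h₂⟩ := hY'.exists_finset_euler hf hp hp2 hω' hε
    obtain ⟨k, w, hw, hwI, hwr, -⟩ := exists_partition hac
      (F₁ ∪ F₂ ∪ (Finset.range (n + 1)).image u)
    obtain ⟨r, hr, hr'⟩ := h₁ k w hw hwI fun x hx => hwr x (by simp [hx])
    obtain ⟨s, hs, hs'⟩ := h₂ k w hw hwI fun x hx => hwr x (by simp [hx])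
    have hm : MapsTo w (Icc 0 k) (Icc a c) := fun l _ => hwI l
    have key := hK k (d + 2 * ε) (fun l => ω (w l)) (fun l => ω' (w l)) r s (fun l => Y (w l))
      (fun l => Y' (w l))
      { left := hr
        right := hs
        mono := fun i j hij => hmono (hwI i) (hwI j) (hw.1 hij)
        left_le := (hω.varNorm_comp_le hp0 (hw.1.monotoneOn _) hm).trans hR
        right_le := (hω'.varNorm_comp_le hp0 (hw.1.monotoneOn _) hm).trans hR'
        mono_le := by rw [hw.2.1, hw.2.2]; exact hπ
        left_pert := hr'.trans hε1
        right_pert := hs'.trans hε1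
        driver_sub := by
          have := hfin.varNorm_comp_le hp0 (hw.1.monotoneOn (Icc 0 k)) hm
          linarith
        pert_sub := by
          have := (hasFinVar_nat hp r 0 k).varNorm_sub_le hp (hasFinVar_nat hp s 0 k)
          linarith }
    rw [hw.2.1, hY.initial hac, hY'.initial hac] at key
    have hsum : SumLE p (fun s t => ‖(Y t - Y' t) - (Y s - Y' s)‖) (w '' Icc 0 k)
        (K * (‖ξ - ξ'‖ + (d + 2 * ε))) :=
      SumLE.of_comp (f := fun t => Y t - Y' t) (hw.1.monotoneOn _) (surjOn_image w (Icc 0 k))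
        (((hasFinVar_nat hp (fun l => Y (w l) - Y' (w l)) 0 k).sumLE hp0).mono_right hp0.le
          varNorm_nonneg key)
    have := hsum n (fun i => u (min i n)) (fun i j hij => hu (min_le_min_right n hij)) (fun i => by
      obtain ⟨j, hj, hju⟩ := hwr (u (min i n)) (Finset.mem_union_right _
        (Finset.mem_image_of_mem u (Finset.mem_range.2 (by omega)))) (hus _)
      exact ⟨j, ⟨Nat.zero_le j, hj⟩, hju⟩)
    refine le_trans (le_of_eq (Finset.sum_congr rfl fun i hi => ?_)) this
    have := Finset.mem_range.1 hi
    simp only [min_eq_left (show i ≤ n by omega), min_eq_left (show i + 1 ≤ n by omega)]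
  have hlim : Tendsto (fun ε : ℝ => (K * (‖ξ - ξ'‖ + (d + 2 * ε))) ^ p) (𝓝[>] 0)
      (𝓝 ((K * (‖ξ - ξ'‖ + (d + 2 * 0))) ^ p)) := by
    have hc : Continuous fun ε : ℝ => (K * (‖ξ - ξ'‖ + (d + 2 * ε))) ^ p :=
      (by fun_prop : Continuous fun ε : ℝ => K * (‖ξ - ξ'‖ + (d + 2 * ε))).rpow_const
        fun _ => Or.inr hp0.le
    exact (hc.tendsto 0).mono_left nhdsWithin_le_nhds
  rw [mul_zero, add_zero] at hlim
  refine ge_of_tendsto hlim ?_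
  filter_upwards [Ioc_mem_nhdsGT (one_pos : (0 : ℝ) < 1)] with ε hε
  exact main ε hε.1 hε.2

end YoungEquation

/-! ### Existence of solutions -/

section Existence

variable {U E : Type*} [NormedAddCommGroup U] [NormedSpace ℝ U] [NormedAddCommGroup E]
  [NormedSpace ℝ E]

/-- `Y` is the Euler scheme along the finite set `F` of times after `a`, as a step function, and
`θ t` is the last of the times in `F ∪ {a}` up to `t`. -/
structure IsStepSolution (f : E → U →L[ℝ] E) (a : ℝ) (F : Finset ℝ) (ξ : E) (ω : ℝ → U)
    (θ : ℝ → ℝ) (Y : ℝ → E) : Prop where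
  mono : MonotoneOn θ (Ici a)
  ge : ∀ t, a ≤ t → a ≤ θ t
  le : ∀ t, a ≤ t → θ t ≤ t
  last : ∀ t, a ≤ t → ∀ x ∈ F, x ≤ t → x ≤ θ t
  const : ∀ s t, a ≤ s → s ≤ t → (∀ x ∈ F, ¬ (s < x ∧ x ≤ t)) → θ s = θ t ∧ Y s = Y t
  step : ∀ s t, a ≤ s → s ≤ t → (∀ x ∈ F, ¬ (s < x ∧ x < t)) →
    Y t - Y s = f (Y s) (ω (θ t) - ω (θ s))
  init : Y a = ξ

theorem exists_isStepSolution (f : E → U →L[ℝ] E) (a : ℝ) (ξ : E) (ω : ℝ → U) (F : Finset ℝ)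
    (hF : ∀ x ∈ F, a < x) : ∃ θ Y, IsStepSolution f a F ξ ω θ Y := by
  induction F using Finset.induction_on_max with
  | empty =>
    exact ⟨fun _ => a, fun _ => ξ, fun _ _ _ _ _ => le_rfl, fun _ _ => le_rfl, fun _ h => h,
      by simp, fun _ _ _ _ _ => ⟨rfl, rfl⟩, by simp, rfl⟩
  | insert m F hm ih =>
    obtain ⟨θ, Y, h⟩ := ih fun x hx => hF x (Finset.mem_insert_of_mem hx)
    have ham : a < m := hF m (Finset.mem_insert_self _ _)
    refine ⟨fun t => if t < m then θ t else m,
      fun t => if t < m then Y t else Y m + f (Y m) (ω m - ω (θ m)), ?_, ?_, ?_, ?_, ?_, ?_, ?_⟩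
    · intro s hs t ht hst
      by_cases h1 : t < m
      · simpa [h1, hst.trans_lt h1] using h.mono hs ht hst
      · by_cases h2 : s < m
        · simpa [h1, h2] using (h.le s hs).trans h2.le
        · simp [h1, h2]
    · intro t ht
      by_cases h1 : t < m
      · simpa [h1] using h.ge t ht
      · simpa [h1] using ham.le
    · intro t ht
      by_cases h1 : t < m
      · simpa [h1] using h.le t ht
      · simpa [h1] using not_lt.1 h1
    · intro t ht x hx hxt
      by_cases h1 : t < m
      · have hx' : x ∈ F := (Finset.mem_insert.1 hx).resolve_left (by
          rintro rfl; exact absurd hxt (not_le.2 h1))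
        simpa [h1] using h.last t ht x hx' hxt
      · rcases Finset.mem_insert.1 hx with rfl | hx'
        · simp [h1]
        · simpa [h1] using (hm x hx').le
    · intro s t hs hst hgap
      by_cases h1 : t < m
      · simpa [h1, hst.trans_lt h1] using h.const s t hs hst fun x hx =>
          hgap x (Finset.mem_insert_of_mem hx)
      · have h2 : ¬ s < m := fun h2 => hgap m (Finset.mem_insert_self _ _) ⟨h2, not_lt.1 h1⟩
        simp [h1, h2]
    · intro s t hs hst hgap
      by_cases h1 : t < m
      · simpa [h1, hst.trans_lt h1] using h.step s t hs hst fun x hx =>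
          hgap x (Finset.mem_insert_of_mem hx)
      · by_cases h2 : s < m
        · have h3 := hgap m (Finset.mem_insert_self _ _)
          have htm : t = m := le_antisymm (not_lt.1 fun h4 => h3 ⟨h2, h4⟩) (not_lt.1 h1)
          subst htm
          obtain ⟨e1, e2⟩ := h.const s t hs hst fun x hx hh =>
            hgap x (Finset.mem_insert_of_mem hx) ⟨hh.1, hm x hx⟩
          simp [h2, e1, e2]
        · simp [h1, h2]
    · simpa [ham] using h.init

variable {f : E → U →L[ℝ] E} {π : U →L[ℝ] ℝ} {A : E → E} {B : E → U →L[ℝ] E} {α M p : ℝ}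

theorem IsStepSolution.solvesYoung {a c : ℝ} (hac : a ≤ c) {F : Finset ℝ} {ξ : E} {ω : ℝ → U}
    {θ : ℝ → ℝ} {Y : ℝ → E} (h : IsStepSolution f a F ξ ω θ Y) (hp : 1 ≤ p) :
    SolvesYoung p a c f ξ (fun t => ω (θ t)) Y := by
  refine ⟨⟨fun t ht => ?_, fun t ht => ?_⟩, ?_, fun t ht => ?_⟩
  · have : ∀ᶠ s in 𝓝[>] t, ∀ x ∈ F, ¬ (t < x ∧ x ≤ s) := by
      rw [Filter.eventually_all_finset]
      intro x _
      by_cases hx : t < x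
      · filter_upwards [Ioo_mem_nhdsGT hx] with s hs hh
        exact absurd hh.2 (not_le.2 hs.2)
      · exact Eventually.of_forall fun s hh => hx hh.1
    refine tendsto_const_nhds.congr' ?_
    filter_upwards [this, self_mem_nhdsWithin] with s hs hts
    exact (h.const t s ht.1 (le_of_lt hts) hs).2
  · have : ∀ᶠ s in 𝓝[<] t, ∀ x ∈ F, ¬ (s < x ∧ x < t) := by
      rw [Filter.eventually_all_finset]
      intro x _
      by_cases hx : x < t
      · filter_upwards [Ioo_mem_nhdsLT hx] with s hs hh
        exact absurd hh.1 (not_lt.2 hs.1.le)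
      · exact Eventually.of_forall fun s hh => hx hh.2
    obtain ⟨s₀, h1, h2⟩ := (this.and (Ioo_mem_nhdsLT ht.1)).exists
    refine ⟨Y s₀, tendsto_const_nhds.congr' ?_⟩
    filter_upwards [Ioo_mem_nhdsLT h2.2] with s hs
    exact (h.const s₀ s h2.1.le hs.1.le fun x hx hh => h1 x hx ⟨hh.1, hh.2.trans_lt hs.2⟩).2
  · obtain ⟨k, w, hw, hwI, hwr, -⟩ := exists_partition hac F
    classical
    set j : ℝ → ℕ := fun t => Nat.findGreatest (fun l => w l ≤ t) k with hj
    have hjw : ∀ t ∈ Icc a c, w (j t) ≤ t := fun t ht =>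
      Nat.findGreatest_spec (P := fun l => w l ≤ t) (n := k) (m := 0) (Nat.zero_le _)
        (by rw [hw.2.1]; exact ht.1)
    have hjm : Monotone j := fun s t hst =>
      Nat.findGreatest_mono (P := fun l => w l ≤ s) (Q := fun l => w l ≤ t)
        (fun l (hl : w l ≤ s) => hl.trans hst) le_rfl
    have e : EqOn Y (fun t => Y (w (j t))) (Icc a c) := fun t ht =>
      (h.const (w (j t)) t (hwI _).1 (hjw t ht) fun x hx hh => by
        obtain ⟨i, hi, rfl⟩ := hwr x hx ⟨(hwI _).1.trans hh.1.le, hh.2.trans ht.2⟩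
        have : i ≤ j t := Nat.le_findGreatest hi hh.2
        exact absurd (hw.1 this) (not_le.2 hh.1)).2.symm
    have hjk : MapsTo j (Icc a c) (Icc 0 k) := fun t _ => ⟨Nat.zero_le _, Nat.findGreatest_le k⟩
    exact ((hasFinVar_nat hp (fun l => Y (w l)) 0 k).comp (by linarith) (hjm.monotoneOn _)
      hjk).congr (by linarith) e
  · refine HasYoungIntegral.of_finset ht.1 fun ε hε => ⟨F, fun k w hw hwr => ?_⟩
    have hge : ∀ i, a ≤ w i := fun i => by rw [← hw.2.1]; exact hw.1 (Nat.zero_le i)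
    have : ∑ i ∈ Finset.range k, f (Y (w i)) (ω (θ (w (i + 1))) - ω (θ (w i))) =
        ∑ i ∈ Finset.range k, (Y (w (i + 1)) - Y (w i)) := by
      refine Finset.sum_congr rfl fun i hi => (h.step (w i) (w (i + 1)) (hge i)
        (hw.1 (Nat.le_succ i)) fun x hx hh => ?_).symm
      have hi' := Finset.mem_range.1 hi
      obtain ⟨l, _, rfl⟩ := hwr x hx ⟨(hge i).trans hh.1.le, by
        rw [← hw.2.2]; exact hh.2.le.trans (hw.1 hi')⟩
      rcases Nat.lt_or_ge i l with hl | hl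
      · exact absurd (hw.1 hl) (not_le.2 hh.2)
      · exact absurd (hw.1 hl) (not_le.2 hh.1)
    rw [this, Finset.sum_range_sub (fun i => Y (w i)), hw.2.1, hw.2.2, h.init, sub_self, norm_zero]
    exact hε

theorem solvesYoung_const {a c : ℝ} (hp : 0 < p) (ξ : E) (u : U) :
    SolvesYoung p a c f ξ (fun _ => u) (fun _ => ξ) := by
  refine ⟨⟨fun _ _ => tendsto_const_nhds, fun _ _ => ⟨ξ, tendsto_const_nhds⟩⟩, ?_, fun t ht => ?_⟩
  · refine SumLE.hasFinVar (C := 0) hp le_rfl fun n u _ _ => ?_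
    simp [Real.zero_rpow hp.ne']
  · exact HasYoungIntegral.of_finset ht.1 fun ε hε => ⟨∅, fun k w _ _ => by simpa using hε⟩

/-- A priori bound for solutions, by comparison with a constant driver. -/
theorem SolvesYoung.exists_bound (hf : IsYoungField f π A B α M) (hp : 1 ≤ p) (hp2 : p < 2)
    (hα : 0 < α) (hα1 : α ≤ 1) (hpα : p < 1 + α) (R : ℝ) : ∃ K : ℝ, 0 ≤ K ∧
      ∀ (a c : ℝ) (ω : ℝ → U) (ξ : E) (Y : ℝ → E), a ≤ c →
        HasFinVar p ω (Icc a c) → varNorm p ω (Icc a c) ≤ R →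
        MonotoneOn (fun t => π (ω t)) (Icc a c) → π (ω c) - π (ω a) ≤ R →
        SolvesYoung p a c f ξ ω Y → SumLE p (fun s t => ‖Y t - Y s‖) (Icc a c) K := by
  have hp0 : 0 < p := by linarith
  obtain ⟨K, hK0, hK⟩ := young_stability hf hp hp2 hα hα1 hpα R
  refine ⟨K * (max R 0), by positivity, fun a c ω ξ Y hac hω hR hmono hπ hY => ?_⟩
  have h0 : SumLE p (fun x y : ℝ => ‖(0 : U) - 0‖) (Icc a c) 0 := fun n u _ _ => by
    simp [Real.zero_rpow hp0.ne']
  have hn0 : varNorm p (fun _ : ℝ => (0 : U)) (Icc a c) ≤ R :=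
    (h0.varNorm_le (f := fun _ => (0 : U)) hp0 le_rfl).trans (varNorm_nonneg.trans hR)
  have := hK a c ω (fun _ => 0) ξ ξ Y (fun _ => ξ) hac hω
    (h0.hasFinVar (f := fun _ => (0 : U)) hp0 le_rfl) hR hn0 hmono hπ hY (solvesYoung_const hp0 ξ 0)
  simp only [sub_self, norm_zero, zero_add, sub_zero, sub_sub_sub_cancel_right] at this
  exact this.mono_right hp0.le (mul_nonneg hK0 varNorm_nonneg)
    (mul_le_mul_of_nonneg_left (hR.trans (le_max_left _ _)) hK0)

/-- The bound of `norm_youngSum_sub_le`, which vanishes with `ε`. -/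
def youngModulus (M C R σ τ ε : ℝ) : ℝ :=
  (M * ε + C * ((M * (2 * ε)) ^ σ * (M * (2 * R)) ^ τ)) * R +
    (M + C * (M * R)) * ((2 * ε) ^ σ * (2 * R) ^ τ)

theorem exists_youngModulus_lt {M C R σ τ : ℝ} (hσ : 0 < σ) {δ : ℝ} (hδ : 0 < δ) :
    ∃ ε > 0, youngModulus M C R σ τ ε < δ := by
  have hc : Continuous (youngModulus M C R σ τ) := by
    have h1 : Continuous fun ε : ℝ => (M * (2 * ε)) ^ σ :=
      (by fun_prop : Continuous fun ε : ℝ => M * (2 * ε)).rpow_const fun _ => Or.inr hσ.le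
    have h2 : Continuous fun ε : ℝ => (2 * ε) ^ σ :=
      (by fun_prop : Continuous fun ε : ℝ => 2 * ε).rpow_const fun _ => Or.inr hσ.le
    unfold youngModulus
    fun_prop
  have h0 : youngModulus M C R σ τ 0 = 0 := by
    simp [youngModulus, Real.zero_rpow hσ.ne']
  have := hc.tendsto 0
  rw [h0] at this
  have hev : ∀ᶠ ε in 𝓝[>] (0 : ℝ), youngModulus M C R σ τ ε < δ :=
    (this.mono_left nhdsWithin_le_nhds).eventually (gt_mem_nhds hδ)
  obtain ⟨ε, h1, h2⟩ := (hev.and self_mem_nhdsWithin).exists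
  exact ⟨ε, h2, h1⟩

theorem sumLE_sub_of_norm_le {α : Type*} [LinearOrder α] {s : Set α} {F : Type*}
    [NormedAddCommGroup F] {p q R R' ε : ℝ} (hp : 1 ≤ p) (hpq : p ≤ q) (hR : 0 ≤ R) (hR' : 0 ≤ R')
    (hε : 0 ≤ ε) {g g' : α → F}
    (hg : SumLE p (fun x y => ‖g y - g x‖) s R) (hg' : SumLE p (fun x y => ‖g' y - g' x‖) s R')
    (h : ∀ x ∈ s, ‖g x - g' x‖ ≤ ε) :
    SumLE q (fun x y => ‖(g y - g' y) - (g x - g' x)‖) s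
      ((2 * ε) ^ (1 - p / q) * (R + R') ^ (p / q)) :=
  SumLE.interpolate (by linarith) hpq (by linarith) (by positivity)
    (fun _ _ _ _ _ => norm_nonneg _)
    (fun x hx y hy _ => (norm_sub_le _ _).trans (by linarith [h x hx, h y hy]))
    (hg.norm_sub hp hR hR' hg')

/-- Left-point sums of uniformly close integrands and integrators of bounded `p`-variation are
close, uniformly in the partition. -/
theorem norm_youngSum_sub_le (hf : IsYoungField f π A B α M) (hp : 1 ≤ p) {q : ℝ} (hpq' : p ≤ q)
    (hpq : 1 < 1 / q + 1 / q) {x x' : ℕ → U} {y y' : ℕ → E} {k : ℕ} {R ε : ℝ} (hR : 0 ≤ R)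
    (hε : 0 ≤ ε)
    (hx : varNorm p x (Icc 0 k) ≤ R) (hx' : varNorm p x' (Icc 0 k) ≤ R)
    (hy : varNorm p y (Icc 0 k) ≤ R) (hy' : varNorm p y' (Icc 0 k) ≤ R)
    (hxx : ∀ l ∈ Icc 0 k, ‖x l - x' l‖ ≤ ε) (hyy : ∀ l ∈ Icc 0 k, ‖y l - y' l‖ ≤ ε) :
    ‖∑ l ∈ Finset.range k, f (y l) (x (l + 1) - x l) -
      ∑ l ∈ Finset.range k, f (y' l) (x' (l + 1) - x' l)‖ ≤
      youngModulus M (youngConst q q) R (1 - p / q) (p / q) ε := by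
  have hp0 : 0 < p := by linarith
  have hq0 : 0 < q := by linarith
  have hq1 : 1 ≤ q := by linarith
  have hM := hf.pos
  have hC := youngConst_nonneg hpq
  have lip : ∀ z : ℕ → E, varNorm p z (Icc 0 k) ≤ R →
      SumLE p (fun a b => ‖f (z b) - f (z a)‖) (Icc 0 k) (M * R) := fun z hz =>
    SumLE.lipschitz_comp hp0 hR hM.le (fun a _ b _ => hf.lipschitz _ _)
      (((hasFinVar_nat hp z 0 k).sumLE hp0).mono_right hp0.le varNorm_nonneg hz)
  have h1 := sumLE_sub_of_norm_le (g := fun l => f (y l)) (g' := fun l => f (y' l)) hp hpq'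
    (by positivity : 0 ≤ M * R) (by positivity : 0 ≤ M * R) (by positivity : 0 ≤ M * ε)
    (lip y hy) (lip y' hy') fun l hl => (hf.lipschitz _ _).trans
      (mul_le_mul_of_nonneg_left (hyy l hl) hM.le)
  have h2 := sumLE_sub_of_norm_le (g := x) (g' := x') hp hpq' hR hR hε
    (((hasFinVar_nat hp x 0 k).sumLE hp0).mono_right hp0.le varNorm_nonneg hx)
    (((hasFinVar_nat hp x' 0 k).sumLE hp0).mono_right hp0.le varNorm_nonneg hx') hxx
  have v1 := h1.varNorm_le (f := fun l => f (y l) - f (y' l)) hq0 (by positivity)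
  have v2 := h2.varNorm_le (f := fun l => x l - x' l) hq0 (by positivity)
  have v3 : varNorm q x (Icc 0 k) ≤ R :=
    ((hasFinVar_nat hp x 0 k).varNorm_exponent_mono hp0 hpq').trans hx
  have hfy' := lip y' hy'
  have v4 : varNorm q (fun l => f (y' l)) (Icc 0 k) ≤ M * R :=
    ((hasFinVar_nat hp (fun l => f (y' l)) 0 k).varNorm_exponent_mono hp0 hpq').trans
      (hfy'.varNorm_le (f := fun l => f (y' l)) hp0 (by positivity))
  have y1 := young_norm_sub_le hq1 hq1 hpq (Nat.zero_le k) (h := fun l => f (y l) - f (y' l))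
    (x := x) (z := fun l => ∑ j ∈ Finset.range l, (f (y j) - f (y' j)) (x (j + 1) - x j))
    (fun l _ _ => by simp only [Finset.sum_range_succ]; abel)
    ((hf.lipschitz _ _).trans (mul_le_mul_of_nonneg_left (hyy 0 ⟨le_rfl, Nat.zero_le k⟩) hM.le))
  have y2 := young_norm_sub_le hq1 hq1 hpq (Nat.zero_le k) (h := fun l => f (y' l))
    (x := fun l => x l - x' l)
    (z := fun l => ∑ j ∈ Finset.range l, f (y' j) ((x (j + 1) - x' (j + 1)) - (x j - x' j)))
    (fun l _ _ => by simp only [Finset.sum_range_succ]; abel) (hf.norm_le _)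
  simp only [Finset.range_zero, Finset.sum_empty, sub_zero] at y1 y2
  have e : ∑ l ∈ Finset.range k, f (y l) (x (l + 1) - x l) -
      ∑ l ∈ Finset.range k, f (y' l) (x' (l + 1) - x' l) =
      ∑ j ∈ Finset.range k, (f (y j) - f (y' j)) (x (j + 1) - x j) +
      ∑ j ∈ Finset.range k, f (y' j) ((x (j + 1) - x' (j + 1)) - (x j - x' j)) := by
    rw [← Finset.sum_sub_distrib, ← Finset.sum_add_distrib]
    refine Finset.sum_congr rfl fun l _ => ?_
    rw [sub_sub_sub_comm (x (l + 1)), map_sub (f (y' l)) (x (l + 1) - x l), sub_apply]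
    abel
  rw [e]
  refine (norm_add_le _ _).trans (add_le_add (y1.trans ?_) (y2.trans ?_))
  · refine mul_le_mul ?_ v3 varNorm_nonneg (by positivity)
    have e1 : 2 * (M * ε) = M * (2 * ε) := by ring
    have e2 : M * R + M * R = M * (2 * R) := by ring
    rw [e1, e2] at v1
    linarith [mul_le_mul_of_nonneg_left v1 hC]
  · rw [← two_mul R] at v2
    exact mul_le_mul (by linarith [mul_le_mul_of_nonneg_left v4 hC]) v2 varNorm_nonneg
      (by positivity)

theorem IsCadlag.of_uniform_limit {E : Type*} [NormedAddCommGroup E] [CompleteSpace E] {a c : ℝ}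
    {Y : ℝ → E} (h : ∀ ε > 0, ∃ Y' : ℝ → E, IsCadlag a c Y' ∧ ∀ t ∈ Icc a c, ‖Y' t - Y t‖ ≤ ε) :
    IsCadlag a c Y := by
  constructor
  · intro t ht
    rw [Metric.tendsto_nhds]
    intro ε hε
    obtain ⟨Y', h1, h2⟩ := h (ε / 4) (by positivity)
    filter_upwards [Metric.tendsto_nhds.1 (h1.1 t ht) (ε / 4) (by positivity),
      Ioo_mem_nhdsGT ht.2] with s hs hst
    have h3 := h2 s ⟨ht.1.trans hst.1.le, hst.2.le⟩
    have h4 := h2 t ⟨ht.1, ht.2.le⟩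
    rw [← dist_eq_norm] at h3 h4
    have h5 := dist_triangle4 (Y s) (Y' s) (Y' t) (Y t)
    rw [dist_comm (Y s) (Y' s)] at h5
    linarith
  · intro t ht
    refine cauchy_map_iff_exists_tendsto.1 ?_
    rw [Metric.cauchy_iff]
    refine ⟨inferInstance, fun ε hε => ?_⟩
    obtain ⟨Y', h1, h2⟩ := h (ε / 6) (by positivity)
    obtain ⟨l, hl⟩ := h1.2 t ht
    refine ⟨Y '' ({s | dist (Y' s) l < ε / 6} ∩ Ioo a t), image_mem_map (inter_mem
      (Metric.tendsto_nhds.1 hl (ε / 6) (by positivity)) (Ioo_mem_nhdsLT ht.1)), ?_⟩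
    rintro _ ⟨s, ⟨hs, hsI⟩, rfl⟩ _ ⟨r, ⟨hr, hrI⟩, rfl⟩
    have h3 := h2 s ⟨hsI.1.le, hsI.2.le.trans ht.2⟩
    have h4 := h2 r ⟨hrI.1.le, hrI.2.le.trans ht.2⟩
    rw [← dist_eq_norm] at h3 h4
    have h5 := dist_triangle4 (Y s) (Y' s) (Y' r) (Y r)
    have h6 := dist_triangle_right (Y' s) (Y' r) l
    rw [dist_comm (Y s) (Y' s)] at h5
    simp only [mem_ofPred_eq] at hs hr
    linarith

/-- Uniform limits of solutions with bounded `p`-variation are solutions. -/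
theorem SolvesYoung.of_approx [CompleteSpace E] (hf : IsYoungField f π A B α M) (hp : 1 ≤ p)
    (hp2 : p < 2) {a c R : ℝ} (hR : 0 ≤ R) {ω : ℝ → U} {ξ : E} {Y : ℝ → E}
    (hω : SumLE p (fun s t => ‖ω t - ω s‖) (Icc a c) R)
    (hY : SumLE p (fun s t => ‖Y t - Y s‖) (Icc a c) R)
    (h : ∀ ε > 0, ∃ (ω' : ℝ → U) (Y' : ℝ → E), SolvesYoung p a c f ξ ω' Y' ∧
      SumLE p (fun s t => ‖ω' t - ω' s‖) (Icc a c) R ∧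
      SumLE p (fun s t => ‖Y' t - Y' s‖) (Icc a c) R ∧
      ∀ t ∈ Icc a c, ‖ω' t - ω t‖ ≤ ε ∧ ‖Y' t - Y t‖ ≤ ε) :
    SolvesYoung p a c f ξ ω Y := by
  have hp0 : 0 < p := by linarith
  set q := (p + 2) / 2 with hq
  have hpq' : p < q := by rw [hq]; linarith
  have hq2 : q < 2 := by rw [hq]; linarith
  have hq0 : 0 < q := by linarith
  have hpq : 1 < 1 / q + 1 / q := by
    have h2 : 1 / 2 < 1 / q := one_div_lt_one_div_of_lt hq0 hq2
    linarith
  have hσ : 0 < 1 - p / q := by rw [sub_pos, div_lt_one hq0]; exact hpq'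
  refine ⟨IsCadlag.of_uniform_limit fun ε hε => ?_, hY.hasFinVar hp0 hR, fun t ht => ?_⟩
  · obtain ⟨ω', Y', h1, -, -, h2⟩ := h ε hε
    exact ⟨Y', h1.1, fun t ht => (h2 t ht).2⟩
  refine HasYoungIntegral.of_finset ht.1 fun δ hδ => ?_
  obtain ⟨ε₀, hε₀, hmod⟩ := exists_youngModulus_lt (M := M) (C := youngConst q q) (R := R)
    (τ := p / q) hσ (by positivity : 0 < δ / 3)
  obtain ⟨ω', Y', h1, h2, h3, h4⟩ := h (min ε₀ (δ / 3)) (by positivity)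
  obtain ⟨F, hF⟩ := (h1.2.2 t ht).exists_finset (by positivity : 0 < δ / 3)
  refine ⟨F, fun k w hw hwr => ?_⟩
  have e1 := hF k w hw hwr
  have hwI : ∀ l ∈ Icc 0 k, w l ∈ Icc a c := fun l hl =>
    ⟨by rw [← hw.2.1]; exact hw.1 (Nat.zero_le l), (hw.1 hl.2).trans (by rw [hw.2.2]; exact ht.2)⟩
  have vn : ∀ {F : Type _} [NormedAddCommGroup F] (g : ℝ → F),
      SumLE p (fun s t => ‖g t - g s‖) (Icc a c) R →
      varNorm p (fun l => g (w l)) (Icc 0 k) ≤ R := fun g hg =>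
    (hg.comp (hw.1.monotoneOn _) hwI).varNorm_le (f := fun l => g (w l)) hp0 hR
  have vn' : ∀ g : ℝ → U, SumLE p (fun s t => ‖g t - g s‖) (Icc a c) R →
      varNorm p (fun l => g (w l)) (Icc 0 k) ≤ R := fun g hg =>
    (hg.comp (hw.1.monotoneOn _) hwI).varNorm_le (f := fun l => g (w l)) hp0 hR
  have key := norm_youngSum_sub_le hf hp hpq'.le hpq hR hε₀.le
    (vn' ω hω) (vn' ω' h2) (vn Y hY) (vn Y' h3)
    (fun l hl => by
      rw [norm_sub_rev]; exact (h4 _ (hwI l hl)).1.trans (min_le_left _ _))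
    (fun l hl => by
      rw [norm_sub_rev]; exact (h4 _ (hwI l hl)).2.trans (min_le_left _ _))
  have e2 := (h4 t ht).2.trans (min_le_right _ _)
  set S := ∑ i ∈ Finset.range k, f (Y (w i)) (ω (w (i + 1)) - ω (w i))
  set S' := ∑ i ∈ Finset.range k, f (Y' (w i)) (ω' (w (i + 1)) - ω' (w i))
  have e : S - (Y t - ξ) = (S - S') + (S' - (Y' t - ξ)) + (Y' t - Y t) := by abel
  rw [e]
  have := norm_add₃_le (a := S - S') (b := S' - (Y' t - ξ)) (c := Y' t - Y t)
  linarith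

/-- **Existence** for Young differential equations with càdlàg drivers. -/
theorem exists_solvesYoung [CompleteSpace E] (hf : IsYoungField f π A B α M) (hp : 1 ≤ p)
    (hα : 0 < α) (hα1 : α ≤ 1) (hpα : p < 1 + α) {a c : ℝ} (hac : a ≤ c) {ω : ℝ → U}
    (hc : IsCadlag a c ω) (hω : HasFinVar p ω (Icc a c))
    (hmono : MonotoneOn (fun t => π (ω t)) (Icc a c)) (ξ : E) :
    ∃ Y, SolvesYoung p a c f ξ ω Y := by
  classical
  have hp0 : 0 < p := by linarith
  have hp2 : p < 2 := by linarith
  -- a slightly larger exponent, for which step drivers converge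
  set q := (p + (1 + α)) / 2 with hq
  have hpq : p < q := by rw [hq]; linarith
  have hqα : q < 1 + α := by rw [hq]; linarith
  have hq2 : q < 2 := by linarith
  have hq0 : 0 < q := by linarith
  have hσ : 0 < 1 - p / q := by rw [sub_pos, div_lt_one hq0]; exact hpq
  set R := max (varNorm p ω (Icc a c)) (π (ω c) - π (ω a)) with hR
  have hR0 : 0 ≤ R := varNorm_nonneg.trans (le_max_left _ _)
  obtain ⟨K₁, hK₁, H₁⟩ := SolvesYoung.exists_bound hf hp hp2 hα hα1 hpα R
  obtain ⟨K₂, hK₂, H₂⟩ := young_stability hf (hp.trans hpq.le) hq2 hα hα1 hqα R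
  have approx : ∀ n : ℕ, ∃ (θ : ℝ → ℝ) (Y : ℝ → E), MonotoneOn θ (Icc a c) ∧
      MapsTo θ (Icc a c) (Icc a c) ∧ SolvesYoung p a c f ξ (fun t => ω (θ t)) Y ∧
      ∀ t ∈ Icc a c, ‖ω (θ t) - ω t‖ ≤ 1 / ((n : ℝ) + 1) := by
    intro n
    obtain ⟨F, hF⟩ := hc.exists_finset_gap (η := 1 / ((n : ℝ) + 1)) (by positivity)
    obtain ⟨θ, Y, h⟩ := exists_isStepSolution f a ξ ω (F.filter (a < ·))
      fun x hx => (Finset.mem_filter.1 hx).2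
    have hm : MapsTo θ (Icc a c) (Icc a c) := fun t ht =>
      ⟨h.ge t ht.1, (h.le t ht.1).trans ht.2⟩
    refine ⟨θ, Y, h.mono.mono Icc_subset_Ici_self, hm, h.solvesYoung hac hp, fun t ht => ?_⟩
    rw [norm_sub_rev]
    refine hF (θ t) (hm ht) t ht (h.le t ht.1) fun x hx hh => ?_
    exact absurd (h.last t ht.1 x (Finset.mem_filter.2 ⟨hx, (h.ge t ht.1).trans_lt hh.1⟩) hh.2)
      (not_le.2 hh.1)
  choose θ Y hθ hθm hY hclose using approx
  have ha : a ∈ Icc a c := ⟨le_rfl, hac⟩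
  have hcc : c ∈ Icc a c := ⟨hac, le_rfl⟩
  have hfin : ∀ n, HasFinVar p (fun t => ω (θ n t)) (Icc a c) := fun n =>
    hω.comp hp0 (hθ n) (hθm n)
  have hvn : ∀ n, varNorm p (fun t => ω (θ n t)) (Icc a c) ≤ R := fun n =>
    (hω.varNorm_comp_le hp0 (hθ n) (hθm n)).trans (le_max_left _ _)
  have hmn : ∀ n, MonotoneOn (fun t => π (ω (θ n t))) (Icc a c) := fun n s hs t ht hst =>
    hmono (hθm n hs) (hθm n ht) (hθ n hs ht hst)
  have hπn : ∀ n, π (ω (θ n c)) - π (ω (θ n a)) ≤ R := fun n => by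
    have h1 := hmono (hθm n hcc) hcc (hθm n hcc).2
    have h2 := hmono ha (hθm n ha) (hθm n ha).1
    have := le_max_right (varNorm p ω (Icc a c)) (π (ω c) - π (ω a))
    simp only at h1 h2
    linarith
  have hbound : ∀ n, SumLE p (fun s t => ‖Y n t - Y n s‖) (Icc a c) K₁ := fun n =>
    H₁ a c _ ξ (Y n) hac (hfin n) (hvn n) (hmn n) (hπn n) (hY n)
  have hexp : ∀ n, SolvesYoung q a c f ξ (fun t => ω (θ n t)) (Y n) := fun n =>
    ⟨(hY n).1, (hY n).2.1.exponent_mono hp0 hpq.le, (hY n).2.2⟩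
  set G : ℕ → ℝ := fun n => K₂ * ((2 * (2 * (1 / ((n : ℝ) + 1)))) ^ (1 - p / q) *
    (R + R) ^ (p / q)) with hG
  have hdist : ∀ n m, n ≤ m → ∀ t ∈ Icc a c, ‖Y n t - Y m t‖ ≤ G n := by
    intro n m hnm t ht
    have hnm' : 1 / ((m : ℝ) + 1) ≤ 1 / ((n : ℝ) + 1) :=
      one_div_le_one_div_of_le (by positivity) (by
        have : (n : ℝ) ≤ m := Nat.cast_le.2 hnm
        linarith)
    have h1 := H₂ a c _ _ ξ ξ (Y n) (Y m) hac ((hfin n).exponent_mono hp0 hpq.le)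
      ((hfin m).exponent_mono hp0 hpq.le)
      (((hfin n).varNorm_exponent_mono hp0 hpq.le).trans (hvn n))
      (((hfin m).varNorm_exponent_mono hp0 hpq.le).trans (hvn m)) (hmn n) (hπn n) (hexp n) (hexp m)
    have h2 := (sumLE_sub_of_norm_le (g := fun t => ω (θ n t)) (g' := fun t => ω (θ m t)) hp hpq.le
      hR0 hR0 (by positivity : 0 ≤ 2 * (1 / ((n : ℝ) + 1)))
      (((hfin n).sumLE hp0).mono_right hp0.le varNorm_nonneg (hvn n))
      (((hfin m).sumLE hp0).mono_right hp0.le varNorm_nonneg (hvn m))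
      (fun t ht => by
        have h3 := hclose n t ht
        have h4 := hclose m t ht
        have h5 := norm_sub_le_norm_sub_add_norm_sub (ω (θ n t)) (ω t) (ω (θ m t))
        rw [norm_sub_rev (ω t)] at h5
        linarith)).varNorm_le (f := fun t => ω (θ n t) - ω (θ m t)) hq0 (by positivity)
    have h3 := (h1.hasFinVar (f := fun t => Y n t - Y m t) hq0 (by
      exact mul_nonneg hK₂ (add_nonneg (norm_nonneg _) varNorm_nonneg))).norm_sub_le hq0 ha ht
    have h4 := h1.varNorm_le (f := fun t => Y n t - Y m t) hq0
      (mul_nonneg hK₂ (add_nonneg (norm_nonneg _) varNorm_nonneg))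
    rw [(hY n).initial hac, (hY m).initial hac] at h3
    simp only [sub_self, norm_zero, zero_add, sub_zero] at h3 h4
    exact h3.trans (h4.trans (mul_le_mul_of_nonneg_left h2 hK₂))
  have hG0 : Tendsto G atTop (𝓝 0) := by
    have h1 : Tendsto (fun n : ℕ => 2 * (2 * (1 / ((n : ℝ) + 1)))) atTop (𝓝 (2 * (2 * 0))) :=
      (tendsto_one_div_add_atTop_nhds_zero_nat.const_mul 2).const_mul 2
    have h2 := ((h1.rpow_const (p := 1 - p / q) (Or.inr hσ.le)).mul_const
      ((R + R) ^ (p / q))).const_mul K₂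
    simp only [mul_zero, Real.zero_rpow hσ.ne', zero_mul] at h2
    exact h2
  have hcau : ∀ t ∈ Icc a c, ∃ y, Tendsto (fun n => Y n t) atTop (𝓝 y) := fun t ht =>
    cauchySeq_tendsto_of_complete (cauchySeq_of_le_tendsto_0' G (fun n m hnm => by
      rw [dist_eq_norm]; exact hdist n m hnm t ht) hG0)
  choose! Z hZ using hcau
  have hZdist : ∀ n, ∀ t ∈ Icc a c, ‖Y n t - Z t‖ ≤ G n := fun n t ht =>
    le_of_tendsto (tendsto_const_nhds.sub (hZ t ht)).norm
      (eventually_atTop.2 ⟨n, fun m hm => hdist n m hm t ht⟩)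
  have hR' : R ≤ max R K₁ := le_max_left _ _
  refine ⟨Z, SolvesYoung.of_approx hf hp hp2 (hR0.trans hR')
    ((hω.sumLE hp0).mono_right hp0.le varNorm_nonneg ((le_max_left _ _).trans hR'))
    (sumLE_of_tendsto hp0 hZ (Eventually.of_forall fun n => (hbound n).mono_right hp0.le hK₁
      (le_max_right _ _))) fun ε hε => ?_⟩
  obtain ⟨n, hn1, hn2⟩ := ((hG0.eventually (gt_mem_nhds hε)).and
    (tendsto_one_div_add_atTop_nhds_zero_nat.eventually (gt_mem_nhds hε))).exists
  exact ⟨fun t => ω (θ n t), Y n, hY n, ((hfin n).sumLE hp0).mono_right hp0.le varNorm_nonneg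
    ((hvn n).trans hR'), (hbound n).mono_right hp0.le hK₁ (le_max_right _ _),
    fun t ht => ⟨(hclose n t ht).trans hn2.le, (hZdist n t ht).trans hn1.le⟩⟩

theorem SolvesYoung.eqOn (hf : IsYoungField f π A B α M) (hp : 1 ≤ p) (hp2 : p < 2)
    (hα : 0 < α) (hα1 : α ≤ 1) (hpα : p < 1 + α) {a c : ℝ} (hac : a ≤ c) {ω : ℝ → U}
    (hω : HasFinVar p ω (Icc a c)) (hmono : MonotoneOn (fun t => π (ω t)) (Icc a c))
    {ξ : E} {Y Y' : ℝ → E} (h : SolvesYoung p a c f ξ ω Y) (h' : SolvesYoung p a c f ξ ω Y') :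
    EqOn Y Y' (Icc a c) := by
  have hp0 : 0 < p := by linarith
  obtain ⟨K, hK, H⟩ := young_stability hf hp hp2 hα hα1 hpα
    (max (varNorm p ω (Icc a c)) (π (ω c) - π (ω a)))
  have h0 : SumLE p (fun s t => ‖(ω t - ω t) - (ω s - ω s)‖) (Icc a c) 0 := fun n u _ _ => by
    simp [Real.zero_rpow hp0.ne']
  have h1 := H a c ω ω ξ ξ Y Y' hac hω hω (le_max_left _ _) (le_max_left _ _) hmono
    (le_max_right _ _) h h'
  have h2 : varNorm p (fun t => ω t - ω t) (Icc a c) = 0 :=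
    le_antisymm (h0.varNorm_le (f := fun t => ω t - ω t) hp0 le_rfl) varNorm_nonneg
  rw [h2, sub_self, norm_zero, add_zero, mul_zero] at h1
  intro t ht
  have h3 := ((h1.hasFinVar (f := fun t => Y t - Y' t) hp0 le_rfl).norm_sub_le hp0
    (⟨le_rfl, hac⟩ : a ∈ Icc a c) ht).trans
    (h1.varNorm_le (f := fun t => Y t - Y' t) hp0 le_rfl)
  rw [h.initial hac, h'.initial hac, sub_self, sub_zero] at h3
  exact sub_eq_zero.1 (norm_le_zero_iff.1 h3)

end Existence

/-! ### Invariance under monotone surjections -/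

/-- A nondecreasing surjection of `[a, c]` onto `[a, c']`. -/
structure IsTimeChange (a c c' : ℝ) (θ : ℝ → ℝ) : Prop where
  mono : MonotoneOn θ (Icc a c)
  mapsTo : MapsTo θ (Icc a c) (Icc a c')
  surjOn : SurjOn θ (Icc a c) (Icc a c')

namespace IsTimeChange

variable {a c c' : ℝ} {θ : ℝ → ℝ}

theorem map_left (h : IsTimeChange a c c' θ) (hac : a ≤ c) : θ a = a := by
  have ha : a ∈ Icc a c := ⟨le_rfl, hac⟩
  obtain ⟨s, hs, hsa⟩ := h.surjOn ⟨le_rfl, (h.mapsTo ha).1.trans (h.mapsTo ha).2⟩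
  exact le_antisymm ((h.mono ha hs hs.1).trans hsa.le) (h.mapsTo ha).1

theorem tendsto_right (h : IsTimeChange a c c' θ) {t : ℝ} (ht : t ∈ Ico a c) :
    Tendsto θ (𝓝[>] t) (𝓝 (θ t)) := by
  have htI : t ∈ Icc a c := ⟨ht.1, ht.2.le⟩
  refine tendsto_order.2 ⟨fun v hv => ?_, fun v hv => ?_⟩
  · filter_upwards [Ioo_mem_nhdsGT ht.2] with s hs
    exact hv.trans_le (h.mono htI ⟨ht.1.trans hs.1.le, hs.2.le⟩ hs.1.le)
  · rcases (h.mapsTo htI).2.eq_or_lt with h1 | h1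
    · filter_upwards [Ioo_mem_nhdsGT ht.2] with s hs
      have := (h.mapsTo (⟨ht.1.trans hs.1.le, hs.2.le⟩ : s ∈ Icc a c)).2
      exact (this.trans h1.ge).trans_lt hv
    · obtain ⟨z, hz1, hz2⟩ := exists_between (lt_min hv h1)
      obtain ⟨r, hr, rfl⟩ := h.surjOn (⟨(h.mapsTo htI).1.trans hz1.le,
        hz2.le.trans (min_le_right _ _)⟩ : z ∈ Icc a c')
      have htr : t < r := by
        by_contra hc
        exact absurd (h.mono hr htI (not_lt.1 hc)) (not_le.2 hz1)
      filter_upwards [Ioo_mem_nhdsGT htr] with s hs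
      exact (h.mono ⟨ht.1.trans hs.1.le, hs.2.le.trans hr.2⟩ hr hs.2.le).trans_lt
        (hz2.trans_le (min_le_left _ _))

theorem tendsto_left (h : IsTimeChange a c c' θ) {t : ℝ} (ht : t ∈ Ioc a c) :
    Tendsto θ (𝓝[<] t) (𝓝 (θ t)) := by
  have htI : t ∈ Icc a c := ⟨ht.1.le, ht.2⟩
  refine tendsto_order.2 ⟨fun v hv => ?_, fun v hv => ?_⟩
  · rcases (h.mapsTo htI).1.eq_or_lt with h1 | h1
    · filter_upwards [Ioo_mem_nhdsLT ht.1] with s hs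
      have := (h.mapsTo (⟨hs.1.le, hs.2.le.trans ht.2⟩ : s ∈ Icc a c)).1
      exact hv.trans_le (h1.ge.trans this)
    · obtain ⟨z, hz1, hz2⟩ := exists_between (max_lt hv h1)
      obtain ⟨r, hr, rfl⟩ := h.surjOn (⟨(le_max_right _ _).trans hz1.le,
        hz2.le.trans (h.mapsTo htI).2⟩ : z ∈ Icc a c')
      have htr : r < t := by
        by_contra hc
        exact absurd (h.mono htI hr (not_lt.1 hc)) (not_le.2 hz2)
      filter_upwards [Ioo_mem_nhdsLT htr] with s hs
      exact ((le_max_left _ _).trans_lt hz1).trans_le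
        (h.mono hr ⟨hr.1.trans hs.1.le, hs.2.le.trans ht.2⟩ hs.1.le)
  · filter_upwards [Ioo_mem_nhdsLT ht.1] with s hs
    exact (h.mono ⟨hs.1.le, hs.2.le.trans ht.2⟩ htI hs.2.le).trans_lt hv

theorem isCadlag_comp {E : Type*} [TopologicalSpace E] (h : IsTimeChange a c c' θ) {Y : ℝ → E}
    (hY : IsCadlag a c' Y) : IsCadlag a c (fun t => Y (θ t)) := by
  constructor
  · intro t ht
    have htI : t ∈ Icc a c := ⟨ht.1, ht.2.le⟩
    have hmem : ∀ᶠ s in 𝓝[>] t, s ∈ Icc a c ∧ θ t ≤ θ s := by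
      filter_upwards [Ioo_mem_nhdsGT ht.2] with s hs
      have : s ∈ Icc a c := ⟨ht.1.trans hs.1.le, hs.2.le⟩
      exact ⟨this, h.mono htI this hs.1.le⟩
    rcases (h.mapsTo htI).2.eq_or_lt with h1 | h1
    · refine tendsto_const_nhds.congr' ?_
      filter_upwards [hmem] with s hs
      rw [le_antisymm hs.2 ((h.mapsTo hs.1).2.trans h1.ge)]
    · have h2 : Tendsto Y (𝓝[≥] (θ t)) (𝓝 (Y (θ t))) := by
        have h3 := hY.1 (θ t) ⟨(h.mapsTo htI).1, h1⟩
        rw [← Ioi_insert, nhdsWithin_insert]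
        exact tendsto_sup.2 ⟨tendsto_pure_nhds _ _, h3⟩
      exact h2.comp (tendsto_nhdsWithin_iff.2 ⟨h.tendsto_right ht, hmem.mono fun s hs => hs.2⟩)
  · intro t ht
    have htI : t ∈ Icc a c := ⟨ht.1.le, ht.2⟩
    by_cases hex : ∃ r, a ≤ r ∧ r < t ∧ θ r = θ t
    · obtain ⟨r, har, hrt, hr⟩ := hex
      refine ⟨Y (θ t), tendsto_const_nhds.congr' ?_⟩
      filter_upwards [Ioo_mem_nhdsLT hrt] with s hs
      have hs' : s ∈ Icc a c := ⟨har.trans hs.1.le, hs.2.le.trans ht.2⟩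
      rw [le_antisymm (h.mono hs' htI hs.2.le)
        (hr ▸ h.mono ⟨har, hrt.le.trans ht.2⟩ hs' hs.1.le)]
    · push Not at hex
      have hlt : ∀ s, a ≤ s → s < t → θ s < θ t := fun s hs hst =>
        lt_of_le_of_ne (h.mono ⟨hs, hst.le.trans ht.2⟩ htI hst.le) (hex s hs hst)
      have ha : a < θ t := by
        have := hlt a le_rfl ht.1
        rwa [h.map_left (ht.1.le.trans ht.2)] at this
      obtain ⟨l, hl⟩ := hY.2 (θ t) ⟨ha, (h.mapsTo htI).2⟩
      refine ⟨l, hl.comp (tendsto_nhdsWithin_iff.2 ⟨h.tendsto_left ht, ?_⟩)⟩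
      filter_upwards [Ioo_mem_nhdsLT ht.1] with s hs
      exact hlt s hs.1.le hs.2

theorem hasYoungIntegral_comp {U E : Type*} [NormedAddCommGroup U] [NormedSpace ℝ U]
    [NormedAddCommGroup E] [NormedSpace ℝ E] (h : IsTimeChange a c c' θ) {g : ℝ → U →L[ℝ] E}
    {ω : ℝ → U} {t : ℝ} (ht : t ∈ Icc a c) {I : E} (hI : HasYoungIntegral g ω a (θ t) I) :
    HasYoungIntegral (fun r => g (θ r)) (fun r => ω (θ r)) a t I := by
  classical
  have ha := h.map_left (ht.1.trans ht.2)
  refine HasYoungIntegral.of_finset ht.1 fun ε hε => ?_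
  obtain ⟨F, hF⟩ := hI.exists_finset hε
  have hinv : ∀ x ∈ Icc a (θ t), ∃ r ∈ Icc a t, θ r = x := by
    intro x hx
    obtain ⟨r, hr, rfl⟩ := h.surjOn (⟨hx.1, hx.2.trans (h.mapsTo ht).2⟩ : x ∈ Icc a c')
    rcases le_total r t with hrt | hrt
    · exact ⟨r, ⟨hr.1, hrt⟩, rfl⟩
    · exact ⟨t, ⟨ht.1, le_rfl⟩, le_antisymm (h.mono ht hr hrt) hx.2⟩
  choose! z hz hzx using hinv
  refine ⟨F.image z, fun k w hw hwr => ?_⟩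
  have hwI : ∀ i, w (min i k) ∈ Icc a c := fun i =>
    ⟨by rw [← hw.2.1]; exact hw.1 (Nat.zero_le _), (hw.1 (min_le_right i k)).trans (by
      rw [hw.2.2]; exact ht.2)⟩
  have hp : IsPartition a (θ t) k (fun i => θ (w (min i k))) :=
    ⟨fun i j hij => h.mono (hwI i) (hwI j) (hw.1 (min_le_min_right k hij)),
      by simp [hw.2.1, ha], by simp [hw.2.2]⟩
  have := hF k _ hp fun x hx hxI => by
    obtain ⟨j, hj, hjx⟩ := hwr (z x) (Finset.mem_image_of_mem z hx) (hz x hxI)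
    exact ⟨j, hj, by simp only [min_eq_left hj, hjx, hzx x hxI]⟩
  refine lt_of_le_of_lt (le_of_eq ?_) this
  congr 2
  refine Finset.sum_congr rfl fun i hi => ?_
  have hi' := Finset.mem_range.1 hi
  simp only [min_eq_left hi'.le, min_eq_left (show i + 1 ≤ k by omega)]

theorem solvesYoung_comp {U E : Type*} [NormedAddCommGroup U] [NormedSpace ℝ U]
    [NormedAddCommGroup E] [NormedSpace ℝ E] (h : IsTimeChange a c c' θ) {p : ℝ} (hp : 0 < p)
    {f : E → U →L[ℝ] E} {ξ : E} {ω : ℝ → U} {Y : ℝ → E} (hY : SolvesYoung p a c' f ξ ω Y) :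
    SolvesYoung p a c f ξ (fun t => ω (θ t)) (fun t => Y (θ t)) :=
  ⟨h.isCadlag_comp hY.1, hY.2.1.comp hp h.mono h.mapsTo,
    fun t ht => h.hasYoungIntegral_comp ht (hY.2.2 (θ t) (h.mapsTo ht))⟩

end IsTimeChange

/-- The values of a solution do not depend on those of the driver outside `[a, c]`. -/
theorem SolvesYoung.congr {U E : Type*} [NormedAddCommGroup U] [NormedSpace ℝ U]
    [NormedAddCommGroup E] [NormedSpace ℝ E] {p a c : ℝ} {f : E → U →L[ℝ] E} {ξ : E}
    {ω ω' : ℝ → U} {Y : ℝ → E} (h : SolvesYoung p a c f ξ ω Y) (hω : EqOn ω' ω (Icc a c)) :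
    SolvesYoung p a c f ξ ω' Y := by
  refine ⟨h.1, h.2.1, fun t ht => HasYoungIntegral.of_finset ht.1 fun ε hε => ?_⟩
  obtain ⟨F, hF⟩ := (h.2.2 t ht).exists_finset hε
  refine ⟨F, fun k w hw hwr => ?_⟩
  have hwI : ∀ i ≤ k, w i ∈ Icc a c := fun i hi =>
    ⟨by rw [← hw.2.1]; exact hw.1 (Nat.zero_le _), (hw.1 hi).trans (by
      rw [hw.2.2]; exact ht.2)⟩
  refine lt_of_le_of_lt (le_of_eq ?_) (hF k w hw hwr)
  congr 2
  refine Finset.sum_congr rfl fun i hi => ?_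
  have hi' := Finset.mem_range.1 hi
  rw [hω (hwI i hi'.le), hω (hwI (i + 1) hi')]

/-! ### Inserting time intervals -/

namespace Marks

variable {a b : ℝ} (e : Marks a b) {δ : ℝ}

theorem rawWeight_nonneg (j : ℕ) : 0 ≤ e.rawWeight j := by
  unfold rawWeight; split_ifs <;> positivity

theorem summable_rawWeight : Summable e.rawWeight := by
  refine Summable.of_nonneg_of_le e.rawWeight_nonneg (fun j => ?_)
    ((summable_nat_add_iff 1).2 (summable_geometric_of_lt_one (by norm_num : (0 : ℝ) ≤ 1 / 2)
      (by norm_num)))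
  unfold rawWeight
  split_ifs
  · exact le_rfl
  · positivity

theorem tsum_rawWeight_pos : 0 < ∑' j, e.rawWeight j := by
  obtain ⟨j, hj, -⟩ := e.right_mem
  refine e.summable_rawWeight.tsum_pos e.rawWeight_nonneg j ?_
  have hj' : (j : ℕ∞) < e.card := hj
  simp only [rawWeight, hj', if_true]
  positivity

theorem weight_nonneg (j : ℕ) : 0 ≤ e.weight j :=
  div_nonneg (e.rawWeight_nonneg j) e.tsum_rawWeight_pos.le

theorem weight_pos {j : ℕ} (hj : (j : ℕ∞) < e.card) : 0 < e.weight j := by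
  refine div_pos ?_ e.tsum_rawWeight_pos
  simp only [rawWeight, hj, if_true]
  positivity

theorem weight_eq_zero {j : ℕ} (hj : ¬ (j : ℕ∞) < e.card) : e.weight j = 0 := by
  simp [weight, rawWeight, hj]

theorem summable_weight : Summable e.weight := e.summable_rawWeight.div_const _

theorem tsum_weight : ∑' j, e.weight j = 1 := by
  unfold weight
  rw [tsum_div_const, div_self e.tsum_rawWeight_pos.ne']

open Classical in
theorem summable_ite (hδ : 0 ≤ δ) (P : ℕ → Prop) :
    Summable fun j => if P j then δ * e.weight j else 0 := by
  refine Summable.of_nonneg_of_le (fun j => ?_) (fun j => ?_) (e.summable_weight.mul_left δ)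
  · split_ifs
    · exact mul_nonneg hδ (e.weight_nonneg j)
    · exact le_rfl
  · split_ifs
    · exact le_rfl
    · exact mul_nonneg hδ (e.weight_nonneg j)

open Classical in
theorem tsum_ite_le (hδ : 0 ≤ δ) {P Q : ℕ → Prop} (h : ∀ j, P j → Q j) :
    (∑' j, if P j then δ * e.weight j else 0) ≤ ∑' j, if Q j then δ * e.weight j else 0 := by
  refine (e.summable_ite hδ P).tsum_le_tsum (fun j => ?_) (e.summable_ite hδ Q)
  by_cases h1 : P j
  · simp [h1, h j h1]
  · simp only [h1, if_false]
    split_ifs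
    · exact mul_nonneg hδ (e.weight_nonneg j)
    · exact le_rfl

theorem tau_add_le (hδ : 0 ≤ δ) {s t : ℝ} (hst : s < t) :
    e.tau δ s + (t - s) ≤ e.tauLeft δ t := by
  have := e.tsum_ite_le hδ (P := fun j => e.pts j ≤ s) (Q := fun j => e.pts j < t)
    fun j hj => hj.trans_lt hst
  unfold tau tauLeft
  linarith

theorem tau_lt_tauLeft (hδ : 0 ≤ δ) {s t : ℝ} (hst : s < t) : e.tau δ s < e.tauLeft δ t := by
  have := e.tau_add_le hδ hst
  linarith

theorem tauLeft_le_tau (hδ : 0 ≤ δ) (t : ℝ) : e.tauLeft δ t ≤ e.tau δ t := by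
  have := e.tsum_ite_le hδ (P := fun j => e.pts j < t) (Q := fun j => e.pts j ≤ t)
    fun j hj => le_of_lt hj
  unfold tau tauLeft
  linarith

theorem tauLeft_lt_tau (hδ : 0 < δ) {t : ℝ} (ht : t ∈ e.support) :
    e.tauLeft δ t < e.tau δ t := by
  obtain ⟨j, hj, rfl⟩ := ht
  have hw := e.weight_pos hj
  unfold tau tauLeft
  refine add_lt_add_right ((e.summable_ite hδ.le _).tsum_lt_tsum (i := j) (fun i => ?_) ?_
    (e.summable_ite hδ.le _)) _
  · by_cases h : e.pts i < e.pts j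
    · simp [h, h.le]
    · simp only [h, if_false]
      split_ifs
      · exact mul_nonneg hδ.le (e.weight_nonneg i)
      · exact le_rfl
  · simp only [lt_irrefl, if_false, le_refl, if_true]
    positivity

theorem tauLeft_eq_tau {t : ℝ} (ht : t ∉ e.support) : e.tauLeft δ t = e.tau δ t := by
  unfold tau tauLeft
  congr 1
  refine tsum_congr fun j => ?_
  by_cases hj : (j : ℕ∞) < e.card
  · have : e.pts j ≠ t := fun h => ht ⟨j, hj, h⟩
    by_cases h : e.pts j < t
    · simp [h, h.le]
    · have h' : ¬ e.pts j ≤ t := fun h' => h (lt_of_le_of_ne h' this)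
      simp [h, h']
  · simp [e.weight_eq_zero hj]

theorem tauLeft_left : e.tauLeft δ a = a := by
  unfold tauLeft
  have : (fun j => if e.pts j < a then δ * e.weight j else 0) = fun _ => 0 := by
    funext j
    by_cases hj : (j : ℕ∞) < e.card
    · simp [not_lt.2 (e.mem_Icc j hj).1]
    · simp [e.weight_eq_zero hj]
  rw [this, tsum_zero, add_zero]

theorem tau_right : e.tau δ b = b + δ := by
  unfold tau
  have : (fun j => if e.pts j ≤ b then δ * e.weight j else 0) = fun j => δ * e.weight j := by
    funext j
    by_cases hj : (j : ℕ∞) < e.card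
    · simp [(e.mem_Icc j hj).2]
    · simp [e.weight_eq_zero hj]
  rw [this, tsum_mul_left, e.tsum_weight, mul_one]

theorem le_tauLeft (hδ : 0 ≤ δ) (t : ℝ) : t ≤ e.tauLeft δ t := by
  have : 0 ≤ ∑' j, if e.pts j < t then δ * e.weight j else 0 := tsum_nonneg fun j => by
    split_ifs
    · exact mul_nonneg hδ (e.weight_nonneg j)
    · exact le_rfl
  unfold tauLeft
  linarith

theorem tau_le (hδ : 0 ≤ δ) (t : ℝ) : e.tau δ t ≤ t + δ := by
  have h1 := e.tsum_ite_le hδ (P := fun j => e.pts j ≤ t) (Q := fun _ => True)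
    fun j _ => trivial
  simp only [if_true] at h1
  rw [tsum_mul_left, e.tsum_weight, mul_one] at h1
  unfold tau
  linarith

theorem tau_strictMono (hδ : 0 ≤ δ) : StrictMono (e.tau δ) := fun _ t hst =>
  (e.tau_lt_tauLeft hδ hst).trans_le (e.tauLeft_le_tau hδ t)

theorem tendsto_tau_right (hδ : 0 ≤ δ) (t : ℝ) :
    Tendsto (e.tau δ) (𝓝[>] t) (𝓝 (e.tau δ t)) := by
  refine (tendsto_nhdsWithin_of_tendsto_nhds tendsto_id).add
    (tendsto_tsum_of_dominated_convergence (e.summable_weight.mul_left δ) (fun j => ?_)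
      (Eventually.of_forall fun s j => ?_))
  · refine tendsto_const_nhds.congr' ?_
    by_cases h : e.pts j ≤ t
    · filter_upwards [self_mem_nhdsWithin] with s hs
      simp [h, h.trans (le_of_lt hs)]
    · filter_upwards [Ioo_mem_nhdsGT (not_le.1 h)] with s hs
      simp [h, not_le.2 hs.2]
  · have := mul_nonneg hδ (e.weight_nonneg j)
    split_ifs
    · rw [Real.norm_of_nonneg this]
    · rw [norm_zero]; exact this

theorem tendsto_tau_left (hδ : 0 ≤ δ) (t : ℝ) :
    Tendsto (e.tau δ) (𝓝[<] t) (𝓝 (e.tauLeft δ t)) := by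
  refine (tendsto_nhdsWithin_of_tendsto_nhds tendsto_id).add
    (tendsto_tsum_of_dominated_convergence (e.summable_weight.mul_left δ) (fun j => ?_)
      (Eventually.of_forall fun s j => ?_))
  · refine tendsto_const_nhds.congr' ?_
    by_cases h : e.pts j < t
    · filter_upwards [Ioo_mem_nhdsLT h] with s hs
      simp [h, hs.1.le]
    · filter_upwards [self_mem_nhdsWithin] with s hs
      simp [h, (lt_of_lt_of_le hs (not_lt.1 h) : s < e.pts j)]
  · have := mul_nonneg hδ (e.weight_nonneg j)
    split_ifs
    · rw [Real.norm_of_nonneg this]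
    · rw [norm_zero]; exact this

/-- The point of `[a, b + δ]` that corresponds to the time `s ∈ [0, 1]` of the excursion at the
time `t`. -/
def pos (e : Marks a b) (δ t s : ℝ) : ℝ := e.tauLeft δ t + s * (e.tau δ t - e.tauLeft δ t)

theorem pos_zero (t : ℝ) : e.pos δ t 0 = e.tauLeft δ t := by simp [pos]

theorem pos_one (t : ℝ) : e.pos δ t 1 = e.tau δ t := by simp [pos]

theorem collapse_eq {E : Type*} (Y : ℝ → E) (t s : ℝ) : e.collapse δ Y t s = Y (e.pos δ t s) := rfl

theorem pos_of_notMem {t : ℝ} (ht : t ∉ e.support) (s : ℝ) : e.pos δ t s = e.tau δ t := by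
  simp [pos, e.tauLeft_eq_tau ht]

theorem pos_mono (hδ : 0 ≤ δ) (t : ℝ) : Monotone (e.pos δ t) := fun _ _ h =>
  add_le_add_right (mul_le_mul_of_nonneg_right h (sub_nonneg.2 (e.tauLeft_le_tau hδ t))) _

theorem tauLeft_le_pos (hδ : 0 ≤ δ) (t : ℝ) {s : ℝ} (hs : s ∈ Icc (0 : ℝ) 1) :
    e.tauLeft δ t ≤ e.pos δ t s := by
  rw [← e.pos_zero]; exact e.pos_mono hδ t hs.1

theorem pos_le_tau (hδ : 0 ≤ δ) (t : ℝ) {s : ℝ} (hs : s ∈ Icc (0 : ℝ) 1) :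
    e.pos δ t s ≤ e.tau δ t := by
  rw [← e.pos_one]; exact e.pos_mono hδ t hs.2

theorem pos_lt_pos (hδ : 0 ≤ δ) {t t' s s' : ℝ} (htt : t < t') (hs : s ∈ Icc (0 : ℝ) 1)
    (hs' : s' ∈ Icc (0 : ℝ) 1) : e.pos δ t s < e.pos δ t' s' :=
  ((e.pos_le_tau hδ t hs).trans_lt (e.tau_lt_tauLeft hδ htt)).trans_le (e.tauLeft_le_pos hδ t' hs')

theorem pos_mem (hδ : 0 ≤ δ) {t s : ℝ} (ht : t ∈ Icc a b) (hs : s ∈ Icc (0 : ℝ) 1) :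
    e.pos δ t s ∈ Icc a (b + δ) := by
  refine ⟨(ht.1.trans (e.le_tauLeft hδ t)).trans (e.tauLeft_le_pos hδ t hs),
    (e.pos_le_tau hδ t hs).trans ?_⟩
  rw [← e.tau_right]
  exact (e.tau_strictMono hδ).monotone ht.2

theorem tauInv_mem (hδ : 0 ≤ δ) (hab : a ≤ b) {u : ℝ} (hu : u ∈ Icc a (b + δ)) :
    e.tauInv δ u ∈ Icc a b ∧
      u ∈ Icc (e.tauLeft δ (e.tauInv δ u)) (e.tau δ (e.tauInv δ u)) := by
  set S := {s ∈ Icc a b | u ≤ e.tau δ s} with hS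
  have hbS : b ∈ S := ⟨⟨hab, le_rfl⟩, by rw [e.tau_right]; exact hu.2⟩
  have hbdd : BddBelow S := ⟨a, fun s hs => hs.1.1⟩
  have hle : ∀ s ∈ S, e.tauInv δ u ≤ s := fun s hs => csInf_le hbdd hs
  have hmem : e.tauInv δ u ∈ Icc a b := ⟨le_csInf ⟨b, hbS⟩ fun s hs => hs.1.1, hle b hbS⟩
  set t := e.tauInv δ u with ht
  refine ⟨hmem, ?_, ?_⟩
  · rcases hmem.1.eq_or_lt with h | h
    · rw [← h, e.tauLeft_left]; exact hu.1
    · refine le_of_tendsto (e.tendsto_tau_left hδ t) ?_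
      filter_upwards [Ioo_mem_nhdsLT h] with s hs
      by_contra hc
      exact absurd (hle s ⟨⟨hs.1.le, hs.2.le.trans hmem.2⟩, (not_le.1 hc).le⟩) (not_le.2 hs.2)
  · refine ge_of_tendsto (e.tendsto_tau_right hδ t) ?_
    filter_upwards [self_mem_nhdsWithin] with s hs
    obtain ⟨r, hr, hrs⟩ := exists_lt_of_csInf_lt ⟨b, hbS⟩ (show sInf S < s from hs)
    exact hr.2.trans ((e.tau_strictMono hδ).monotone hrs.le)

theorem tauInv_eq (hδ : 0 ≤ δ) {t u : ℝ} (ht : t ∈ Icc a b)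
    (hu : u ∈ Icc (e.tauLeft δ t) (e.tau δ t)) : e.tauInv δ u = t := by
  refine IsLeast.csInf_eq ⟨⟨ht, hu.2⟩, fun s hs => ?_⟩
  by_contra hc
  exact absurd (hs.2.trans_lt (e.tau_lt_tauLeft hδ (not_le.1 hc))) (not_lt.2 hu.1)

theorem tauInv_pos (hδ : 0 ≤ δ) {t s : ℝ} (ht : t ∈ Icc a b) (hs : s ∈ Icc (0 : ℝ) 1) :
    e.tauInv δ (e.pos δ t s) = t :=
  e.tauInv_eq hδ ht ⟨e.tauLeft_le_pos hδ t hs, e.pos_le_tau hδ t hs⟩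

theorem exists_pos_eq (hδ : 0 ≤ δ) (hab : a ≤ b) {u : ℝ} (hu : u ∈ Icc a (b + δ)) :
    ∃ t ∈ Icc a b, ∃ s ∈ Icc (0 : ℝ) 1, e.pos δ t s = u := by
  obtain ⟨h1, h2⟩ := e.tauInv_mem hδ hab hu
  refine ⟨_, h1, ?_⟩
  set t := e.tauInv δ u
  rcases (e.tauLeft_le_tau hδ t).eq_or_lt with h | h
  · exact ⟨1, ⟨zero_le_one, le_rfl⟩, by rw [e.pos_one]; exact le_antisymm (h ▸ h2.1) h2.2⟩
  · have h' := sub_pos.2 h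
    refine ⟨(u - e.tauLeft δ t) / (e.tau δ t - e.tauLeft δ t),
      ⟨div_nonneg (sub_nonneg.2 h2.1) h'.le, (div_le_one h').2 (by linarith [h2.2])⟩, ?_⟩
    rw [pos, div_mul_cancel₀ _ h'.ne']
    ring

/-- A function on `[a, b] × [0, 1]` is stationary off the marked times. -/
def Stationary {E : Type*} (e : Marks a b) (φ : ℝ → ℝ → E) : Prop :=
  ∀ t ∈ Icc a b, t ∉ e.support → ∀ s ∈ Icc (0 : ℝ) 1, φ t s = φ t 0

theorem ext_pos {E : Type*} (hδ : 0 < δ) {φ : ℝ → ℝ → E} (hφ : e.Stationary φ) {t s : ℝ}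
    (ht : t ∈ Icc a b) (hs : s ∈ Icc (0 : ℝ) 1) : e.ext δ φ (e.pos δ t s) = φ t s := by
  unfold ext
  rw [e.tauInv_pos hδ.le ht hs]
  by_cases hm : t ∈ e.support
  · have h := e.tauLeft_lt_tau hδ hm
    have h' := sub_pos.2 h
    rw [if_pos h, pos, add_sub_cancel_left, mul_div_cancel_right₀ _ h'.ne']
  · rw [if_neg (by rw [e.tauLeft_eq_tau hm]; exact lt_irrefl _),
      hφ t ht hm 1 ⟨zero_le_one, le_rfl⟩, hφ t ht hm s hs]

theorem stationary_id : e.Stationary (fun t _ => t) := fun _ _ _ _ _ => rfl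

theorem stationary_pos (e' : Marks a b) (h : e'.support ⊆ e.support) (δ' : ℝ) :
    e.Stationary (e'.pos δ') := fun t _ ht' s _ => by
  have ht := fun hh => ht' (h hh)
  rw [e'.pos_of_notMem ht, e'.pos_of_notMem ht]

/-- The order of `[a, b + δ]` is the lexicographic order of `[a, b] × [0, 1]`. -/
theorem ext_monotoneOn (hδ : 0 < δ) (hab : a ≤ b) {Φ : ℝ → ℝ → ℝ} (hΦ : e.Stationary Φ)
    (h1 : ∀ t ∈ Icc a b, MonotoneOn (Φ t) (Icc 0 1))
    (h2 : ∀ t ∈ Icc a b, ∀ t' ∈ Icc a b, t < t' → Φ t 1 ≤ Φ t' 0) :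
    MonotoneOn (e.ext δ Φ) (Icc a (b + δ)) := by
  have i0 : (0 : ℝ) ∈ Icc (0 : ℝ) 1 := ⟨le_rfl, zero_le_one⟩
  have i1 : (1 : ℝ) ∈ Icc (0 : ℝ) 1 := ⟨zero_le_one, le_rfl⟩
  intro u hu v hv huv
  obtain ⟨t, ht, s, hs, rfl⟩ := e.exists_pos_eq hδ.le hab hu
  obtain ⟨t', ht', s', hs', rfl⟩ := e.exists_pos_eq hδ.le hab hv
  rw [e.ext_pos hδ hΦ ht hs, e.ext_pos hδ hΦ ht' hs']
  rcases lt_trichotomy t t' with h | rfl | h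
  · exact ((h1 t ht hs i1 hs.2).trans (h2 t ht t' ht' h)).trans (h1 t' ht' i0 hs' hs'.1)
  · by_cases hm : t ∈ e.support
    · have h' := sub_pos.2 (e.tauLeft_lt_tau hδ hm)
      have : s ≤ s' := by
        unfold pos at huv
        exact le_of_mul_le_mul_right (by linarith) h'
      exact h1 t ht hs hs' this
    · rw [hΦ t ht hm s hs, hΦ t ht hm s' hs']
  · exact absurd huv (not_le.2 (e.pos_lt_pos hδ.le h hs' hs))

theorem isTimeChange_ext (hδ : 0 < δ) (hab : a ≤ b) {Φ : ℝ → ℝ → ℝ} {c : ℝ}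
    (hΦ : e.Stationary Φ) (h1 : ∀ t ∈ Icc a b, MonotoneOn (Φ t) (Icc 0 1))
    (h2 : ∀ t ∈ Icc a b, ∀ t' ∈ Icc a b, t < t' → Φ t 1 ≤ Φ t' 0)
    (h3 : ∀ t ∈ Icc a b, ∀ s ∈ Icc (0 : ℝ) 1, Φ t s ∈ Icc a c)
    (h4 : ∀ v ∈ Icc a c, ∃ t ∈ Icc a b, ∃ s ∈ Icc (0 : ℝ) 1, Φ t s = v) :
    IsTimeChange a (b + δ) c (e.ext δ Φ) := by
  refine ⟨e.ext_monotoneOn hδ hab hΦ h1 h2, fun u hu => ?_, fun v hv => ?_⟩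
  · obtain ⟨t, ht, s, hs, rfl⟩ := e.exists_pos_eq hδ.le hab hu
    rw [e.ext_pos hδ hΦ ht hs]
    exact h3 t ht s hs
  · obtain ⟨t, ht, s, hs, rfl⟩ := h4 v hv
    exact ⟨e.pos δ t s, e.pos_mem hδ.le ht hs, e.ext_pos hδ hΦ ht hs⟩

/-- Removing marked times and changing `δ` amounts to a time change. -/
theorem isTimeChange_pos (hδ : 0 < δ) (hab : a ≤ b) {δ' : ℝ} (hδ' : 0 < δ') (e' : Marks a b)
    (h : e'.support ⊆ e.support) : IsTimeChange a (b + δ) (b + δ') (e.ext δ (e'.pos δ')) :=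
  e.isTimeChange_ext hδ hab (e.stationary_pos e' h δ')
    (fun t _ => (e'.pos_mono hδ'.le t).monotoneOn _)
    (fun _ _ _ _ htt => (e'.pos_lt_pos hδ'.le htt ⟨zero_le_one, le_rfl⟩ ⟨le_rfl, zero_le_one⟩).le)
    (fun _ ht _ hs => e'.pos_mem hδ'.le ht hs) (fun _ hv => e'.exists_pos_eq hδ'.le hab hv)

/-- Reparametrising the excursions amounts to a time change. -/
theorem isTimeChange_reparam (hδ : 0 < δ) (hab : a ≤ b)
    (ρ : ℝ → Icc (0 : ℝ) 1 ≃o Icc (0 : ℝ) 1) :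
    IsTimeChange a (b + δ) (b + δ)
      (e.ext δ (fun t s => e.pos δ t (ρ t (projIcc 0 1 zero_le_one s)))) := by
  refine e.isTimeChange_ext hδ hab (fun t _ hm s _ => ?_) (fun t _ s _ s' _ hss => ?_)
    (fun t _ t' _ htt => (e.pos_lt_pos hδ.le htt (ρ t _).2 (ρ t' _).2).le)
    (fun t ht s _ => e.pos_mem hδ.le ht (ρ t _).2) (fun v hv => ?_)
  · rw [e.pos_of_notMem hm, e.pos_of_notMem hm]
  · exact e.pos_mono hδ.le t ((ρ t).monotone (monotone_projIcc _ hss))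
  · obtain ⟨t, ht, s, hs, rfl⟩ := e.exists_pos_eq hδ.le hab hv
    exact ⟨t, ht, (ρ t).symm ⟨s, hs⟩, ((ρ t).symm ⟨s, hs⟩).2, by simp⟩

theorem tauInv_monotoneOn (hδ : 0 < δ) (hab : a ≤ b) :
    MonotoneOn (e.tauInv δ) (Icc a (b + δ)) :=
  e.ext_monotoneOn hδ hab (Φ := fun t _ => t) e.stationary_id (fun _ _ _ _ _ _ _ => le_rfl)
    fun _ _ _ _ h => h.le

theorem tauInv_le (hδ : 0 ≤ δ) (hab : a ≤ b) {u : ℝ} (hu : u ∈ Icc a (b + δ)) :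
    e.tauInv δ u ≤ u ∧ u ≤ e.tauInv δ u + δ := by
  obtain ⟨-, h2⟩ := e.tauInv_mem hδ hab hu
  exact ⟨(e.le_tauLeft hδ _).trans h2.1, h2.2.trans (e.tau_le hδ _)⟩

/-- The extension of a stationary path is unchanged by a change of marked times and of `δ`, up to
the corresponding time change. -/
theorem ext_ext_pos {E : Type*} (hδ : 0 < δ) (hab : a ≤ b) {δ' : ℝ} (hδ' : 0 < δ')
    (e' : Marks a b) (h : e'.support ⊆ e.support) {φ : ℝ → ℝ → E} (hφ : e'.Stationary φ) :
    EqOn (e.ext δ φ) (fun u => e'.ext δ' φ (e.ext δ (e'.pos δ') u)) (Icc a (b + δ)) := by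
  intro u hu
  obtain ⟨t, ht, s, hs, rfl⟩ := e.exists_pos_eq hδ.le hab hu
  simp only
  rw [e.ext_pos hδ (e.stationary_pos e' h δ') ht hs, e'.ext_pos hδ' hφ ht hs,
    e.ext_pos hδ (fun t ht hm => hφ t ht fun hh => hm (h hh)) ht hs]

/-- A function on `[a, b + δ]` is the extension of the path obtained by collapsing it. -/
theorem ext_collapse {E : Type*} (hδ : 0 < δ) (hab : a ≤ b) (Y : ℝ → E) :
    EqOn (e.ext δ (e.collapse δ Y)) Y (Icc a (b + δ)) := by
  intro u hu
  obtain ⟨t, ht, s, hs, rfl⟩ := e.exists_pos_eq hδ.le hab hu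
  rw [e.ext_pos hδ (fun t _ hm s _ => by
    rw [e.collapse_eq, e.collapse_eq, e.pos_of_notMem hm, e.pos_of_notMem hm]) ht hs,
    e.collapse_eq]

theorem ext_congr {E : Type*} (hδ : 0 < δ) (hab : a ≤ b) {φ ψ : ℝ → ℝ → E}
    (h : ∀ t ∈ Icc a b, ∀ s ∈ Icc (0 : ℝ) 1, φ t s = ψ t s) :
    EqOn (e.ext δ φ) (e.ext δ ψ) (Icc a (b + δ)) := by
  intro u hu
  obtain ⟨h1, h2⟩ := e.tauInv_mem hδ.le hab hu
  refine h _ h1 _ ?_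
  split_ifs with h3
  · have h' := sub_pos.2 h3
    exact ⟨div_nonneg (sub_nonneg.2 h2.1) h'.le, (div_le_one h').2 (by linarith [h2.2])⟩
  · exact ⟨zero_le_one, le_rfl⟩

end Marks

/-! ### Extensions and collapses of decorated paths -/

section Paths

variable {a b δ : ℝ} {E : Type*} [NormedAddCommGroup E]

theorem IsMarkSet.stationary' {φ : ℝ → ℝ → E} {e : Marks a b} (h : IsMarkSet a b φ e.support) :
    e.Stationary φ := h.stationary

theorem IsMarkSet.mono {φ : ℝ → ℝ → E} {P Q : Set ℝ} (h : IsMarkSet a b φ P) (hPQ : P ⊆ Q)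
    (hQ : Q ⊆ Icc a b) (hc : Q.Countable) : IsMarkSet a b φ Q where
  subset := hQ
  countable := hc
  stationary t ht hm := h.stationary t ht fun hh => hm (hPQ hh)
  finite_osc ε hε := (h.finite_osc ε hε).subset fun t ht => by
    obtain ⟨htQ, s, hs, hlt⟩ := ht
    refine ⟨?_, s, hs, hlt⟩
    by_contra hm
    rw [h.stationary t (hQ htQ) hm s hs, sub_self, norm_zero] at hlt
    exact absurd hlt (not_lt.2 hε.le)

/-- All but finitely many excursions stay close to their end points. -/
theorem IsMarkSet.finite_osc_end {φ : ℝ → ℝ → E} {P : Set ℝ} (h : IsMarkSet a b φ P) {ε : ℝ}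
    (hε : 0 < ε) : {t ∈ Icc a b | ∃ s ∈ Icc (0 : ℝ) 1, ε < ‖φ t s - φ t 1‖}.Finite := by
  refine (h.finite_osc (ε / 2) (by positivity)).subset ?_
  rintro t ⟨ht, s, hs, hlt⟩
  have i1 : (1 : ℝ) ∈ Icc (0 : ℝ) 1 := ⟨zero_le_one, le_rfl⟩
  have hP : t ∈ P := by
    by_contra hm
    rw [h.stationary t ht hm s hs, h.stationary t ht hm 1 i1, sub_self, norm_zero] at hlt
    exact absurd hlt (not_lt.2 hε.le)
  refine ⟨hP, ?_⟩
  by_contra hc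
  push Not at hc
  have h1 := hc s hs
  have h2 := hc 1 i1
  have h3 := norm_sub_le_norm_sub_add_norm_sub (φ t s) (φ t 0) (φ t 1)
  rw [norm_sub_rev (φ t 0)] at h3
  linarith

theorem eventually_notMem_of_finite {S : Set ℝ} (hS : S.Finite) (t : ℝ) :
    ∀ᶠ x in 𝓝[≠] t, x ∉ S := by
  have h1 : (S \ {t})ᶜ ∈ 𝓝 t :=
    (hS.subset sdiff_subset).isClosed.isOpen_compl.mem_nhds (by simp)
  filter_upwards [nhdsWithin_le_nhds h1, self_mem_nhdsWithin] with x hx hxt hxS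
  exact hx ⟨hxS, hxt⟩

namespace Marks

variable (e : Marks a b)

theorem ext_affine {E : Type*} (hδ : 0 < δ) {φ : ℝ → ℝ → E} (hφ : e.Stationary φ) {t : ℝ}
    (ht : t ∈ Icc a b) (hlt : e.tauLeft δ t < e.tau δ t) {u : ℝ}
    (hu : u ∈ Icc (e.tauLeft δ t) (e.tau δ t)) :
    e.ext δ φ u = φ t ((u - e.tauLeft δ t) / (e.tau δ t - e.tauLeft δ t)) := by
  have h' := sub_pos.2 hlt
  have hs : (u - e.tauLeft δ t) / (e.tau δ t - e.tauLeft δ t) ∈ Icc (0 : ℝ) 1 :=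
    ⟨div_nonneg (sub_nonneg.2 hu.1) h'.le, (div_le_one h').2 (by linarith [hu.2])⟩
  rw [← e.ext_pos hδ hφ ht hs, pos, div_mul_cancel₀ _ h'.ne', add_sub_cancel]

/-- `δ`-extensions are càdlàg. -/
theorem isCadlag_ext (hδ : 0 < δ) (hab : a ≤ b) {φ : ℝ → ℝ → E}
    (hfib : ∀ t ∈ Icc a b, IsCadlag 0 1 (φ t)) (hend : IsCadlag a b (fun t => φ t 1))
    (hm : IsMarkSet a b φ e.support) : IsCadlag a (b + δ) (e.ext δ φ) := by
  have i1 : (1 : ℝ) ∈ Icc (0 : ℝ) 1 := ⟨zero_le_one, le_rfl⟩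
  have htend : ∀ t, Continuous fun u => (u - e.tauLeft δ t) / (e.tau δ t - e.tauLeft δ t) :=
    fun t => by fun_prop
  constructor
  · intro u hu
    obtain ⟨t, ht, s, hs, rfl⟩ := e.exists_pos_eq hδ.le hab ⟨hu.1, hu.2.le⟩
    rcases (e.pos_le_tau hδ.le t hs).eq_or_lt with h | h
    · -- the right end of an inserted interval
      have htb : t < b := by
        refine lt_of_le_of_ne ht.2 fun hh => ?_
        rw [h, hh, e.tau_right] at hu
        exact lt_irrefl _ hu.2
      rw [h, ← e.pos_one, e.ext_pos hδ hm.stationary' ht i1, e.pos_one, Metric.tendsto_nhds]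
      intro ε hε
      have hev : ∀ᶠ t' in 𝓝[>] t, dist (φ t' 1) (φ t 1) < ε / 2 ∧
          t' ∉ {t ∈ Icc a b | ∃ s ∈ Icc (0 : ℝ) 1, ε / 2 < ‖φ t s - φ t 1‖} :=
        (Metric.tendsto_nhds.1 (hend.1 t ⟨ht.1, htb⟩) (ε / 2) (by positivity)).and
          ((eventually_notMem_of_finite (hm.finite_osc_end (half_pos hε)) t).filter_mono
            (nhdsWithin_mono t fun x hx => ne_of_gt hx))
      obtain ⟨t₁, ht₁, hsub⟩ := (mem_nhdsGT_iff_exists_Ioo_subset' htb).1 hev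
      filter_upwards [Ioo_mem_nhdsGT (e.tau_lt_tauLeft hδ.le ht₁),
        Ioo_mem_nhdsGT (h ▸ hu.2)] with v hv hvb
      obtain ⟨t', ht', s', hs', rfl⟩ := e.exists_pos_eq hδ.le hab
        ⟨(hu.1.trans h.le).trans hvb.1.le, hvb.2.le⟩
      have h1 : t < t' := by
        by_contra hc
        exact absurd ((e.pos_le_tau hδ.le t' hs').trans ((e.tau_strictMono hδ.le).monotone
          (not_lt.1 hc))) (not_le.2 hv.1)
      have h2 : t' < t₁ := by
        by_contra hc
        rcases (not_lt.1 hc).eq_or_lt with h3 | h3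
        · exact absurd (h3 ▸ e.tauLeft_le_pos hδ.le t' hs') (not_le.2 hv.2)
        · exact absurd (((e.tauLeft_le_tau hδ.le t₁).trans (e.tau_lt_tauLeft hδ.le h3).le).trans
            (e.tauLeft_le_pos hδ.le t' hs')) (not_le.2 hv.2)
      obtain ⟨h3, h4⟩ := hsub ⟨h1, h2⟩
      rw [e.ext_pos hδ hm.stationary' ht' hs']
      have h5 : ‖φ t' s' - φ t' 1‖ ≤ ε / 2 := by
        by_contra hc
        exact h4 ⟨ht', s', hs', not_le.1 hc⟩
      rw [← dist_eq_norm] at h5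
      linarith [dist_triangle (φ t' s') (φ t' 1) (φ t 1)]
    · have hlt := (e.tauLeft_le_pos hδ.le t hs).trans_lt h
      have h' := sub_pos.2 hlt
      have hev : ∀ᶠ v in 𝓝[>] (e.pos δ t s),
          φ t ((v - e.tauLeft δ t) / (e.tau δ t - e.tauLeft δ t)) = e.ext δ φ v := by
        filter_upwards [Ioo_mem_nhdsGT h] with v hv
        exact (e.ext_affine hδ hm.stationary' ht hlt
          ⟨(e.tauLeft_le_pos hδ.le t hs).trans hv.1.le, hv.2.le⟩).symm
      refine Tendsto.congr' hev ?_
      rw [e.ext_affine hδ hm.stationary' ht hlt ⟨e.tauLeft_le_pos hδ.le t hs, h.le⟩]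
      have h0 := (hfib t ht).1 ((e.pos δ t s - e.tauLeft δ t) / (e.tau δ t - e.tauLeft δ t))
        ⟨div_nonneg (sub_nonneg.2 (e.tauLeft_le_pos hδ.le t hs)) h'.le,
          (div_lt_one h').2 (by linarith)⟩
      refine h0.comp (tendsto_nhdsWithin_iff.2
        ⟨((htend t).tendsto _).mono_left nhdsWithin_le_nhds, ?_⟩)
      filter_upwards [self_mem_nhdsWithin] with v hv
      exact div_lt_div_of_pos_right (sub_lt_sub_right hv _) h'
  · intro u hu
    obtain ⟨t, ht, s, hs, rfl⟩ := e.exists_pos_eq hδ.le hab ⟨hu.1.le, hu.2⟩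
    rcases (e.tauLeft_le_pos hδ.le t hs).eq_or_lt with h | h
    · have hta : a < t := by
        refine lt_of_le_of_ne ht.1 fun hh => ?_
        rw [← h, ← hh, e.tauLeft_left] at hu
        exact lt_irrefl _ hu.1
      obtain ⟨l, hl⟩ := hend.2 t ⟨hta, ht.2⟩
      refine ⟨l, ?_⟩
      rw [← h, Metric.tendsto_nhds]
      intro ε hε
      have hev : ∀ᶠ t' in 𝓝[<] t, dist (φ t' 1) l < ε / 2 ∧
          t' ∉ {t ∈ Icc a b | ∃ s ∈ Icc (0 : ℝ) 1, ε / 2 < ‖φ t s - φ t 1‖} :=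
        (Metric.tendsto_nhds.1 hl (ε / 2) (by positivity)).and
          ((eventually_notMem_of_finite (hm.finite_osc_end (half_pos hε)) t).filter_mono
            (nhdsWithin_mono t fun x hx => ne_of_lt hx))
      obtain ⟨t₁, ht₁, hsub⟩ := (mem_nhdsLT_iff_exists_Ioo_subset' hta).1 hev
      filter_upwards [Ioo_mem_nhdsLT (e.tau_lt_tauLeft hδ.le ht₁),
        Ioo_mem_nhdsLT (h ▸ hu.1)] with v hv hva
      obtain ⟨t', ht', s', hs', rfl⟩ := e.exists_pos_eq hδ.le hab
        ⟨hva.1.le, (hva.2.le.trans h.le).trans hu.2⟩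
      have h1 : t' < t := by
        by_contra hc
        rcases (not_lt.1 hc).eq_or_lt with h3 | h3
        · exact absurd (h3 ▸ e.tauLeft_le_pos hδ.le t' hs') (not_le.2 hv.2)
        · exact absurd (((e.tauLeft_le_tau hδ.le t).trans (e.tau_lt_tauLeft hδ.le h3).le).trans
            (e.tauLeft_le_pos hδ.le t' hs')) (not_le.2 hv.2)
      have h2 : t₁ < t' := by
        by_contra hc
        exact absurd ((e.pos_le_tau hδ.le t' hs').trans ((e.tau_strictMono hδ.le).monotone
          (not_lt.1 hc))) (not_le.2 hv.1)
      obtain ⟨h3, h4⟩ := hsub ⟨h2, h1⟩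
      rw [e.ext_pos hδ hm.stationary' ht' hs']
      have h5 : ‖φ t' s' - φ t' 1‖ ≤ ε / 2 := by
        by_contra hc
        exact h4 ⟨ht', s', hs', not_le.1 hc⟩
      rw [← dist_eq_norm] at h5
      linarith [dist_triangle (φ t' s') (φ t' 1) l]
    · have hle := e.pos_le_tau hδ.le t hs
      have hlt := h.trans_le hle
      have h' := sub_pos.2 hlt
      obtain ⟨l, hl⟩ := (hfib t ht).2
        ((e.pos δ t s - e.tauLeft δ t) / (e.tau δ t - e.tauLeft δ t))
        ⟨div_pos (sub_pos.2 h) h', (div_le_one h').2 (by linarith)⟩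
      have hev : ∀ᶠ v in 𝓝[<] (e.pos δ t s),
          φ t ((v - e.tauLeft δ t) / (e.tau δ t - e.tauLeft δ t)) = e.ext δ φ v := by
        filter_upwards [Ioo_mem_nhdsLT h] with v hv
        exact (e.ext_affine hδ hm.stationary' ht hlt ⟨hv.1.le, hv.2.le.trans hle⟩).symm
      refine ⟨l, Tendsto.congr' hev (hl.comp (tendsto_nhdsWithin_iff.2
        ⟨((htend t).tendsto _).mono_left nhdsWithin_le_nhds, ?_⟩))⟩
      filter_upwards [self_mem_nhdsWithin] with v hv
      exact div_lt_div_of_pos_right (sub_lt_sub_right hv _) h'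

theorem isMarkSet_id (P : Set ℝ) (hP : P ⊆ Icc a b) (hc : P.Countable) :
    IsMarkSet a b (fun t _ : ℝ => t) P where
  subset := hP
  countable := hc
  stationary _ _ _ _ _ := rfl
  finite_osc ε hε := by
    convert Set.finite_empty using 1
    ext t
    simp [hε.le]

theorem support_subset : e.support ⊆ Icc a b := by
  rintro _ ⟨j, hj, rfl⟩
  exact e.mem_Icc j hj

theorem support_countable : e.support.Countable := (to_countable _).image _

theorem isCadlag_tauInv (hδ : 0 < δ) (hab : a ≤ b) : IsCadlag a (b + δ) (e.tauInv δ) :=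
  e.isCadlag_ext hδ hab (φ := fun t _ => t)
    (fun t _ => ⟨fun _ _ => tendsto_const_nhds, fun _ _ => ⟨t, tendsto_const_nhds⟩⟩)
    ⟨fun _ _ => tendsto_nhdsWithin_of_tendsto_nhds tendsto_id,
      fun t _ => ⟨t, tendsto_nhdsWithin_of_tendsto_nhds tendsto_id⟩⟩
    (isMarkSet_id _ e.support_subset e.support_countable)

theorem isCadlag_collapse_fibre (hδ : 0 < δ) {Y : ℝ → E} (hY : IsCadlag a (b + δ) Y) {t : ℝ}
    (ht : t ∈ Icc a b) : IsCadlag 0 1 (e.collapse δ Y t) := by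
  rcases (e.tauLeft_le_tau hδ.le t).eq_or_lt with h | h
  · have : e.collapse δ Y t = fun _ => Y (e.tau δ t) := by
      funext s; simp [collapse, h]
    rw [this]
    exact ⟨fun _ _ => tendsto_const_nhds, fun _ _ => ⟨_, tendsto_const_nhds⟩⟩
  have hst : StrictMono (e.pos δ t) := fun s s' hs =>
    add_lt_add_right (mul_lt_mul_of_pos_right hs (sub_pos.2 h)) _
  have hc : Continuous (e.pos δ t) := by unfold pos; fun_prop
  constructor
  · intro s hs
    have h1 := e.pos_mem hδ.le ht (⟨hs.1, hs.2.le⟩ : s ∈ Icc (0 : ℝ) 1)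
    have h2 := hst hs.2
    have h3 := (e.pos_mem hδ.le ht (⟨zero_le_one, le_rfl⟩ : (1 : ℝ) ∈ Icc (0 : ℝ) 1)).2
    refine (hY.1 _ ⟨h1.1, h2.trans_le h3⟩).comp (tendsto_nhdsWithin_iff.2
      ⟨(hc.tendsto s).mono_left nhdsWithin_le_nhds, ?_⟩)
    filter_upwards [self_mem_nhdsWithin] with v hv
    exact hst hv
  · intro s hs
    have h1 := e.pos_mem hδ.le ht (⟨hs.1.le, hs.2⟩ : s ∈ Icc (0 : ℝ) 1)
    have h2 := hst hs.1
    have h3 := (e.pos_mem hδ.le ht (⟨le_rfl, zero_le_one⟩ : (0 : ℝ) ∈ Icc (0 : ℝ) 1)).1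
    obtain ⟨l, hl⟩ := hY.2 _ ⟨h3.trans_lt h2, h1.2⟩
    refine ⟨l, hl.comp (tendsto_nhdsWithin_iff.2
      ⟨(hc.tendsto s).mono_left nhdsWithin_le_nhds, ?_⟩)⟩
    filter_upwards [self_mem_nhdsWithin] with v hv
    exact hst hv

theorem isCadlag_collapse_end (hδ : 0 < δ) {Y : ℝ → E} (hY : IsCadlag a (b + δ) Y) :
    IsCadlag a b (fun t => e.collapse δ Y t 1) := by
  simp only [collapse_eq, pos_one]
  have i0 : (0 : ℝ) ∈ Icc (0 : ℝ) 1 := ⟨le_rfl, zero_le_one⟩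
  have i1 : (1 : ℝ) ∈ Icc (0 : ℝ) 1 := ⟨zero_le_one, le_rfl⟩
  constructor
  · intro t ht
    have h1 := e.pos_mem hδ.le (⟨ht.1, ht.2.le⟩ : t ∈ Icc a b) i1
    have h2 := e.tau_strictMono hδ.le ht.2
    rw [e.pos_one] at h1
    rw [e.tau_right] at h2
    refine (hY.1 _ ⟨h1.1, h2⟩).comp (tendsto_nhdsWithin_iff.2 ⟨e.tendsto_tau_right hδ.le t, ?_⟩)
    filter_upwards [self_mem_nhdsWithin] with v hv
    exact e.tau_strictMono hδ.le hv
  · intro t ht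
    have h1 := e.pos_mem hδ.le (⟨ht.1.le, ht.2⟩ : t ∈ Icc a b) i0
    rw [e.pos_zero] at h1
    obtain ⟨l, hl⟩ := hY.2 (e.tauLeft δ t) ⟨ht.1.trans_le (e.le_tauLeft hδ.le t), h1.2⟩
    refine ⟨l, hl.comp (tendsto_nhdsWithin_iff.2 ⟨e.tendsto_tau_left hδ.le t, ?_⟩)⟩
    filter_upwards [self_mem_nhdsWithin] with v hv
    exact e.tau_lt_tauLeft hδ.le hv

theorem isMarkSet_collapse (hδ : 0 < δ) {Y : ℝ → E} (hY : IsCadlag a (b + δ) Y) :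
    IsMarkSet a b (e.collapse δ Y) e.support where
  subset := e.support_subset
  countable := e.support_countable
  stationary t _ hm s _ := by
    rw [collapse_eq, collapse_eq, e.pos_of_notMem hm, e.pos_of_notMem hm]
  finite_osc ε hε := by
    have i0 : (0 : ℝ) ∈ Icc (0 : ℝ) 1 := ⟨le_rfl, zero_le_one⟩
    obtain ⟨F, hF⟩ := hY.exists_finset_gap hε
    refine (F.finite_toSet.image (e.tauInv δ)).subset ?_
    rintro t ⟨htm, s, hs, hlt⟩
    have ht := e.support_subset htm
    by_contra hc
    refine absurd (hF _ (e.pos_mem hδ.le ht i0) _ (e.pos_mem hδ.le ht hs)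
      (e.pos_mono hδ.le t hs.1) fun x hx hh => hc ⟨x, hx, e.tauInv_eq hδ.le ht ⟨?_, ?_⟩⟩)
      (not_le.2 hlt)
    · rw [← e.pos_zero]; exact hh.1.le
    · exact hh.2.trans (e.pos_le_tau hδ.le t hs)

end Marks

/-- Every countable subset of `[a, b]` containing `b` can be enumerated without repetition. -/
theorem exists_marks {P : Set ℝ} (hP : P ⊆ Icc a b) (hc : P.Countable) (hb : b ∈ P) :
    ∃ e : Marks a b, e.support = P := by
  classical
  rcases P.finite_or_infinite with hfin | hinf
  · have : Fintype P := hfin.fintype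
    set g := Fintype.equivFin P
    set pts : ℕ → ℝ := fun j => if h : j < Fintype.card P then (g.symm ⟨j, h⟩ : ℝ) else b with hpts
    have himg : pts '' {j : ℕ | (j : ℕ∞) < (Fintype.card P : ℕ∞)} = P := by
      ext x
      constructor
      · rintro ⟨j, hj, rfl⟩
        have hj' : j < Fintype.card P := by exact_mod_cast (show (j : ℕ∞) < _ from hj)
        simp only [hpts, hj', dif_pos]
        exact (g.symm ⟨j, hj'⟩).2
      · intro hx
        refine ⟨g ⟨x, hx⟩, ?_, ?_⟩
        · change ((g ⟨x, hx⟩ : ℕ) : ℕ∞) < _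
          exact_mod_cast (g ⟨x, hx⟩).2
        · simp only [hpts]
          rw [dif_pos (g ⟨x, hx⟩).2]
          simp
    refine ⟨⟨Fintype.card P, pts, fun i hi j hj hij => ?_, fun j hj => ?_, himg.symm.subset hb⟩,
      himg⟩
    · have hi' : i < Fintype.card P := by exact_mod_cast (show (i : ℕ∞) < _ from hi)
      have hj' : j < Fintype.card P := by exact_mod_cast (show (j : ℕ∞) < _ from hj)
      simp only [hpts, hi', hj', dif_pos] at hij
      have := g.symm.injective (Subtype.ext hij)
      simpa using this
    · exact hP (himg.subset (mem_image_of_mem pts hj))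
  · have : Infinite P := hinf.to_subtype
    have : Countable P := hc.to_subtype
    obtain ⟨g⟩ := nonempty_equiv_of_countable (α := P) (β := ℕ)
    have himg : (fun j : ℕ => (g.symm j : ℝ)) '' {j : ℕ | (j : ℕ∞) < (⊤ : ℕ∞)} = P := by
      ext x
      constructor
      · rintro ⟨j, _, rfl⟩
        exact (g.symm j).2
      · intro hx
        exact ⟨g ⟨x, hx⟩, ENat.natCast_lt_top _, by simp⟩
    exact ⟨⟨⊤, fun j => (g.symm j : ℝ), fun i _ j _ hij => g.symm.injective (Subtype.ext hij),
      fun j _ => hP (g.symm j).2, himg.symm.subset hb⟩, himg⟩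

/-- The union of two enumerated sets of marked times. -/
theorem exists_marks_union (e₁ e₂ : Marks a b) :
    ∃ e : Marks a b, e₁.support ⊆ e.support ∧ e₂.support ⊆ e.support := by
  obtain ⟨e, he⟩ := exists_marks (union_subset e₁.support_subset e₂.support_subset)
    (e₁.support_countable.union e₂.support_countable) (Or.inl e₁.right_mem)
  exact ⟨e, he ▸ subset_union_left, he ▸ subset_union_right⟩

theorem hasFinVar_ext_iff {p δ' : ℝ} (hp : 0 < p) (hab : a ≤ b) (hδ : 0 < δ) (hδ' : 0 < δ')
    {e₁ e₂ : Marks a b} {φ : ℝ → ℝ → E} (h₁ : IsMarkSet a b φ e₁.support)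
    (h₂ : IsMarkSet a b φ e₂.support) (h : HasFinVar p (e₁.ext δ φ) (Icc a (b + δ))) :
    HasFinVar p (e₂.ext δ' φ) (Icc a (b + δ')) ∧
      varNorm p (e₂.ext δ' φ) (Icc a (b + δ')) = varNorm p (e₁.ext δ φ) (Icc a (b + δ)) := by
  obtain ⟨e, hs₁, hs₂⟩ := exists_marks_union e₁ e₂
  have θ₁ := e.isTimeChange_pos hδ hab hδ e₁ hs₁
  have θ₂ := e.isTimeChange_pos hδ hab hδ' e₂ hs₂
  have q₁ := e.ext_ext_pos hδ hab hδ e₁ hs₁ h₁.stationary'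
  have q₂ := e.ext_ext_pos hδ hab hδ' e₂ hs₂ h₂.stationary'
  have f : HasFinVar p (e.ext δ φ) (Icc a (b + δ)) :=
    (h.comp hp θ₁.mono θ₁.mapsTo).congr hp q₁
  have f₂ : HasFinVar p (e₂.ext δ' φ) (Icc a (b + δ')) :=
    HasFinVar.of_comp hp θ₂.mono θ₂.surjOn (f.congr hp q₂.symm)
  refine ⟨f₂, ?_⟩
  rw [← varNorm_comp_eq hp θ₁.mono θ₁.surjOn θ₁.mapsTo h,
    ← varNorm_comp_eq hp θ₂.mono θ₂.surjOn θ₂.mapsTo f₂, ← varNorm_congr q₁, ← varNorm_congr q₂]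

end Paths

/-! ### Equivalence of decorated paths -/

theorem orderIso_zero (ρ : Icc (0 : ℝ) 1 ≃o Icc (0 : ℝ) 1) : ρ 0 = 0 := by
  have h1 : (0 : Icc (0 : ℝ) 1) ≤ ρ.symm 0 := (ρ.symm 0).2.1
  have h2 := ρ.monotone h1
  rw [OrderIso.apply_symm_apply] at h2
  exact le_antisymm h2 (ρ 0).2.1

theorem orderIso_one (ρ : Icc (0 : ℝ) 1 ≃o Icc (0 : ℝ) 1) : ρ 1 = 1 := by
  have h1 : ρ.symm 1 ≤ (1 : Icc (0 : ℝ) 1) := (ρ.symm 1).2.2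
  have h2 := ρ.monotone h1
  rw [OrderIso.apply_symm_apply] at h2
  exact le_antisymm (ρ 1).2.2 h2

theorem IsReparam.apply_zero {E : Type*} [NormedAddCommGroup E] {h₁ h₂ : ℝ → E}
    (h : IsReparam h₁ h₂) : h₁ 0 = h₂ 0 := by
  rw [← sub_eq_zero, ← norm_le_zero_iff]
  refine le_of_forall_pos_le_add fun ε hε => ?_
  obtain ⟨ρ, hρ⟩ := h ε hε
  have := hρ 0
  rw [orderIso_zero] at this
  simpa using this

theorem IsReparam.apply_one {E : Type*} [NormedAddCommGroup E] {h₁ h₂ : ℝ → E}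
    (h : IsReparam h₁ h₂) : h₁ 1 = h₂ 1 := by
  rw [← sub_eq_zero, ← norm_le_zero_iff]
  refine le_of_forall_pos_le_add fun ε hε => ?_
  obtain ⟨ρ, hρ⟩ := h ε hε
  have := hρ 1
  rw [orderIso_one] at this
  simpa using this

/-- Two decorated paths are equivalent as soon as their excursions are reparametrisations of each
other, without reference to the left limits: these agree since the end values do, and conversely
right-continuity at `0` recovers the starting values. -/
theorem equiv_iff_isReparam {p a b : ℝ} {n : ℕ} (φ₁ φ₂ : PrePVarPath p a b n) :
    φ₁ ≈ φ₂ ↔ ∀ t ∈ Icc a b, IsReparam (φ₁.1.val t) (φ₂.1.val t) := by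
  have i0 : (0 : ℝ) ∈ Icc (0 : ℝ) 1 := ⟨le_rfl, zero_le_one⟩
  constructor
  · intro h t ht ε hε
    obtain ⟨ρ, hρ⟩ := h t ht ε hε
    have hpos : ∀ s : Icc (0 : ℝ) 1, (s : ℝ) ≠ 0 → ‖φ₁.1.val t (ρ s) - φ₂.1.val t s‖ ≤ ε := by
      intro s hs
      have hs' : (ρ s : ℝ) ≠ 0 := fun h0 => hs (by
        have h1 : ρ s = ρ 0 := by rw [orderIso_zero]; exact Subtype.ext h0
        rw [ρ.injective h1]; rfl)
      have := hρ s
      simpa [PreDecPath.startedFibre, hs, hs'] using this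
    refine ⟨ρ, fun s => ?_⟩
    by_cases hs : (s : ℝ) = 0
    swap
    · exact hpos s hs
    obtain rfl : s = 0 := Subtype.ext hs
    rw [orderIso_zero]
    have hproj : Tendsto (fun x : ℝ => projIcc 0 1 zero_le_one x) (𝓝[>] 0)
        (𝓝 (0 : Icc (0 : ℝ) 1)) := by
      have h1 := (continuous_projIcc (h := zero_le_one (α := ℝ))).tendsto 0
      have h2 : projIcc (0 : ℝ) 1 zero_le_one 0 = 0 := projIcc_left _
      rw [h2] at h1
      exact h1.mono_left nhdsWithin_le_nhds
    have hρt : Tendsto (fun x : ℝ => (ρ (projIcc 0 1 zero_le_one x) : ℝ)) (𝓝[>] 0) (𝓝[>] 0) := by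
      refine tendsto_nhdsWithin_iff.2 ⟨?_, ?_⟩
      · have h1 := (ρ.continuous.tendsto 0).comp hproj
        rw [orderIso_zero] at h1
        exact (continuous_subtype_val.tendsto _).comp h1
      · filter_upwards [Ioo_mem_nhdsGT (zero_lt_one : (0 : ℝ) < 1)] with x hx
        have h1 : (0 : Icc (0 : ℝ) 1) < projIcc 0 1 zero_le_one x := by
          rw [projIcc_of_mem _ ⟨hx.1.le, hx.2.le⟩]; exact hx.1
        have h2 := ρ.strictMono h1
        rw [orderIso_zero] at h2
        exact h2
    have c1 := ((φ₁.1.fibre_cadlag t ht).1 0 ⟨le_rfl, zero_lt_one⟩).comp hρt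
    have c2 := (φ₂.1.fibre_cadlag t ht).1 0 ⟨le_rfl, zero_lt_one⟩
    refine le_of_tendsto (c1.sub c2).norm ?_
    filter_upwards [Ioo_mem_nhdsGT (zero_lt_one : (0 : ℝ) < 1)] with x hx
    have := hpos (projIcc 0 1 zero_le_one x)
    rw [projIcc_of_mem _ (⟨hx.1.le, hx.2.le⟩ : x ∈ Icc (0 : ℝ) 1)] at this
    simpa [projIcc_of_mem _ (⟨hx.1.le, hx.2.le⟩ : x ∈ Icc (0 : ℝ) 1)] using this hx.1.ne'
  · intro h t ht ε hε
    obtain ⟨ρ, hρ⟩ := h t ht ε hε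
    have hleft : φ₁.1.leftValue t = φ₂.1.leftValue t := by
      by_cases hta : t = a
      · simp only [PreDecPath.leftValue, hta, if_true]
        exact (h a (hta ▸ ht)).apply_zero
      · have hat : a < t := lt_of_le_of_ne ht.1 (Ne.symm hta)
        obtain ⟨l, hl⟩ := φ₁.1.end_cadlag.2 t ⟨hat, ht.2⟩
        have hl' : Tendsto (fun u => φ₂.1.val u 1) (𝓝[<] t) (𝓝 l) := by
          refine hl.congr' ?_
          filter_upwards [Ioo_mem_nhdsLT hat] with u hu
          exact (h u ⟨hu.1.le, hu.2.le.trans ht.2⟩).apply_one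
        simp only [PreDecPath.leftValue, hta, if_false]
        rw [leftLim_eq_of_tendsto hl, leftLim_eq_of_tendsto hl']
    refine ⟨ρ, fun s => ?_⟩
    by_cases hs : (s : ℝ) = 0
    · obtain rfl : s = 0 := Subtype.ext hs
      rw [orderIso_zero]
      simpa [PreDecPath.startedFibre, hleft] using hε.le
    · have hs' : (ρ s : ℝ) ≠ 0 := fun h0 => hs (by
        have h1 : ρ s = ρ 0 := by rw [orderIso_zero]; exact Subtype.ext h0
        rw [ρ.injective h1]; rfl)
      simpa [PreDecPath.startedFibre, hs, hs'] using hρ s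

/-! ### Coefficients of class `C^γ` -/

section Coefficients

variable {E F : Type*} [NormedAddCommGroup E] [NormedSpace ℝ E] [NormedAddCommGroup F]
  [NormedSpace ℝ F] {γ : ℝ} {f : E → F}

theorem IsCGamma.one_le_order (hγ : 1 < γ) : 1 ≤ ⌈γ⌉₊ - 1 := by
  have : 1 < ⌈γ⌉₊ := Nat.lt_ceil.2 (by exact_mod_cast hγ)
  omega

theorem IsCGamma.differentiable (hγ : 1 < γ) (h : IsCGamma γ f) : Differentiable ℝ f :=
  h.1.differentiable (by
    have := IsCGamma.one_le_order hγ
    exact_mod_cast (by omega : ⌈γ⌉₊ - 1 ≠ 0))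

/-- For `γ > 1` the class `C^γ` consists of bounded functions with a bounded derivative which is
Hölder continuous of exponent `min (γ - 1) 1`. -/
theorem IsCGamma.exists_bounds (hγ : 1 < γ) (h : IsCGamma γ f) : ∃ M : ℝ, 0 ≤ M ∧
    (∀ x, ‖f x‖ ≤ M) ∧ (∀ x, ‖fderiv ℝ f x‖ ≤ M) ∧
      ∀ x y, ‖fderiv ℝ f x - fderiv ℝ f y‖ ≤ M * ‖x - y‖ ^ min (γ - 1) 1 := by
  have hk := IsCGamma.one_le_order hγ
  obtain ⟨hcd, M, hM, hH⟩ := h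
  have hM0 : 0 ≤ M := (norm_nonneg _).trans (hM 0 (Nat.zero_le _) 0)
  refine ⟨M, hM0, fun x => ?_, fun x => ?_, fun x y => ?_⟩
  · rw [← norm_iteratedFDeriv_zero (𝕜 := ℝ) (f := f)]
    exact hM 0 (Nat.zero_le _) x
  · rw [← norm_iteratedFDeriv_one (𝕜 := ℝ) f]
    exact hM 1 hk x
  · rcases hk.eq_or_lt with h1 | h1
    · have hγ2 : γ ≤ 2 := by
        have h2 : ⌈γ⌉₊ ≤ 2 := by omega
        exact_mod_cast Nat.ceil_le.1 h2
      have h3 := hH x y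
      rw [← h1, Nat.cast_one] at h3
      rw [min_eq_left (by linarith)]
      refine ContinuousLinearMap.opNorm_le_bound _ (by positivity) fun v => ?_
      have h4 := (iteratedFDeriv ℝ 1 f x - iteratedFDeriv ℝ 1 f y).le_opNorm (fun _ => v)
      rw [sub_apply, iteratedFDeriv_one_apply, iteratedFDeriv_one_apply] at h4
      simp only [Finset.univ_unique, Finset.prod_singleton] at h4
      exact h4.trans (mul_le_mul_of_nonneg_right h3 (norm_nonneg _))
    · have hγ2 : 2 < γ := by
        have h2 : 2 < ⌈γ⌉₊ := by omega
        exact_mod_cast Nat.lt_ceil.1 h2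
      rw [min_eq_right (by linarith), Real.rpow_one]
      have hd : ContDiff ℝ 1 (fderiv ℝ f) := by
        refine (hcd.fderiv_right (m := 1) ?_)
        exact_mod_cast (by omega : 1 + 1 ≤ ⌈γ⌉₊ - 1)
      refine Convex.norm_image_sub_le_of_norm_fderiv_le (𝕜 := ℝ) (s := univ)
        (fun z _ => (hd.differentiable one_ne_zero).differentiableAt) (fun z _ => ?_) convex_univ
        (mem_univ y) (mem_univ x)
      rw [← norm_iteratedFDeriv_one, norm_iteratedFDeriv_fderiv]
      exact hM 2 h1 z

theorem norm_sub_le_of_norm_fderiv_le {M : ℝ} (hf : Differentiable ℝ f)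
    (hM : ∀ x, ‖fderiv ℝ f x‖ ≤ M) (x y : E) : ‖f x - f y‖ ≤ M * ‖x - y‖ :=
  Convex.norm_image_sub_le_of_norm_fderiv_le (𝕜 := ℝ) (s := univ)
    (fun _ _ => hf.differentiableAt) (fun z _ => hM z) convex_univ (mem_univ y) (mem_univ x)

/-- The four-point estimate: compare the derivatives of `f` along the two segments. -/
theorem four_point_of_holder_fderiv {M α : ℝ} (hM0 : 0 ≤ M) (hα : 0 ≤ α) (hf : Differentiable ℝ f)
    (hM : ∀ x, ‖fderiv ℝ f x‖ ≤ M)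
    (hH : ∀ x y, ‖fderiv ℝ f x - fderiv ℝ f y‖ ≤ M * ‖x - y‖ ^ α) (y₁ z₁ y₂ z₂ : E) :
    ‖f y₁ - f z₁ - (f y₂ - f z₂)‖ ≤
      M * ‖y₁ - z₁ - (y₂ - z₂)‖ + M * (‖y₁ - y₂‖ + ‖z₁ - z₂‖) ^ α * ‖y₂ - z₂‖ := by
  have hseg : ∀ (y z : E) (θ : ℝ), HasDerivAt (fun θ : ℝ => f (z + θ • (y - z)))
      (fderiv ℝ f (z + θ • (y - z)) (y - z)) θ := fun y z θ => by
    have h1 : HasDerivAt (fun θ : ℝ => z + θ • (y - z)) (y - z) θ := by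
      simpa using ((hasDerivAt_id θ).smul_const (y - z)).const_add z
    exact (hf _).hasFDerivAt.comp_hasDerivAt θ h1
  have key := norm_image_sub_le_of_norm_deriv_le_segment_01'
    (f := fun θ : ℝ => f (z₁ + θ • (y₁ - z₁)) - f (z₂ + θ • (y₂ - z₂)))
    (C := M * ‖y₁ - z₁ - (y₂ - z₂)‖ + M * (‖y₁ - y₂‖ + ‖z₁ - z₂‖) ^ α * ‖y₂ - z₂‖)
    (fun θ _ => ((hseg y₁ z₁ θ).sub (hseg y₂ z₂ θ)).hasDerivWithinAt) fun θ hθ => ?_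
  · simpa [sub_sub_sub_comm] using key
  · set x₁ := z₁ + θ • (y₁ - z₁) with hx₁
    set x₂ := z₂ + θ • (y₂ - z₂) with hx₂
    have e1 : fderiv ℝ f x₁ (y₁ - z₁) - fderiv ℝ f x₂ (y₂ - z₂) =
        fderiv ℝ f x₁ (y₁ - z₁ - (y₂ - z₂)) + (fderiv ℝ f x₁ - fderiv ℝ f x₂) (y₂ - z₂) := by
      rw [map_sub (fderiv ℝ f x₁) (y₁ - z₁), sub_apply]
      abel
    have e2 : x₁ - x₂ = (1 - θ) • (z₁ - z₂) + θ • (y₁ - y₂) := by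
      rw [hx₁, hx₂]; module
    have e3 : ‖x₁ - x₂‖ ≤ ‖y₁ - y₂‖ + ‖z₁ - z₂‖ := by
      rw [e2]
      refine (norm_add_le _ _).trans ?_
      rw [norm_smul, norm_smul, Real.norm_of_nonneg hθ.1,
        Real.norm_of_nonneg (by linarith [hθ.2] : 0 ≤ 1 - θ)]
      nlinarith [norm_nonneg (y₁ - y₂), norm_nonneg (z₁ - z₂), hθ.1, hθ.2]
    rw [e1]
    refine (norm_add_le _ _).trans (add_le_add ?_ ?_)
    · exact ((fderiv ℝ f x₁).le_opNorm _).trans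
        (mul_le_mul_of_nonneg_right (hM _) (norm_nonneg _))
    · refine ((fderiv ℝ f x₁ - fderiv ℝ f x₂).le_opNorm _).trans
        (mul_le_mul_of_nonneg_right ((hH _ _).trans ?_) (norm_nonneg _))
      exact mul_le_mul_of_nonneg_left (Real.rpow_le_rpow (norm_nonneg _) e3 hα) hM0

end Coefficients

theorem norm_comp_snd_le {d : ℕ} {E : Type*} [NormedAddCommGroup E] [NormedSpace ℝ E]
    (L : RSp d →L[ℝ] E) : ‖L.comp (ContinuousLinearMap.snd ℝ ℝ (RSp d))‖ ≤ ‖L‖ :=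
  (L.opNorm_comp_le _).trans
    (mul_le_of_le_one_right (norm_nonneg _) (ContinuousLinearMap.norm_snd_le _ _ _))

theorem norm_fst_smulRight_le {d : ℕ} {E : Type*} [NormedAddCommGroup E] [NormedSpace ℝ E]
    (v : E) : ‖(ContinuousLinearMap.fst ℝ ℝ (RSp d)).smulRight v‖ ≤ ‖v‖ := by
  rw [ContinuousLinearMap.norm_smulRight_apply]
  exact mul_le_of_le_one_left (norm_nonneg _) (ContinuousLinearMap.norm_fst_le _ _ _)

/-- For coefficients of class `C^β`, `β > 1`, and `C^γ`, `γ > p`, the field `(A, B)` satisfies the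
estimates used for Young equations, with `α = min (γ - 1) 1`. -/
theorem exists_isYoungField {m d : ℕ} {p β γ : ℝ} (hp : 1 ≤ p) (hβ : 1 < β) (hγ : p < γ)
    (hp2 : p < 2) {A : RSp m → RSp m} {B : RSp m → RSp d →L[ℝ] RSp m} (hA : IsCGamma β A)
    (hB : IsCGamma γ B) :
    ∃ α M : ℝ, 0 < α ∧ α ≤ 1 ∧ p < 1 + α ∧
      IsYoungField (jointField A B) (ContinuousLinearMap.fst ℝ ℝ (RSp d)) A
        (fun y => (B y).comp (ContinuousLinearMap.snd ℝ ℝ (RSp d))) α M := by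
  have hγ1 : 1 < γ := by linarith
  obtain ⟨MA, hMA, hA0, hA1, -⟩ := hA.exists_bounds hβ
  obtain ⟨MB, hMB, hB0, hB1, hB2⟩ := hB.exists_bounds hγ1
  have hAd := hA.differentiable hβ
  have hBd := hB.differentiable hγ1
  set α := min (γ - 1) 1 with hα
  have hα0 : 0 < α := lt_min (by linarith) one_pos
  have hAL := norm_sub_le_of_norm_fderiv_le hAd hA1
  have hBL := norm_sub_le_of_norm_fderiv_le hBd hB1
  refine ⟨α, MA + MB + 1, hα0, min_le_right _ _, ?_, by linarith, fun y u => rfl, fun y => ?_,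
    fun y z => ?_, fun y z => ?_, fun y₁ z₁ y₂ z₂ => ?_⟩
  · rw [hα, ← sub_lt_iff_lt_add']
    exact lt_min (by linarith) (by linarith)
  · refine (norm_add_le _ _).trans ?_
    linarith [norm_fst_smulRight_le (d := d) (A y), norm_comp_snd_le (B y), hA0 y, hB0 y]
  · have e : jointField A B y - jointField A B z =
        (ContinuousLinearMap.fst ℝ ℝ (RSp d)).smulRight (A y - A z) +
          (B y - B z).comp (ContinuousLinearMap.snd ℝ ℝ (RSp d)) := by
      refine ContinuousLinearMap.ext fun u => ?_
      simp only [jointField, sub_apply, add_apply, ContinuousLinearMap.smulRight_apply,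
        ContinuousLinearMap.comp_apply, smul_sub]
      abel
    rw [e]
    refine (norm_add_le _ _).trans ?_
    have := norm_nonneg (y - z)
    nlinarith [norm_fst_smulRight_le (d := d) (A y - A z), norm_comp_snd_le (B y - B z),
      hAL y z, hBL y z]
  · have := norm_nonneg (y - z)
    nlinarith [hAL y z]
  · simp only [← ContinuousLinearMap.sub_comp]
    refine (norm_comp_snd_le _).trans
      ((four_point_of_holder_fderiv hMB hα0.le hBd hB1 hB2 y₁ z₁ y₂ z₂).trans ?_)
    have h1 : MB ≤ MA + MB + 1 := by linarith
    gcongr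

/-! ### The extended equations and their collapsed solutions -/

section Driver

variable {a b δ p : ℝ} {E : Type*} [NormedAddCommGroup E]

theorem SumLE.prodMk {α F G : Type*} [LinearOrder α] [NormedAddCommGroup F]
    [NormedAddCommGroup G] {p C D : ℝ} {s : Set α} {f : α → F} {g : α → G} (hp : 1 ≤ p)
    (hC : 0 ≤ C) (hD : 0 ≤ D) (hf : SumLE p (fun x y => ‖f y - f x‖) s C)
    (hg : SumLE p (fun x y => ‖g y - g x‖) s D) :
    SumLE p (fun x y => ‖(f y, g y) - (f x, g x)‖) s (C + D) :=
  SumLE.mono_left (by linarith) (fun _ _ _ _ _ => norm_nonneg _)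
    (fun x _ y _ _ => by
      rw [Prod.mk_sub_mk, Prod.norm_mk]
      exact max_le_add_of_nonneg (norm_nonneg _) (norm_nonneg _))
    (SumLE.add hp hC hD (fun _ _ _ _ _ => norm_nonneg _) (fun _ _ _ _ _ => norm_nonneg _) hf hg)

namespace Marks

variable (e : Marks a b)

theorem sumLE_tauInv (hp : 1 ≤ p) (hδ : 0 < δ) (hab : a ≤ b) :
    SumLE p (fun x y => ‖e.tauInv δ y - e.tauInv δ x‖) (Icc a (b + δ)) (b - a) := by
  have hm := e.tauInv_monotoneOn hδ hab
  refine SumLE.mono_left (by linarith) (fun _ _ _ _ _ => norm_nonneg _)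
    (fun x hx y hy hxy => (Real.norm_of_nonneg (sub_nonneg.2 (hm hx hy hxy))).le)
    (sumLE_of_monotone hp (fun x hx y hy hxy => hm hx hy hxy) fun x hx y hy => ?_)
  linarith [(e.tauInv_mem hδ.le hab hx).1.1, (e.tauInv_mem hδ.le hab hy).1.2]

/-- The driver `(Id, φ)^δ` of the extended equation has variation controlled by that of `φ^δ`. -/
theorem hasFinVar_driver (hp : 1 ≤ p) (hδ : 0 < δ) (hab : a ≤ b) {φ : ℝ → ℝ → E}
    (h : HasFinVar p (e.ext δ φ) (Icc a (b + δ))) :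
    HasFinVar p (e.ext δ (fun t s => (t, φ t s))) (Icc a (b + δ)) ∧
      varNorm p (e.ext δ (fun t s => (t, φ t s))) (Icc a (b + δ)) ≤
        b - a + varNorm p (e.ext δ φ) (Icc a (b + δ)) := by
  have hp0 : 0 < p := by linarith
  have h1 : SumLE p (fun x y => ‖e.ext δ (fun t s => (t, φ t s)) y -
      e.ext δ (fun t s => (t, φ t s)) x‖) (Icc a (b + δ))
      (b - a + varNorm p (e.ext δ φ) (Icc a (b + δ))) :=
    (e.sumLE_tauInv hp hδ hab).prodMk hp (by linarith) varNorm_nonneg (h.sumLE hp0)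
  have h0 : 0 ≤ b - a + varNorm p (e.ext δ φ) (Icc a (b + δ)) :=
    add_nonneg (by linarith) varNorm_nonneg
  exact ⟨h1.hasFinVar hp0 h0, h1.varNorm_le hp0 h0⟩

theorem isCadlag_driver (hδ : 0 < δ) (hab : a ≤ b) {φ : ℝ → ℝ → E}
    (h : IsCadlag a (b + δ) (e.ext δ φ)) :
    IsCadlag a (b + δ) (e.ext δ (fun t s => (t, φ t s))) := by
  have h' := e.isCadlag_tauInv hδ hab
  refine ⟨fun t ht => (h'.1 t ht).prodMk_nhds (h.1 t ht), fun t ht => ?_⟩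
  obtain ⟨l, hl⟩ := h'.2 t ht
  obtain ⟨l', hl'⟩ := h.2 t ht
  exact ⟨(l, l'), hl.prodMk_nhds hl'⟩

/-- Excursions which are reparametrisations of each other give `δ`-extensions which are uniformly
close up to a time change preserving the inserted intervals. -/
theorem exists_timeChange_of_isReparam (hδ : 0 < δ) (hab : a ≤ b) {φ₁ φ₂ : ℝ → ℝ → E}
    (h₁ : e.Stationary φ₁) (h₂ : e.Stationary φ₂)
    (h : ∀ t ∈ Icc a b, IsReparam (φ₁ t) (φ₂ t)) {ε : ℝ} (hε : 0 < ε) :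
    ∃ θ : ℝ → ℝ, IsTimeChange a (b + δ) (b + δ) θ ∧
      (∀ u ∈ Icc a (b + δ), e.tauInv δ (θ u) = e.tauInv δ u) ∧
      (∀ u ∈ Icc a (b + δ), ‖e.ext δ φ₁ (θ u) - e.ext δ φ₂ u‖ ≤ ε) ∧
      ∀ t ∈ Icc a b, ∃ ρ : Icc (0 : ℝ) 1 ≃o Icc (0 : ℝ) 1, ∀ s : Icc (0 : ℝ) 1,
        θ (e.pos δ t s) = e.pos δ t (ρ s) := by
  have h' : ∀ t, ∃ ρ : Icc (0 : ℝ) 1 ≃o Icc (0 : ℝ) 1, t ∈ Icc a b →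
      ∀ s : Icc (0 : ℝ) 1, ‖φ₁ t (ρ s) - φ₂ t s‖ ≤ ε := fun t => by
    by_cases ht : t ∈ Icc a b
    · obtain ⟨ρ, hρ⟩ := h t ht ε hε
      exact ⟨ρ, fun _ => hρ⟩
    · exact ⟨OrderIso.refl _, fun hh => absurd hh ht⟩
  choose ρ hρ using h'
  have hst : e.Stationary (fun t s => e.pos δ t (ρ t (projIcc 0 1 zero_le_one s))) :=
    fun t _ hm s _ => by
      change e.pos δ t _ = e.pos δ t _
      rw [e.pos_of_notMem hm, e.pos_of_notMem hm]
  have key : ∀ t ∈ Icc a b, ∀ s : Icc (0 : ℝ) 1,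
      e.ext δ (fun t s => e.pos δ t (ρ t (projIcc 0 1 zero_le_one s))) (e.pos δ t s) =
        e.pos δ t (ρ t s) := fun t ht s => by
    rw [e.ext_pos hδ hst ht s.2, projIcc_val]
  refine ⟨_, e.isTimeChange_reparam hδ hab ρ, fun u hu => ?_, fun u hu => ?_,
    fun t ht => ⟨ρ t, key t ht⟩⟩
  · obtain ⟨t, ht, s, hs, rfl⟩ := e.exists_pos_eq hδ.le hab hu
    rw [key t ht ⟨s, hs⟩, e.tauInv_pos hδ.le ht (ρ t _).2, e.tauInv_pos hδ.le ht hs]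
  · obtain ⟨t, ht, s, hs, rfl⟩ := e.exists_pos_eq hδ.le hab hu
    rw [key t ht ⟨s, hs⟩, e.ext_pos hδ h₁ ht (ρ t _).2, e.ext_pos hδ h₂ ht hs]
    exact hρ t ht ⟨s, hs⟩

end Marks

end Driver

theorem PrePVarPath.isCadlag_ext {p a b δ : ℝ} {n : ℕ} (φ : PrePVarPath p a b n) {e : Marks a b}
    (he : IsMarkSet a b φ.1.val e.support) (hδ : 0 < δ) (hab : a ≤ b) :
    IsCadlag a (b + δ) (e.ext δ φ.1.val) :=
  e.isCadlag_ext hδ hab φ.1.fibre_cadlag φ.1.end_cadlag he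

theorem PrePVarPath.hasFinVar_ext {p a b δ : ℝ} {n : ℕ} (φ : PrePVarPath p a b n) {e : Marks a b}
    (he : IsMarkSet a b φ.1.val e.support) (hδ : 0 < δ) :
    HasFinVar p (e.ext δ φ.1.val) (Icc a (b + δ)) := φ.2 e he δ hδ

/-- Two decorated paths have a common enumerated set of marked times. -/
theorem PreDecPath.exists_common_marks {a b : ℝ} {n n' : ℕ} (hab : a ≤ b) (φ : PreDecPath a b n)
    (ψ : PreDecPath a b n') : ∃ e : Marks a b,
      IsMarkSet a b φ.val e.support ∧ IsMarkSet a b ψ.val e.support := by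
  obtain ⟨P, hP⟩ := φ.exists_markSet
  obtain ⟨Q, hQ⟩ := ψ.exists_markSet
  have hsub : insert b (P ∪ Q) ⊆ Icc a b :=
    insert_subset ⟨hab, le_rfl⟩ (union_subset hP.subset hQ.subset)
  have hc : (insert b (P ∪ Q)).Countable := (hP.countable.union hQ.countable).insert b
  obtain ⟨e, he⟩ := exists_marks hsub hc (mem_insert _ _)
  refine ⟨e, ?_, ?_⟩ <;> rw [he]
  · exact hP.mono (subset_union_left.trans (subset_insert _ _)) hsub hc
  · exact hQ.mono (subset_union_right.trans (subset_insert _ _)) hsub hc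

/-- The decorated path obtained from a path on `[a, b + δ]` by collapsing the inserted
intervals. -/
def Marks.collapsePath {p a b δ : ℝ} {n : ℕ} (hp : 0 < p) (hab : a ≤ b) (e : Marks a b)
    (hδ : 0 < δ) (Y : ℝ → RSp n) (hY : IsCadlag a (b + δ) Y)
    (hf : HasFinVar p Y (Icc a (b + δ))) : PrePVarPath p a b n :=
  ⟨⟨e.collapse δ Y, fun _ ht => e.isCadlag_collapse_fibre hδ hY ht, e.isCadlag_collapse_end hδ hY,
    e.support, e.isMarkSet_collapse hδ hY⟩, fun _ he' _ hδ' =>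
    (hasFinVar_ext_iff hp hab hδ hδ' (e.isMarkSet_collapse hδ hY) he'
      (hf.congr hp (e.ext_collapse hδ hab Y))).1⟩

/-- The `p`-variation of the `δ`-extensions depends on the equivalence class only. -/
theorem varNorm_ext_le_of_equiv {p a b δ : ℝ} {n : ℕ} (hp : 0 < p) (hab : a ≤ b) (hδ : 0 < δ)
    {φ₁ φ₂ : PrePVarPath p a b n} (h : φ₁ ≈ φ₂) {e₁ e₂ : Marks a b} {δ' : ℝ} (hδ' : 0 < δ')
    (h₁ : IsMarkSet a b φ₁.1.val e₁.support) (h₂ : IsMarkSet a b φ₂.1.val e₂.support) :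
    varNorm p (e₂.ext δ' φ₂.1.val) (Icc a (b + δ')) ≤
      varNorm p (e₁.ext δ φ₁.1.val) (Icc a (b + δ)) := by
  obtain ⟨e, h₁', h₂'⟩ := φ₁.1.exists_common_marks hab φ₂.1
  rw [(hasFinVar_ext_iff hp hab hδ hδ' h₂' h₂ (φ₂.hasFinVar_ext h₂' hδ)).2,
    ← (hasFinVar_ext_iff hp hab hδ hδ h₁ h₁' (φ₁.hasFinVar_ext h₁ hδ)).2]
  have h' := (equiv_iff_isReparam φ₁ φ₂).1 h
  choose θ hθ _ hθ' _ using fun k : ℕ => e.exists_timeChange_of_isReparam hδ hab h₁'.stationary'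
    h₂'.stationary' h' (Nat.one_div_pos_of_nat (α := ℝ) (n := k))
  refine SumLE.varNorm_le hp varNorm_nonneg (sumLE_of_tendsto (l := atTop)
    (φ := fun k u => e.ext δ φ₁.1.val (θ k u)) hp (fun u hu => ?_)
    (Eventually.of_forall fun k => ((φ₁.hasFinVar_ext h₁' hδ).sumLE hp).comp (hθ k).mono
      (hθ k).mapsTo))
  rw [tendsto_iff_norm_sub_tendsto_zero]
  exact squeeze_zero (fun _ => norm_nonneg _) (fun k => hθ' k u hu)
    tendsto_one_div_add_atTop_nhds_zero_nat

theorem IsReparam.congr {E : Type*} [NormedAddCommGroup E] {h₁ h₂ g₁ g₂ : ℝ → E}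
    (h : IsReparam h₁ h₂) (e₁ : EqOn g₁ h₁ (Icc 0 1)) (e₂ : EqOn g₂ h₂ (Icc 0 1)) :
    IsReparam g₁ g₂ := fun ε hε => by
  obtain ⟨ρ, hρ⟩ := h ε hε
  refine ⟨ρ, fun s => ?_⟩
  rw [e₁ (ρ s).2, e₂ s.2]
  exact hρ s

theorem SolvesYoung.exponent_mono {U E : Type*} [NormedAddCommGroup U] [NormedSpace ℝ U]
    [NormedAddCommGroup E] [NormedSpace ℝ E] {p q a c : ℝ} {f : E → U →L[ℝ] E} {ξ : E}
    {ω : ℝ → U} {Y : ℝ → E} (hp : 0 < p) (hpq : p ≤ q) (h : SolvesYoung p a c f ξ ω Y) :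
    SolvesYoung q a c f ξ ω Y := ⟨h.1, h.2.1.exponent_mono hp hpq, h.2.2⟩

section Extended

variable {m d : ℕ} {a b p α M δ δ' : ℝ} {A : RSp m → RSp m} {B : RSp m → RSp d →L[ℝ] RSp m}

/-- Estimates on the coefficients of `dX = A(X) dt + B(X) dφ` sufficient for the theory of Young
equations in `p`-variation. -/
structure IsYoungCoeff (p : ℝ) (A : RSp m → RSp m) (B : RSp m → RSp d →L[ℝ] RSp m) (α M : ℝ) :
    Prop where
  one_le : 1 ≤ p
  pos : 0 < α
  le_one : α ≤ 1
  lt_one_add : p < 1 + α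
  field : IsYoungField (jointField A B) (ContinuousLinearMap.fst ℝ ℝ (RSp d)) A
    (fun y => (B y).comp (ContinuousLinearMap.snd ℝ ℝ (RSp d))) α M

namespace IsYoungCoeff

theorem lt_two (h : IsYoungCoeff p A B α M) : p < 2 := by linarith [h.le_one, h.lt_one_add]

theorem exists_isExtSolution (h : IsYoungCoeff p A B α M) (hab : a ≤ b) (ξ : RSp m)
    (φ : PrePVarPath p a b d) {e : Marks a b} (he : IsMarkSet a b φ.1.val e.support)
    (hδ : 0 < δ) : ∃ Y, IsExtSolution p A B ξ φ.1.val e δ Y :=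
  exists_solvesYoung h.field h.one_le h.pos h.le_one h.lt_one_add (by linarith)
    (e.isCadlag_driver hδ hab (φ.isCadlag_ext he hδ hab))
    (e.hasFinVar_driver h.one_le hδ hab (φ.hasFinVar_ext he hδ)).1 (e.tauInv_monotoneOn hδ hab) ξ

theorem eqOn (h : IsYoungCoeff p A B α M) (hab : a ≤ b) {ξ : RSp m} {φ : PrePVarPath p a b d}
    {e : Marks a b} (he : IsMarkSet a b φ.1.val e.support) (hδ : 0 < δ) {Y Y' : ℝ → RSp m}
    (hY : IsExtSolution p A B ξ φ.1.val e δ Y) (hY' : SolvesYoung p a (b + δ) (jointField A B) ξ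
      (e.ext δ (fun t s => (t, φ.1.val t s))) Y') : EqOn Y Y' (Icc a (b + δ)) :=
  SolvesYoung.eqOn h.field h.one_le h.lt_two h.pos h.le_one h.lt_one_add (by linarith)
    (e.hasFinVar_driver h.one_le hδ hab (φ.hasFinVar_ext he hδ)).1 (e.tauInv_monotoneOn hδ hab)
    hY hY'

/-- By uniqueness, a solution for more marked times is a time change of the solution for fewer. -/
theorem collapse_eq_of_subset (h : IsYoungCoeff p A B α M) (hab : a ≤ b) {ξ : RSp m}
    {φ : PrePVarPath p a b d} {e e' : Marks a b} (hee : e'.support ⊆ e.support)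
    (he : IsMarkSet a b φ.1.val e.support) (he' : IsMarkSet a b φ.1.val e'.support) (hδ : 0 < δ)
    (hδ' : 0 < δ') {Y Y' : ℝ → RSp m} (hY : IsExtSolution p A B ξ φ.1.val e δ Y)
    (hY' : IsExtSolution p A B ξ φ.1.val e' δ' Y') {t s : ℝ} (ht : t ∈ Icc a b)
    (hs : s ∈ Icc (0 : ℝ) 1) : e.collapse δ Y t s = e'.collapse δ' Y' t s := by
  have hθ := e.isTimeChange_pos hδ hab hδ' e' hee
  have h1 := (hθ.solvesYoung_comp (by linarith [h.one_le]) hY').congr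
    (e.ext_ext_pos hδ hab hδ' e' hee (φ := fun t s => (t, φ.1.val t s)) fun t ht hm s hs =>
      congrArg (Prod.mk t) (he'.stationary t ht hm s hs))
  have h2 := h.eqOn hab he hδ hY h1 (e.pos_mem hδ.le ht hs)
  rw [e.collapse_eq, e'.collapse_eq, h2, e.ext_pos hδ (e.stationary_pos e' hee δ') ht hs]

/-- The collapsed solution depends neither on the marked times nor on `δ`. -/
theorem collapse_eq (h : IsYoungCoeff p A B α M) (hab : a ≤ b) {ξ : RSp m}
    {φ : PrePVarPath p a b d} {e e' : Marks a b} (he : IsMarkSet a b φ.1.val e.support)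
    (he' : IsMarkSet a b φ.1.val e'.support) (hδ : 0 < δ) (hδ' : 0 < δ') {Y Y' : ℝ → RSp m}
    (hY : IsExtSolution p A B ξ φ.1.val e δ Y) (hY' : IsExtSolution p A B ξ φ.1.val e' δ' Y')
    {t s : ℝ} (ht : t ∈ Icc a b) (hs : s ∈ Icc (0 : ℝ) 1) :
    e.collapse δ Y t s = e'.collapse δ' Y' t s := by
  obtain ⟨g, h₁, h₂⟩ := exists_marks_union e e'
  have hg : IsMarkSet a b φ.1.val g.support := he.mono h₁ g.support_subset g.support_countable
  obtain ⟨Z, hZ⟩ := h.exists_isExtSolution hab ξ φ hg one_pos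
  rw [← h.collapse_eq_of_subset hab h₁ hg he one_pos hδ hZ hY ht hs,
    h.collapse_eq_of_subset hab h₂ hg he' one_pos hδ' hZ hY' ht hs]

/-- Equivalent drivers have equivalent solutions: up to time changes the extended drivers are
uniformly close with bounded `p`-variation, hence close in `q`-variation for `q > p`, and the
equations are stable in `q`-variation. -/
theorem isReparam_of_common (h : IsYoungCoeff p A B α M) (hab : a ≤ b) {ξ : RSp m}
    {φ₁ φ₂ : PrePVarPath p a b d} (hφ : φ₁ ≈ φ₂) {e : Marks a b}
    (h₁ : IsMarkSet a b φ₁.1.val e.support) (h₂ : IsMarkSet a b φ₂.1.val e.support) (hδ : 0 < δ)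
    {Y₁ Y₂ : ℝ → RSp m} (hY₁ : IsExtSolution p A B ξ φ₁.1.val e δ Y₁)
    (hY₂ : IsExtSolution p A B ξ φ₂.1.val e δ Y₂) {t : ℝ} (ht : t ∈ Icc a b) :
    IsReparam (e.collapse δ Y₁ t) (e.collapse δ Y₂ t) := by
  have hp := h.one_le
  have hp0 : 0 < p := by linarith
  have hα1 := h.le_one
  have hpα := h.lt_one_add
  set q := (p + (1 + α)) / 2 with hq
  have hpq : p < q := by rw [hq]; linarith
  have hq1 : q < 1 + α := by rw [hq]; linarith
  have hq0 : 0 < q := by linarith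
  have hac : a ≤ b + δ := by linarith
  obtain ⟨f₁, -⟩ := e.hasFinVar_driver hp hδ hab (φ₁.hasFinVar_ext h₁ hδ)
  obtain ⟨f₂, -⟩ := e.hasFinVar_driver hp hδ hab (φ₂.hasFinVar_ext h₂ hδ)
  set ω₁ := e.ext δ (fun t s => (t, φ₁.1.val t s)) with hω₁
  set ω₂ := e.ext δ (fun t s => (t, φ₂.1.val t s)) with hω₂
  set R := max (b - a) (max (varNorm p ω₁ (Icc a (b + δ))) (varNorm p ω₂ (Icc a (b + δ)))) with hR
  have hR0 : 0 ≤ R := le_max_of_le_left (by linarith)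
  have hRa : b - a ≤ R := le_max_left _ _
  have hR1 : varNorm p ω₁ (Icc a (b + δ)) ≤ R := (le_max_left _ _).trans (le_max_right _ _)
  have hR2 : varNorm p ω₂ (Icc a (b + δ)) ≤ R := (le_max_right _ _).trans (le_max_right _ _)
  obtain ⟨K, hK0, hK⟩ := young_stability h.field (by linarith : 1 ≤ q) (by linarith) h.pos hα1
    hq1 R
  have hlim : Tendsto (fun ε : ℝ => K * ((2 * ε) ^ (1 - p / q) * (R + R) ^ (p / q))) (𝓝[>] 0)
      (𝓝 0) := by
    have hr : 0 < 1 - p / q := by rw [sub_pos, div_lt_one hq0]; exact hpq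
    have hc : Continuous fun ε : ℝ => K * ((2 * ε) ^ (1 - p / q) * (R + R) ^ (p / q)) :=
      continuous_const.mul (((continuous_const.mul continuous_id).rpow_const
        fun _ => Or.inr hr.le).mul continuous_const)
    have := hc.tendsto 0
    simp only [mul_zero, Real.zero_rpow hr.ne', zero_mul] at this
    exact this.mono_left nhdsWithin_le_nhds
  intro ε hε
  obtain ⟨ε', hε'⟩ := ((hlim.eventually (gt_mem_nhds hε)).and self_mem_nhdsWithin).exists
  have hε'0 : 0 < ε' := hε'.2
  obtain ⟨θ, hθ, hθ1, hθ2, hθ3⟩ := e.exists_timeChange_of_isReparam hδ hab h₁.stationary'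
    h₂.stationary' ((equiv_iff_isReparam φ₁ φ₂).1 hφ) hε'0
  have f₁' := f₁.comp hp0 hθ.mono hθ.mapsTo
  have hclose : ∀ u ∈ Icc a (b + δ), ‖ω₁ (θ u) - ω₂ u‖ ≤ ε' := fun u hu => by
    change ‖(e.tauInv δ (θ u), e.ext δ φ₁.1.val (θ u)) -
      (e.tauInv δ u, e.ext δ φ₂.1.val u)‖ ≤ ε'
    rw [Prod.mk_sub_mk, Prod.norm_mk, hθ1 u hu, sub_self, norm_zero]
    exact max_le hε'0.le (hθ2 u hu)
  have hdiff := sumLE_sub_of_norm_le hp hpq.le hR0 hR0 hε'0.le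
    (((f₁.sumLE hp0).comp hθ.mono hθ.mapsTo).mono_right hp0.le varNorm_nonneg hR1)
    ((f₂.sumLE hp0).mono_right hp0.le varNorm_nonneg hR2) hclose
  have hdiff' := hdiff.varNorm_le (f := fun u => ω₁ (θ u) - ω₂ u) hq0 (by positivity)
  have hsol₁ := (hθ.solvesYoung_comp hp0 hY₁).exponent_mono hp0 hpq.le
  have hsol₂ := SolvesYoung.exponent_mono hp0 hpq.le hY₂
  have hst := hK a (b + δ) (fun u => ω₁ (θ u)) ω₂ ξ ξ _ _ hac (f₁'.exponent_mono hp0 hpq.le)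
    (f₂.exponent_mono hp0 hpq.le)
    ((f₁'.varNorm_exponent_mono hp0 hpq.le).trans
      ((f₁.varNorm_comp_le hp0 hθ.mono hθ.mapsTo).trans hR1))
    ((f₂.varNorm_exponent_mono hp0 hpq.le).trans hR2)
    (fun u hu v hv huv => e.tauInv_monotoneOn hδ hab (hθ.mapsTo hu) (hθ.mapsTo hv)
      (hθ.mono hu hv huv))
    (by
      have i1 := (e.tauInv_mem hδ.le hab (hθ.mapsTo ⟨hac, le_rfl⟩)).1.2
      have i2 := (e.tauInv_mem hδ.le hab (hθ.mapsTo ⟨le_rfl, hac⟩)).1.1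
      change e.tauInv δ (θ (b + δ)) - e.tauInv δ (θ a) ≤ R
      linarith) hsol₁ hsol₂
  rw [sub_self, norm_zero, zero_add] at hst
  have hVK : 0 ≤ K * varNorm q (fun u => ω₁ (θ u) - ω₂ u) (Icc a (b + δ)) :=
    mul_nonneg hK0 varNorm_nonneg
  have hclY : ∀ u ∈ Icc a (b + δ), ‖Y₁ (θ u) - Y₂ u‖ ≤ ε := fun u hu => by
    have j1 := (hst.hasFinVar (f := fun u => Y₁ (θ u) - Y₂ u) hq0 hVK).norm_sub_le hq0
      ⟨le_rfl, hac⟩ hu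
    have j2 := hst.varNorm_le (f := fun u => Y₁ (θ u) - Y₂ u) hq0 hVK
    rw [hsol₁.initial hac, hsol₂.initial hac, sub_self, sub_zero] at j1
    have j3 := mul_le_mul_of_nonneg_left hdiff' hK0
    linarith [hε'.1]
  obtain ⟨ρ, hρ⟩ := hθ3 t ht
  refine ⟨ρ, fun s => ?_⟩
  rw [e.collapse_eq, e.collapse_eq, ← hρ s]
  exact hclY _ (e.pos_mem hδ.le ht s.2)

theorem isReparam (h : IsYoungCoeff p A B α M) (hab : a ≤ b) {ξ : RSp m}
    {φ₁ φ₂ : PrePVarPath p a b d} (hφ : φ₁ ≈ φ₂) {e₁ e₂ : Marks a b}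
    (h₁ : IsMarkSet a b φ₁.1.val e₁.support) (h₂ : IsMarkSet a b φ₂.1.val e₂.support) (hδ : 0 < δ)
    (hδ' : 0 < δ') {Y₁ Y₂ : ℝ → RSp m} (hY₁ : IsExtSolution p A B ξ φ₁.1.val e₁ δ Y₁)
    (hY₂ : IsExtSolution p A B ξ φ₂.1.val e₂ δ' Y₂) {t : ℝ} (ht : t ∈ Icc a b) :
    IsReparam (e₁.collapse δ Y₁ t) (e₂.collapse δ' Y₂ t) := by
  obtain ⟨e, g₁, g₂⟩ := φ₁.1.exists_common_marks hab φ₂.1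
  obtain ⟨Z₁, hZ₁⟩ := h.exists_isExtSolution hab ξ φ₁ g₁ one_pos
  obtain ⟨Z₂, hZ₂⟩ := h.exists_isExtSolution hab ξ φ₂ g₂ one_pos
  exact (h.isReparam_of_common hab hφ g₁ g₂ one_pos hZ₁ hZ₂ ht).congr
    (fun s hs => h.collapse_eq hab h₁ g₁ hδ one_pos hY₁ hZ₁ ht hs)
    (fun s hs => h.collapse_eq hab h₂ g₂ hδ' one_pos hY₂ hZ₂ ht hs)

theorem exists_isSolutionMap (h : IsYoungCoeff p A B α M) (hab : a ≤ b) :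
    ∃ S : RSp m → DecPath p a b d → DecPath p a b m, IsSolutionMap A B S := by
  have hp0 : 0 < p := by linarith [h.one_le]
  have hex : ∀ (ξ : RSp m) (c : DecPath p a b d), ∃ (e : Marks a b) (Y : ℝ → RSp m),
      IsMarkSet a b (Quotient.out c).1.val e.support ∧
        IsExtSolution p A B ξ (Quotient.out c).1.val e 1 Y := fun ξ c => by
    obtain ⟨e, he, -⟩ := (Quotient.out c).1.exists_common_marks hab (Quotient.out c).1
    obtain ⟨Y, hY⟩ := h.exists_isExtSolution hab ξ (Quotient.out c) he one_pos
    exact ⟨e, Y, he, hY⟩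
  choose e Y he hY using hex
  refine ⟨fun ξ c => DecPath.mk ((e ξ c).collapsePath hp0 hab one_pos (Y ξ c) (hY ξ c).1
    (hY ξ c).2.1), fun ξ φ g hg δ hδ Z hZ => ⟨g.collapsePath hp0 hab hδ Z hZ.1 hZ.2.1,
    fun _ _ _ _ => rfl, g.isMarkSet_collapse hδ hZ.1, g.ext_collapse hδ hab Z, ?_⟩⟩
  refine Quotient.sound ((equiv_iff_isReparam _ _).2 fun t ht => ?_)
  have hφ : φ ≈ Quotient.out (DecPath.mk φ) := Setoid.symm (Quotient.mk_out φ)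
  exact h.isReparam hab hφ hg (he _ _) hδ one_pos hZ (hY _ _) ht

theorem isSolutionMap_unique (h : IsYoungCoeff p A B α M) (hab : a ≤ b)
    {S S' : RSp m → DecPath p a b d → DecPath p a b m} (hS : IsSolutionMap A B S)
    (hS' : IsSolutionMap A B S') : S = S' := by
  funext ξ c
  obtain ⟨φ, rfl⟩ : ∃ φ, DecPath.mk φ = c := Quotient.exists_rep c
  obtain ⟨e, he, -⟩ := φ.1.exists_common_marks hab φ.1
  obtain ⟨Y, hY⟩ := h.exists_isExtSolution hab ξ φ he one_pos
  obtain ⟨X, hX, -, -, hXS⟩ := hS ξ φ e he 1 one_pos Y hY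
  obtain ⟨X', hX', -, -, hXS'⟩ := hS' ξ φ e he 1 one_pos Y hY
  rw [← hXS, ← hXS']
  exact Quotient.sound ((equiv_iff_isReparam _ _).2 fun t ht =>
    (IsReparam.refl (e.collapse 1 Y t)).congr (fun s hs => hX t ht s hs)
      (fun s hs => hX' t ht s hs))

end IsYoungCoeff

end Extended

/-! ### Local Hölder continuity of the solution map -/

section Sigma

variable {E : Type*} [NormedAddCommGroup E] {p a c s D : ℝ} {h₁ h₂ : ℝ → E}

theorem isTimeChange_orderIso (hac : a ≤ c) (ρ : Icc a c ≃o Icc a c) :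
    IsTimeChange a c c (fun u => (ρ (projIcc a c hac u) : ℝ)) where
  mono _ _ _ _ h := ρ.monotone (monotone_projIcc hac h)
  mapsTo _ _ := (ρ _).2
  surjOn v hv := ⟨ρ.symm ⟨v, hv⟩, (ρ.symm ⟨v, hv⟩).2, by simp⟩

theorem exists_orderIso_of_sigmaPVar_lt (hp : 0 < p) (hac : a ≤ c)
    (h : sigmaPVar p a c h₁ h₂ < ENNReal.ofReal s) : ∃ ρ : Icc a c ≃o Icc a c,
      (∀ u : Icc a c, |(ρ u : ℝ) - u| ≤ s) ∧
      SumLE p (fun x y => ‖(h₁ (ρ (projIcc a c hac y)) - h₂ y) -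
        (h₁ (ρ (projIcc a c hac x)) - h₂ x)‖) (Icc a c) s := by
  have hs : 0 < s := ENNReal.ofReal_pos.1 ((zero_le).trans_lt h)
  obtain ⟨ρ, hρ⟩ := iInf_lt_iff.1 h
  obtain ⟨h1, h2⟩ := max_lt_iff.1 hρ
  refine ⟨ρ, fun u => ?_, ?_⟩
  · have h3 := (le_iSup (fun t : Icc a c => edist (ρ t : ℝ) (t : ℝ)) u).trans h1.le
    rwa [edist_dist, Real.dist_eq, ENNReal.ofReal_le_ofReal_iff hs.le] at h3
  · refine (pVar_le_ofReal_iff (f := fun u => h₁ (ρ (projIcc a c hac u)) - h₂ u) hp hs.le).1 ?_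
    simp only [projIcc_val]
    exact le_add_self.trans h2.le

theorem sigmaPVar_le (hp : 0 < p) (hac : a ≤ c) (hD : 0 ≤ D) (ρ : Icc a c ≃o Icc a c)
    (h1 : ∀ u : Icc a c, |(ρ u : ℝ) - u| ≤ s)
    (h2 : SumLE p (fun x y => ‖(h₁ (ρ (projIcc a c hac y)) - h₂ y) -
        (h₁ (ρ (projIcc a c hac x)) - h₂ x)‖) (Icc a c) D) :
    sigmaPVar p a c h₁ h₂ ≤ ENNReal.ofReal (max s (‖h₁ a - h₂ a‖ + D)) := by
  refine iInf_le_of_le ρ (max_le (iSup_le fun u => ?_) ?_)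
  · rw [edist_dist, Real.dist_eq]
    exact ENNReal.ofReal_le_ofReal ((h1 u).trans (le_max_left _ _))
  · refine le_trans ?_ (ENNReal.ofReal_le_ofReal (le_max_right _ _))
    rw [ENNReal.ofReal_add (norm_nonneg _) hD, edist_dist, dist_eq_norm]
    have h3 := (pVar_le_ofReal_iff (f := fun u => h₁ (ρ (projIcc a c hac u)) - h₂ u) hp hD).2 h2
    simp only [projIcc_val] at h3
    exact add_le_add le_rfl h3

theorem sigmaPVar_congr (hac : a ≤ c) {g₁ g₂ : ℝ → E} (e₁ : EqOn g₁ h₁ (Icc a c))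
    (e₂ : EqOn g₂ h₂ (Icc a c)) : sigmaPVar p a c g₁ g₂ = sigmaPVar p a c h₁ h₂ := by
  unfold sigmaPVar
  rw [e₁ ⟨le_rfl, hac⟩, e₂ ⟨le_rfl, hac⟩]
  refine iInf_congr fun ρ => ?_
  congr 3
  funext u
  rw [e₁ (ρ u).2, e₂ u.2]

end Sigma

theorem exists_rep_of_alphaPVar_lt {p a b : ℝ} {n : ℕ} {c₁ c₂ : DecPath p a b n} {x : ℝ≥0∞}
    (h : alphaPVar c₁ c₂ < x) : ∃ (φ₁ φ₂ : PrePVarPath p a b n) (e₁ e₂ : Marks a b),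
      DecPath.mk φ₁ = c₁ ∧ DecPath.mk φ₂ = c₂ ∧ IsMarkSet a b φ₁.1.val e₁.support ∧
      IsMarkSet a b φ₂.1.val e₂.support ∧
      ∀ᶠ δ in 𝓝[>] (0 : ℝ),
        sigmaPVar p a (b + δ) (e₁.ext δ φ₁.1.val) (e₂.ext δ φ₂.1.val) < x := by
  simp only [alphaPVar, iInf_lt_iff] at h
  obtain ⟨φ₁, φ₂, h₁, h₂, e₁, e₂, m₁, m₂, hlt⟩ := h
  exact ⟨φ₁, φ₂, e₁, e₂, h₁, h₂, m₁, m₂, eventually_lt_of_limsup_lt hlt⟩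

/-- The `p`-variation is bounded on balls of the decorated path space. -/
theorem exists_varNorm_le_of_alphaPVar_lt {p a b : ℝ} {n : ℕ} (hp : 1 ≤ p) (hab : a ≤ b)
    (c₀ : DecPath p a b n) : ∃ V : ℝ, 0 ≤ V ∧ ∀ φ : PrePVarPath p a b n,
      alphaPVar (DecPath.mk φ) c₀ < 1 → ∀ e : Marks a b, IsMarkSet a b φ.1.val e.support →
      ∀ δ : ℝ, 0 < δ → varNorm p (e.ext δ φ.1.val) (Icc a (b + δ)) ≤ V := by
  have hp0 : 0 < p := by linarith
  obtain ⟨φ₀, rfl⟩ : ∃ φ₀, DecPath.mk φ₀ = c₀ := Quotient.exists_rep c₀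
  obtain ⟨e₀, he₀, -⟩ := φ₀.1.exists_common_marks hab φ₀.1
  refine ⟨1 + varNorm p (e₀.ext 1 φ₀.1.val) (Icc a (b + 1)),
    add_nonneg zero_le_one varNorm_nonneg, fun φ hφ e he δ hδ => ?_⟩
  obtain ⟨φ₁, φ₂, e₁, e₂, h₁, h₂, m₁, m₂, hev⟩ := exists_rep_of_alphaPVar_lt hφ
  obtain ⟨δ', hσ, hδ'⟩ := (hev.and self_mem_nhdsWithin).exists
  have hδ'0 : 0 < δ' := hδ'
  have hac : a ≤ b + δ' := by linarith
  rw [← ENNReal.ofReal_one] at hσ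
  obtain ⟨ρ, -, hρ⟩ := exists_orderIso_of_sigmaPVar_lt hp0 hac hσ
  have hθ := isTimeChange_orderIso hac ρ
  have f₁ := φ₁.hasFinVar_ext m₁ hδ'0
  have f₂ := φ₂.hasFinVar_ext m₂ hδ'0
  have key := hρ.norm_add hp zero_le_one varNorm_nonneg (f₂.sumLE hp0)
  simp only [sub_add_cancel] at key
  have h3 := key.varNorm_le (f := fun u => e₁.ext δ' φ₁.1.val (ρ (projIcc a (b + δ') hac u))) hp0
    (add_nonneg zero_le_one varNorm_nonneg)
  rw [varNorm_comp_eq hp0 hθ.mono hθ.surjOn hθ.mapsTo f₁] at h3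
  have h4 := varNorm_ext_le_of_equiv hp0 hab hδ'0 (Quotient.exact h₁) hδ m₁ he
  have h5 := varNorm_ext_le_of_equiv hp0 hab one_pos (Setoid.symm (Quotient.exact h₂)) hδ'0 he₀ m₂
  linarith

section Continuity

variable {m d : ℕ} {a b p α M : ℝ} {A : RSp m → RSp m} {B : RSp m → RSp d →L[ℝ] RSp m}

namespace IsYoungCoeff

/-- Distances between solutions are computed from the solutions of the extended equations. -/
theorem alphaPVar_le (h : IsYoungCoeff p A B α M) (hab : a ≤ b)
    {S : RSp m → DecPath p a b d → DecPath p a b m} (hS : IsSolutionMap A B S) {ξ₁ ξ₂ : RSp m}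
    {φ₁ φ₂ : PrePVarPath p a b d} {e₁ e₂ : Marks a b} (he₁ : IsMarkSet a b φ₁.1.val e₁.support)
    (he₂ : IsMarkSet a b φ₂.1.val e₂.support) {x : ℝ≥0∞}
    (hx : ∀ᶠ δ in 𝓝[>] (0 : ℝ), 0 < δ → ∀ Y₁ Y₂ : ℝ → RSp m,
      IsExtSolution p A B ξ₁ φ₁.1.val e₁ δ Y₁ → IsExtSolution p A B ξ₂ φ₂.1.val e₂ δ Y₂ →
        sigmaPVar p a (b + δ) Y₁ Y₂ ≤ x) :
    alphaPVar (S ξ₁ (DecPath.mk φ₁)) (S ξ₂ (DecPath.mk φ₂)) ≤ x := by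
  -- a representative built with `δ = 1` has all the solutions `X^δ` as its extensions
  have key : ∀ {ξ : RSp m} {φ : PrePVarPath p a b d} {e : Marks a b},
      IsMarkSet a b φ.1.val e.support → ∃ X : PrePVarPath p a b m,
        IsMarkSet a b X.1.val e.support ∧ DecPath.mk X = S ξ (DecPath.mk φ) ∧
        ∀ δ : ℝ, 0 < δ → ∃ Y, IsExtSolution p A B ξ φ.1.val e δ Y ∧
          EqOn (e.ext δ X.1.val) Y (Icc a (b + δ)) := by
    intro ξ φ e he
    obtain ⟨Y, hY⟩ := h.exists_isExtSolution hab ξ φ he one_pos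
    obtain ⟨X, hX, hm, -, hXS⟩ := hS ξ φ e he 1 one_pos Y hY
    refine ⟨X, hm, hXS, fun δ hδ => ?_⟩
    obtain ⟨Z, hZ⟩ := h.exists_isExtSolution hab ξ φ he hδ
    refine ⟨Z, hZ, fun u hu => ?_⟩
    rw [e.ext_congr hδ hab (ψ := e.collapse δ Z) (fun t ht s hs => ?_) hu,
      e.ext_collapse hδ hab Z hu]
    rw [hX t ht s hs]
    exact h.collapse_eq hab he he one_pos hδ hY hZ ht hs
  obtain ⟨X₁, m₁, c₁, hX₁⟩ := key (ξ := ξ₁) he₁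
  obtain ⟨X₂, m₂, c₂, hX₂⟩ := key (ξ := ξ₂) he₂
  refine (iInf_le_of_le X₁ <| iInf_le_of_le X₂ <| iInf_le_of_le c₁ <| iInf_le_of_le c₂ <|
    iInf_le_of_le e₁ <| iInf_le_of_le e₂ <| iInf_le_of_le m₁ <| iInf_le _ m₂).trans ?_
  refine limsup_le_of_le (h := ?_)
  filter_upwards [hx, self_mem_nhdsWithin] with δ hδ hδ0
  have hδ0' : 0 < δ := hδ0
  obtain ⟨Y₁, hY₁, q₁⟩ := hX₁ δ hδ0'
  obtain ⟨Y₂, hY₂, q₂⟩ := hX₂ δ hδ0'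
  rw [sigmaPVar_congr (by linarith) q₁ q₂]
  exact hδ hδ0' Y₁ Y₂ hY₁ hY₂

/-- The difference of two time components is uniformly small but only bounded in `1`-variation;
interpolation yields the Hölder exponent `1 - 1 / p`. -/
theorem exists_sigmaPVar_le (h : IsYoungCoeff p A B α M) (hp1 : 1 < p) (hab : a ≤ b) (V : ℝ) :
    ∃ C : ℝ, 0 ≤ C ∧ ∀ (ξ₁ ξ₂ : RSp m) (φ₁ φ₂ : PrePVarPath p a b d) (e₁ e₂ : Marks a b),
      IsMarkSet a b φ₁.1.val e₁.support → IsMarkSet a b φ₂.1.val e₂.support →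
      ∀ (δ s : ℝ), 0 < δ → δ ≤ s → s ≤ 1 →
        varNorm p (e₁.ext δ φ₁.1.val) (Icc a (b + δ)) ≤ V →
        varNorm p (e₂.ext δ φ₂.1.val) (Icc a (b + δ)) ≤ V → ‖ξ₁ - ξ₂‖ ≤ s →
        sigmaPVar p a (b + δ) (e₁.ext δ φ₁.1.val) (e₂.ext δ φ₂.1.val) < ENNReal.ofReal s →
        ∀ Y₁ Y₂ : ℝ → RSp m,
          IsExtSolution p A B ξ₁ φ₁.1.val e₁ δ Y₁ → IsExtSolution p A B ξ₂ φ₂.1.val e₂ δ Y₂ →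
          sigmaPVar p a (b + δ) Y₁ Y₂ ≤ ENNReal.ofReal (C * s ^ (1 - 1 / p)) := by
  have hp := h.one_le
  have hp0 : 0 < p := by linarith
  have hη0 : 0 < 1 - 1 / p := by rw [sub_pos, div_lt_one hp0]; exact hp1
  have hη1 : 1 - 1 / p ≤ 1 := by
    have : 0 < 1 / p := by positivity
    linarith
  obtain ⟨K, hK0, hK⟩ := young_stability h.field hp h.lt_two h.pos h.le_one h.lt_one_add
    (b - a + max V 0)
  have hL : 0 ≤ b - a := sub_nonneg.2 hab
  set Λ : ℝ := (4 : ℝ) ^ (1 - 1 / p) * (b - a + (b - a)) ^ (1 / p) with hΛ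
  have hΛ0 : 0 ≤ Λ := by positivity
  refine ⟨1 + K * (2 + Λ), by positivity, ?_⟩
  intro ξ₁ ξ₂ φ₁ φ₂ e₁ e₂ m₁ m₂ δ s hδ hδs hs1 hV₁ hV₂ hξ hσ Y₁ Y₂ hY₁ hY₂
  have hs0 : 0 < s := hδ.trans_le hδs
  have hac : a ≤ b + δ := by linarith
  obtain ⟨ρ, hρ1, hρ2⟩ := exists_orderIso_of_sigmaPVar_lt hp0 hac hσ
  have hθ := isTimeChange_orderIso hac ρ
  set θ : ℝ → ℝ := fun u => (ρ (projIcc a (b + δ) hac u) : ℝ) with hθ_def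
  have hθu : ∀ u ∈ Icc a (b + δ), |θ u - u| ≤ s := fun u hu => by
    simpa only [hθ_def, projIcc_of_mem hac hu] using hρ1 ⟨u, hu⟩
  obtain ⟨f₁, g₁⟩ := e₁.hasFinVar_driver hp hδ hab (φ₁.hasFinVar_ext m₁ hδ)
  obtain ⟨f₂, g₂⟩ := e₂.hasFinVar_driver hp hδ hab (φ₂.hasFinVar_ext m₂ hδ)
  have hV := le_max_left V 0
  -- the time components are `2 s`-close
  have htime : ∀ u ∈ Icc a (b + δ), ‖e₁.tauInv δ (θ u) - e₂.tauInv δ u‖ ≤ 2 * s := fun u hu => by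
    have i1 := e₁.tauInv_le hδ.le hab (hθ.mapsTo hu)
    have i2 := e₂.tauInv_le hδ.le hab hu
    have i3 := abs_le.1 (hθu u hu)
    change e₁.tauInv δ (θ u) ≤ θ u ∧ θ u ≤ e₁.tauInv δ (θ u) + δ at i1
    rw [Real.norm_eq_abs, abs_le]
    constructor <;> linarith [i1.1, i1.2, i2.1, i2.2, i3.1, i3.2]
  have hdt := sumLE_sub_of_norm_le le_rfl hp hL hL (by linarith)
    ((e₁.sumLE_tauInv le_rfl hδ hab).comp hθ.mono hθ.mapsTo) (e₂.sumLE_tauInv le_rfl hδ hab) htime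
  have hpow : (2 * (2 * s)) ^ (1 - 1 / p) * (b - a + (b - a)) ^ (1 / p) =
      Λ * s ^ (1 - 1 / p) := by
    rw [show 2 * (2 * s) = 4 * s by ring, Real.mul_rpow (by norm_num) hs0.le, hΛ]
    ring
  rw [hpow] at hdt
  have hsη : s ≤ s ^ (1 - 1 / p) := by
    conv_lhs => rw [← Real.rpow_one s]
    exact Real.rpow_le_rpow_of_exponent_ge hs0 hs1 hη1
  have hsη0 : 0 ≤ s ^ (1 - 1 / p) := hs0.le.trans hsη
  have hdiff := (hdt.prodMk (f := fun u => e₁.tauInv δ (θ u) - e₂.tauInv δ u)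
    (g := fun u => e₁.ext δ φ₁.1.val (θ u) - e₂.ext δ φ₂.1.val u) hp (by positivity) hs0.le
    hρ2).varNorm_le (f := fun u => e₁.ext δ (fun t s => (t, φ₁.1.val t s)) (θ u) -
      e₂.ext δ (fun t s => (t, φ₂.1.val t s)) u) hp0 (by positivity)
  have hst := hK a (b + δ) (fun u => e₁.ext δ (fun t s => (t, φ₁.1.val t s)) (θ u))
    (e₂.ext δ (fun t s => (t, φ₂.1.val t s))) ξ₁ ξ₂ _ _ hac (f₁.comp hp0 hθ.mono hθ.mapsTo) f₂
    ((f₁.varNorm_comp_le hp0 hθ.mono hθ.mapsTo).trans (by linarith)) (by linarith)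
    (fun u hu v hv huv => e₁.tauInv_monotoneOn hδ hab (hθ.mapsTo hu) (hθ.mapsTo hv)
      (hθ.mono hu hv huv))
    (by
      have i1 := (e₁.tauInv_mem hδ.le hab (hθ.mapsTo ⟨hac, le_rfl⟩)).1.2
      have i2 := (e₁.tauInv_mem hδ.le hab (hθ.mapsTo ⟨le_rfl, hac⟩)).1.1
      change e₁.tauInv δ (θ (b + δ)) - e₁.tauInv δ (θ a) ≤ _
      linarith [le_max_right V 0])
    (hθ.solvesYoung_comp hp0 hY₁) hY₂
  have hfin : K * (‖ξ₁ - ξ₂‖ + varNorm p (fun u => e₁.ext δ (fun t s => (t, φ₁.1.val t s)) (θ u) -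
      e₂.ext δ (fun t s => (t, φ₂.1.val t s)) u) (Icc a (b + δ))) ≤
        K * ((2 + Λ) * s ^ (1 - 1 / p)) :=
    mul_le_mul_of_nonneg_left (by linarith) hK0
  refine (sigmaPVar_le hp0 hac (mul_nonneg hK0 (add_nonneg (norm_nonneg _) varNorm_nonneg)) ρ hρ1
    hst).trans (ENNReal.ofReal_le_ofReal (max_le ?_ ?_))
  · have : 0 ≤ K * ((2 + Λ) * s ^ (1 - 1 / p)) := by positivity
    linarith
  · rw [SolvesYoung.initial hac hY₁, SolvesYoung.initial hac hY₂]
    linarith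

/-- A crude bound, used for data at distance at least `1`. -/
theorem exists_sigmaPVar_le_const (h : IsYoungCoeff p A B α M) (hab : a ≤ b) (V : ℝ) :
    ∃ C : ℝ, 0 ≤ C ∧ ∀ (ξ₁ ξ₂ : RSp m) (φ₁ φ₂ : PrePVarPath p a b d) (e₁ e₂ : Marks a b),
      IsMarkSet a b φ₁.1.val e₁.support → IsMarkSet a b φ₂.1.val e₂.support →
      ∀ δ : ℝ, 0 < δ →
        varNorm p (e₁.ext δ φ₁.1.val) (Icc a (b + δ)) ≤ V →
        varNorm p (e₂.ext δ φ₂.1.val) (Icc a (b + δ)) ≤ V →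
        ∀ Y₁ Y₂ : ℝ → RSp m,
          IsExtSolution p A B ξ₁ φ₁.1.val e₁ δ Y₁ → IsExtSolution p A B ξ₂ φ₂.1.val e₂ δ Y₂ →
          sigmaPVar p a (b + δ) Y₁ Y₂ ≤ ENNReal.ofReal (‖ξ₁ - ξ₂‖ + C) := by
  have hp := h.one_le
  have hp0 : 0 < p := by linarith
  obtain ⟨K, hK0, hK⟩ := SolvesYoung.exists_bound h.field hp h.lt_two h.pos h.le_one h.lt_one_add
    (b - a + max V 0)
  refine ⟨K + K, by positivity, ?_⟩
  intro ξ₁ ξ₂ φ₁ φ₂ e₁ e₂ m₁ m₂ δ hδ hV₁ hV₂ Y₁ Y₂ hY₁ hY₂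
  have hac : a ≤ b + δ := by linarith
  have hbound : ∀ (ξ : RSp m) (φ : PrePVarPath p a b d) (e : Marks a b),
      IsMarkSet a b φ.1.val e.support → varNorm p (e.ext δ φ.1.val) (Icc a (b + δ)) ≤ V →
      ∀ Y, IsExtSolution p A B ξ φ.1.val e δ Y →
        SumLE p (fun s t => ‖Y t - Y s‖) (Icc a (b + δ)) K := fun ξ φ e he hV Y hY => by
    obtain ⟨f, g⟩ := e.hasFinVar_driver hp hδ hab (φ.hasFinVar_ext he hδ)
    refine hK a (b + δ) _ ξ Y hac f (g.trans (by linarith [le_max_left V 0]))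
      (e.tauInv_monotoneOn hδ hab) ?_ hY
    have i1 := (e.tauInv_mem hδ.le hab (⟨hac, le_rfl⟩ : b + δ ∈ Icc a (b + δ))).1.2
    have i2 := (e.tauInv_mem hδ.le hab (⟨le_rfl, hac⟩ : a ∈ Icc a (b + δ))).1.1
    change e.tauInv δ (b + δ) - e.tauInv δ a ≤ _
    linarith [le_max_right V 0]
  have hdiff := (hbound ξ₁ φ₁ e₁ m₁ hV₁ Y₁ hY₁).norm_sub hp hK0 hK0
    (hbound ξ₂ φ₂ e₂ m₂ hV₂ Y₂ hY₂)
  refine (sigmaPVar_le (s := 0) hp0 hac (add_nonneg hK0 hK0) (OrderIso.refl _)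
    (fun u => by simp) (hdiff.congr (f := fun u => Y₁ u - Y₂ u) fun u hu => ?_)).trans
    (ENNReal.ofReal_le_ofReal (max_le (by positivity) ?_))
  · simp only [OrderIso.refl_apply, projIcc_of_mem hac hu]
  · rw [SolvesYoung.initial hac hY₁, SolvesYoung.initial hac hY₂]

/-- For data at distance less than `1` compare representatives that nearly attain the distance and
let the bound tend to it; at distance at least `1` the a priori bound on solutions suffices. -/
theorem locally_holder (h : IsYoungCoeff p A B α M) (hp1 : 1 < p) (hab : a ≤ b)
    {S : RSp m → DecPath p a b d → DecPath p a b m} (hS : IsSolutionMap A B S) (ξ₀ : RSp m)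
    (c₀ : DecPath p a b d) : ∃ C : ℝ≥0, ∀ (ξ₁ ξ₂ : RSp m) (c₁ c₂ : DecPath p a b d),
      edist ξ₁ ξ₀ < 1 → edist ξ₂ ξ₀ < 1 → alphaPVar c₁ c₀ < 1 → alphaPVar c₂ c₀ < 1 →
        alphaPVar (S ξ₁ c₁) (S ξ₂ c₂) ≤
          C * (edist ξ₁ ξ₂ + alphaPVar c₁ c₂) ^ (1 - 1 / p) := by
  have hp0 : 0 < p := by linarith
  have hη0 : 0 < 1 - 1 / p := by rw [sub_pos, div_lt_one hp0]; exact hp1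
  obtain ⟨V, hV0, hV⟩ := exists_varNorm_le_of_alphaPVar_lt h.one_le hab c₀
  obtain ⟨C₁, hC₁, H₁⟩ := h.exists_sigmaPVar_le hp1 hab V
  obtain ⟨C₂, hC₂, H₂⟩ := h.exists_sigmaPVar_le_const hab V
  refine ⟨Real.toNNReal (C₁ + (2 + C₂)), fun ξ₁ ξ₂ c₁ c₂ hξ₁ hξ₂ hc₁ hc₂ => ?_⟩
  change _ ≤ ENNReal.ofReal (C₁ + (2 + C₂)) * _
  set T := edist ξ₁ ξ₂ + alphaPVar c₁ c₂ with hT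
  rcases lt_or_ge T 1 with hT1 | hT1
  · have claim : ∀ x ∈ Ioo T 1, alphaPVar (S ξ₁ c₁) (S ξ₂ c₂) ≤
        ENNReal.ofReal (C₁ + (2 + C₂)) * x ^ (1 - 1 / p) := by
      rintro x ⟨hTx, hx1⟩
      have hxt : x ≠ ⊤ := (hx1.trans ENNReal.one_lt_top).ne
      obtain ⟨s, hs0, rfl⟩ : ∃ s : ℝ, 0 ≤ s ∧ ENNReal.ofReal s = x :=
        ⟨x.toReal, ENNReal.toReal_nonneg, ENNReal.ofReal_toReal hxt⟩
      have hspos : 0 < s := ENNReal.ofReal_pos.1 ((zero_le).trans_lt hTx)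
      have hs1 : s ≤ 1 := by
        rw [← ENNReal.ofReal_le_ofReal_iff zero_le_one, ENNReal.ofReal_one]; exact hx1.le
      have hξ : ‖ξ₁ - ξ₂‖ ≤ s := by
        have := le_self_add.trans hTx.le
        rwa [edist_dist, dist_eq_norm, ENNReal.ofReal_le_ofReal_iff hs0] at this
      obtain ⟨φ₁, φ₂, e₁, e₂, rfl, rfl, m₁, m₂, hev⟩ :=
        exists_rep_of_alphaPVar_lt (le_add_self.trans_lt hTx)
      refine (h.alphaPVar_le hab hS m₁ m₂ (x := ENNReal.ofReal (C₁ * s ^ (1 - 1 / p))) ?_).trans ?_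
      · filter_upwards [hev, Ioo_mem_nhdsGT hspos] with δ hσ hδs hδ Y₁ Y₂ hY₁ hY₂
        exact H₁ ξ₁ ξ₂ φ₁ φ₂ e₁ e₂ m₁ m₂ δ s hδ hδs.2.le hs1 (hV φ₁ hc₁ e₁ m₁ δ hδ)
          (hV φ₂ hc₂ e₂ m₂ δ hδ) hξ hσ Y₁ Y₂ hY₁ hY₂
      · rw [ENNReal.ofReal_rpow_of_nonneg hs0 hη0.le, ← ENNReal.ofReal_mul (by positivity)]
        exact ENNReal.ofReal_le_ofReal (mul_le_mul_of_nonneg_right (by linarith) (by positivity))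
    have hne : (𝓝[>] T).NeBot := nhdsGT_neBot_of_exists_gt ⟨1, hT1⟩
    have hcont : Tendsto (fun x : ℝ≥0∞ => ENNReal.ofReal (C₁ + (2 + C₂)) * x ^ (1 - 1 / p))
        (𝓝[>] T) (𝓝 (ENNReal.ofReal (C₁ + (2 + C₂)) * T ^ (1 - 1 / p))) :=
      (((ENNReal.continuous_const_mul ENNReal.ofReal_ne_top).comp
        ENNReal.continuous_rpow_const).tendsto T).mono_left nhdsWithin_le_nhds
    exact ge_of_tendsto hcont (by
      filter_upwards [Ioo_mem_nhdsGT hT1] with x hx using claim x hx)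
  · obtain ⟨φ₁, rfl⟩ : ∃ φ, DecPath.mk φ = c₁ := Quotient.exists_rep c₁
    obtain ⟨φ₂, rfl⟩ : ∃ φ, DecPath.mk φ = c₂ := Quotient.exists_rep c₂
    obtain ⟨e₁, m₁, -⟩ := φ₁.1.exists_common_marks hab φ₁.1
    obtain ⟨e₂, m₂, -⟩ := φ₂.1.exists_common_marks hab φ₂.1
    refine (h.alphaPVar_le hab hS m₁ m₂ (x := ENNReal.ofReal (C₁ + (2 + C₂))) ?_).trans
      (le_mul_of_one_le_right' (ENNReal.one_le_rpow hT1 hη0))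
    refine Eventually.of_forall fun δ hδ Y₁ Y₂ hY₁ hY₂ =>
      (H₂ ξ₁ ξ₂ φ₁ φ₂ e₁ e₂ m₁ m₂ δ hδ (hV φ₁ hc₁ e₁ m₁ δ hδ) (hV φ₂ hc₂ e₂ m₂ δ hδ) Y₁ Y₂ hY₁
        hY₂).trans (ENNReal.ofReal_le_ofReal ?_)
    rw [← ENNReal.ofReal_one, edist_dist, ENNReal.ofReal_lt_ofReal_iff one_pos] at hξ₁ hξ₂
    have := dist_triangle_right ξ₁ ξ₂ ξ₀
    rw [dist_eq_norm ξ₁ ξ₂] at this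
    linarith

end IsYoungCoeff

end Continuity

end

theorem proposition8p9 (m d : ℕ) (a b p β γ : ℝ) (hab : a < b) (hp1 : 1 ≤ p) (hp2 : p < 2)
    (hβ : 1 < β) (hγ : p < γ) (A : RSp m → RSp m) (B : RSp m → RSp d →L[ℝ] RSp m)
    (hA : IsCGamma β A) (hB : IsCGamma γ B) :
    -- the extended equations are uniquely solvable
    (∀ (ξ : RSp m) (φ : PrePVarPath p a b d) (e : Marks a b), IsMarkSet a b φ.1.val e.support →
      ∀ δ : ℝ, 0 < δ → ∃ Y : ℝ → RSp m, IsExtSolution p A B ξ φ.1.val e δ Y ∧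
        ∀ Y' : ℝ → RSp m, IsExtSolution p A B ξ φ.1.val e δ Y' → EqOn Y' Y (Icc a (b + δ))) ∧
    -- the solution map is well defined
    (∃! S : RSp m → DecPath p a b d → DecPath p a b m, IsSolutionMap A B S) ∧
    -- the solution map is locally Hölder continuous
    (1 < p → ∀ S : RSp m → DecPath p a b d → DecPath p a b m, IsSolutionMap A B S →
      ∃ η : ℝ, 0 < η ∧ η ≤ 1 ∧
        ∀ (ξ₀ : RSp m) (c₀ : DecPath p a b d), ∃ (r : ℝ≥0∞) (C : ℝ≥0), 0 < r ∧
          ∀ (ξ₁ ξ₂ : RSp m) (c₁ c₂ : DecPath p a b d),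
            edist ξ₁ ξ₀ < r → edist ξ₂ ξ₀ < r → alphaPVar c₁ c₀ < r → alphaPVar c₂ c₀ < r →
              alphaPVar (S ξ₁ c₁) (S ξ₂ c₂) ≤ C * (edist ξ₁ ξ₂ + alphaPVar c₁ c₂) ^ η) := by
  obtain ⟨α, M, hα, hα1, hpα, hf⟩ := exists_isYoungField hp1 hβ hγ hp2 hA hB
  have h : IsYoungCoeff p A B α M := ⟨hp1, hα, hα1, hpα, hf⟩
  refine ⟨fun ξ φ e he δ hδ => ?_, ?_, fun hp S hS => ⟨1 - 1 / p, ?_, ?_, fun ξ₀ c₀ => ?_⟩⟩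
  · obtain ⟨Y, hY⟩ := h.exists_isExtSolution hab.le ξ φ he hδ
    exact ⟨Y, hY, fun Y' hY' => h.eqOn hab.le he hδ hY' hY⟩
  · obtain ⟨S, hS⟩ := h.exists_isSolutionMap (d := d) hab.le
    exact ⟨S, hS, fun S' hS' => h.isSolutionMap_unique hab.le hS' hS⟩
  · rw [sub_pos, div_lt_one (by linarith)]
    exact hp
  · have : 0 < 1 / p := by positivity
    linarith
  · obtain ⟨C, hC⟩ := h.locally_holder hp hab.le hS ξ₀ c₀
    exact ⟨1, C, one_pos, hC⟩
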